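/- **Setting.** All functions are complex valued, $\mathbb D\subset\mathbb R^2$ is the unit disc, and $L^2_{rad}(\mathbb D)$ carries the real inner product $\langle f,g\rangle=\mathrm{Re}\int_{\mathbb D}f\bar g$. Let $J_0$ be the Bessel function, $z_1<z_2<\dots$ its positive zeros, $e_n=J_0(z_n|\cdot|)/\|J_0(z_n|\cdot|)\|_{L^2(\mathbb D)}$. For finite $N$ let $E_N$ be the complex span of $e_1,\dots,e_N$, and let $E_\infty=L^2_{rad}(\mathbb D)$; $P_{\le N}$ is the $L^2$-orthogonal projection onto $E_N$. Let $Q$ be the ground state, i.e. the positive, radial, exponentially decaying solution of $\Delta Q+Q^3-Q=0$ on $\mathbb R^2$. For $\delta>0$ put $Q_\delta(x)=\delta^{-1}Q(\delta^{-1}x)$ and $\mathbf Q_\delta(r)=Q_\delta(r)-Q_\delta(1)$. The normal space at $e^{i\theta}\mathbf Q_\delta$ is $$V_{\theta,\delta}=\{v\in L^2_{rad}(\mathbb D):\langle v,-\Delta(e^{i\theta}\partial_\delta\mathbf Q_\delta)\rangle=\langle v,-\Delta(ie^{i\theta}\mathbf Q_\delta)\rangle=0\},$$ and $P_{V_{\theta,\delta}\cap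 E_N}$ is the $\dot H^1$-orthogonal projection of $E_N$ onto $V_{\theta,\delta}\cap E_N$, that is $$P_{V_{\theta,\delta}\cap E_N}v=v-\sum_{t}\frac{\langle v,-\Delta t\rangle}{\langle P_{\le N}t,-\Delta t\rangle}P_{\le N}t,\qquad t\in\{ie^{i\theta}\mathbf Q_\delta,\ e^{i\theta}\partial_\delta\mathbf Q_\delta\}$$ (this formula is also used for $N=\infty$). Finally $$U_\epsilon(\delta_*,\delta^*)=\{u\in L^2_{rad}(\mathbb D):\|u\|_{L^2(\mathbb D)}\le\|Q\|_{L^2(\mathbb R^2)},\ \|u-e^{i\theta}Q_\delta\|_{L^2(\mathbb D)}\le\epsilon\text{ for some }\theta\in\mathbb T,\ \delta\in(\delta_*,\delta^*)\}.$$ **Theorem (Normal bundle decomposition).** There is a constant $C>0$ such that for every $\eta>0$ there is $\epsilon_0>0$ with the following property. For every $0<\epsilon\le\epsilon_0$ there are $\delta^*\in(0,\eta)$ and $K>0$ such that for every dyadic number $N\in\{1,2,4,\dots\}\cup\{\infty\}$ there is $\delta_*$ with $$K^{-1}N^{-1}\le\delta_*\le C N^{-1},\qquad\delta_*<\delta^*$$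 (so $\delta_*=0$ if $N=\infty$), for which the following two statements hold. 1. For all $\bar\theta$ and all $\bar\delta\in(\delta_*,\delta^*)$ there is an open neighborhood $W$ of $(0,1,0)$ in $\mathbb T\times(0,\infty)\times(V_{\bar\theta,\bar\delta}\cap E_N)$ (with the $L^2$ topology) such that $$G(\theta,\delta,v)=P_{\le N}\big(e^{i(\bar\theta+\theta)}\mathbf Q_{\bar\delta\delta}\big)+P_{V_{\bar\theta+\theta,\bar\delta\delta}\cap E_N}v$$ is a $C^\infty$ diffeomorphism from $W$ onto an open subset $G(W)$ of $E_N$, and $$\{u\in E_N:\|u-P_{\le N}(e^{i\bar\theta}\mathbf Q_{\bar\delta})\|_{L^2(\mathbb D)}\le2\epsilon\}\subset G(W).$$ 2. For every $u\in U_\epsilon(\delta_*,\delta^*)$ there are $\theta\in\mathbb T$, $\delta>0$ and $v\in V_{\theta,\delta}\cap E_N$ with $$P_{\le N}u=P_{\le N}(e^{i\theta}\mathbf Q_\delta)+v.$$ -/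

import Mathlib

open MeasureTheory Filter Topology
open scoped ContDiff Laplacian

noncomputable section

namespace SolitonBundle

/-- The plane `ℝ²` with its Euclidean norm. -/
abbrev Plane : Type := EuclideanSpace ℝ (Fin 2)

/-- The (open) unit disc. -/
def disc : Set Plane := Metric.ball 0 1

/-- `L²(𝔻; ℂ)`. It is used as a real Hilbert space: `inner ℝ f g = Re ∫_𝔻 f conj(g)`. -/
abbrev L2Disc : Type := Lp ℂ 2 (volume.restrict disc)

open Classical in
/-- The class in `L²(𝔻)` of a function on the plane (restricted to `𝔻`). The value `0` is used only
when the function is not square integrable on `𝔻`, which never happens for the functions below. -/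
def toL2 (g : Plane → ℂ) : L2Disc :=
  if h : MemLp g 2 (volume.restrict disc) then h.toLp g else 0

/-- `L²_rad(𝔻)`: the elements of `L²(𝔻)` that agree a.e. with a function of `|x|`. -/
def L2rad : Submodule ℝ L2Disc where
  carrier := {u | ∃ f : ℝ → ℂ, ∀ᵐ x ∂(volume.restrict disc), u x = f ‖x‖}
  zero_mem' := ⟨0, by
    filter_upwards [Lp.coeFn_zero ℂ 2 (volume.restrict disc)] with x hx
    rw [hx]; rfl⟩
  add_mem' := by
    rintro u v ⟨f, hf⟩ ⟨g, hg⟩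
    refine ⟨f + g, ?_⟩
    filter_upwards [hf, hg, Lp.coeFn_add u v] with x h1 h2 h3
    rw [h3, Pi.add_apply, Pi.add_apply, h1, h2]
  smul_mem' := by
    rintro c u ⟨f, hf⟩
    refine ⟨c • f, ?_⟩
    filter_upwards [hf, Lp.coeFn_smul c u] with x h1 h2
    rw [h2, Pi.smul_apply, Pi.smul_apply, h1]

theorem isClosed_L2rad : IsClosed (L2rad : Set L2Disc) := by
  rw [← isSeqClosed_iff_isClosed]
  intro u v hu huv
  choose f hf using hu
  obtain ⟨φ, -, hφ⟩ := (tendstoInMeasure_of_tendsto_Lp huv).exists_seq_tendsto_ae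
  refine ⟨fun r => limUnder atTop (fun k => f (φ k) r), ?_⟩
  have hall : ∀ᵐ x ∂(volume.restrict disc), ∀ n, u n x = f n ‖x‖ := ae_all_iff.2 hf
  filter_upwards [hφ, hall] with x h1 h2
  simp only [h2] at h1
  exact h1.limUnder_eq.symm

/-! ### Bessel eigenfunctions of the Dirichlet Laplacian and the spectral cutoff -/

/-- The Bessel function `J₀`. -/
def besselJ0 (r : ℝ) : ℝ :=
  ∑' m : ℕ, (-1 : ℝ) ^ m / ((m.factorial : ℝ) ^ 2) * (r / 2) ^ (2 * m)

/-- For `n ≥ 1`, `besselZero n` is the `n`-th positive zero of `J₀`; `besselZero 0 = 0` is only the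
starting point of the recursion. -/
def besselZero : ℕ → ℝ
  | 0 => 0
  | n + 1 => sInf {r : ℝ | besselZero n < r ∧ besselJ0 r = 0}

/-- `J₀(z_n |x|)` as an element of `L²(𝔻)`. -/
def besselMode (n : ℕ) : L2Disc :=
  toL2 (fun x => (besselJ0 (besselZero n * ‖x‖) : ℂ))

/-- The `L²`-normalized radial eigenfunctions `e_n`, `n ≥ 1`. -/
def eigenfun (n : ℕ) : L2Disc := ‖besselMode n‖⁻¹ • besselMode n

/-- `E_N`: for finite `N` the `2N`-dimensional real span of `e_n, i e_n`, `1 ≤ n ≤ N`;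
for `N = ∞` all of `L²_rad(𝔻)`. -/
def cutoffSpace : ℕ∞ → Submodule ℝ L2Disc
  | none => L2rad
  | some N => Submodule.span ℝ
      (eigenfun '' Set.Icc 1 N ∪ (fun n => Complex.I • eigenfun n) '' Set.Icc 1 N)

instance completeSpace_cutoffSpace (N : ℕ∞) : CompleteSpace (cutoffSpace N) := by
  cases N with
  | top => exact isClosed_L2rad.completeSpace_coe
  | coe N =>
    have hfin : (eigenfun '' Set.Icc 1 N ∪
        (fun n => Complex.I • eigenfun n) '' Set.Icc 1 N).Finite :=
      ((Set.finite_Icc 1 N).image _).union ((Set.finite_Icc 1 N).image _)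
    have : FiniteDimensional ℝ (cutoffSpace (N : ℕ∞)) :=
      FiniteDimensional.span_of_finite ℝ hfin
    exact FiniteDimensional.complete ℝ _

/-- `P_{≤N}`: the `L²`-orthogonal projection onto `E_N` (the identity of `L²_rad(𝔻)` if `N = ∞`). -/
def cutoff (N : ℕ∞) : L2Disc →L[ℝ] cutoffSpace N := (cutoffSpace N).orthogonalProjectionOnto

/-- Dyadic numbers in `[1, ∞]`. -/
def IsDyadic (N : ℕ∞) : Prop := N = ⊤ ∨ ∃ k : ℕ, N = ((2 ^ k : ℕ) : ℕ∞)

/-- `N⁻¹` as a real number, with `∞⁻¹ = 0`. -/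
def invScale : ℕ∞ → ℝ
  | none => 0
  | some N => (N : ℝ)⁻¹

/-! ### The ground state and the soliton manifold -/

/-- `q` is the radial profile, `Q(x) = q(|x|)`, of the ground state: the positive, exponentially
decaying radial classical solution of `ΔQ + Q³ - Q = 0` on `ℝ²`. -/
structure IsGroundState (q : ℝ → ℝ) : Prop where
  contDiff : ContDiff ℝ 2 (fun x : Plane => q ‖x‖)
  pos : ∀ r : ℝ, 0 ≤ r → 0 < q r
  equation : ∀ x : Plane, (Δ (fun y : Plane => q ‖y‖)) x + q ‖x‖ ^ 3 - q ‖x‖ = 0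
  decay : ∃ A c : ℝ, 0 < c ∧ ∀ r : ℝ, 0 ≤ r → q r ≤ A * Real.exp (-c * r)

/-- `‖Q‖_{L²(ℝ²)}`. -/
def massNorm (q : ℝ → ℝ) : ℝ := Real.sqrt (∫ x : Plane, q ‖x‖ ^ 2)

/-- The radial profile of `Q_δ = δ⁻¹ Q(δ⁻¹ ·)`. -/
def rescaled (q : ℝ → ℝ) (δ r : ℝ) : ℝ := δ⁻¹ * q (δ⁻¹ * r)

/-- The radial profile of `𝐐_δ = Q_δ - Q_δ(1)`, which vanishes on the unit circle. -/
def bold (q : ℝ → ℝ) (δ r : ℝ) : ℝ := rescaled q δ r - rescaled q δ 1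

/-- The radial profile of `∂_δ 𝐐_δ`. -/
def boldDeriv (q : ℝ → ℝ) (δ r : ℝ) : ℝ := deriv (fun s => bold q s r) δ

/-- The phase `e^{iθ}`. -/
def phase (θ : ℝ) : ℂ := Complex.exp (θ * Complex.I)

/-- `e^{iθ} Q_δ`, restricted to the disc. -/
def fullSoliton (q : ℝ → ℝ) (θ δ : ℝ) : L2Disc :=
  toL2 (fun x => phase θ * (rescaled q δ ‖x‖ : ℂ))

/-- `e^{iθ} 𝐐_δ`. -/
def soliton (q : ℝ → ℝ) (θ δ : ℝ) : L2Disc :=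
  toL2 (fun x => phase θ * (bold q δ ‖x‖ : ℂ))

/-- The tangent vector `i e^{iθ} 𝐐_δ = ∂_θ (e^{iθ} 𝐐_δ)`, as a function. -/
def tangentPhase (q : ℝ → ℝ) (θ δ : ℝ) (x : Plane) : ℂ :=
  Complex.I * phase θ * (bold q δ ‖x‖ : ℂ)

/-- The tangent vector `e^{iθ} ∂_δ 𝐐_δ = ∂_δ (e^{iθ} 𝐐_δ)`, as a function. -/
def tangentScale (q : ℝ → ℝ) (θ δ : ℝ) (x : Plane) : ℂ :=
  phase θ * (boldDeriv q δ ‖x‖ : ℂ)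

/-- `-Δ g` as an element of `L²(𝔻)`. -/
def negLaplacian (g : Plane → ℂ) : L2Disc := toL2 (fun x => -(Δ g) x)

/-- The normal space
`V_{θ,δ} = {v ∈ L²_rad(𝔻) : ⟨v, -Δ(e^{iθ} ∂_δ 𝐐_δ)⟩ = ⟨v, -Δ(i e^{iθ} 𝐐_δ)⟩ = 0}`. -/
def normalSpace (q : ℝ → ℝ) (θ δ : ℝ) : Submodule ℝ L2Disc where
  carrier := {v | v ∈ L2rad ∧ inner ℝ v (negLaplacian (tangentScale q θ δ)) = 0 ∧
    inner ℝ v (negLaplacian (tangentPhase q θ δ)) = 0}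
  zero_mem' := ⟨L2rad.zero_mem, inner_zero_left _, inner_zero_left _⟩
  add_mem' := by
    rintro u v ⟨h1, h2, h3⟩ ⟨k1, k2, k3⟩
    exact ⟨L2rad.add_mem h1 k1, by rw [inner_add_left, h2, k2, add_zero],
      by rw [inner_add_left, h3, k3, add_zero]⟩
  smul_mem' := by
    rintro c u ⟨h1, h2, h3⟩
    exact ⟨L2rad.smul_mem c h1, by rw [real_inner_smul_left, h2, mul_zero],
      by rw [real_inner_smul_left, h3, mul_zero]⟩

/-- The `Ḣ¹`-coefficient `⟨v, -Δ t⟩ / ⟨P_{≤N} t, -Δ t⟩` of `v ∈ E_N` along `P_{≤N} t`. For `t`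
vanishing on the unit circle, `⟨v, -Δ t⟩` is the `Ḣ¹` inner product of `v` with `P_{≤N} t`. -/
def h1Coeff (N : ℕ∞) (t : Plane → ℂ) (v : cutoffSpace N) : ℝ :=
  inner ℝ (v : L2Disc) (negLaplacian t) /
    inner ℝ (cutoff N (toL2 t) : L2Disc) (negLaplacian t)

/-- `P_{V_{θ,δ} ∩ E_N}`: the `Ḣ¹`-orthogonal projection of `E_N` onto `V_{θ,δ} ∩ E_N`, which removes
the components along the two tangent vectors `P_{≤N}(i e^{iθ} 𝐐_δ)`, `P_{≤N}(e^{iθ} ∂_δ 𝐐_δ)`. These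
are `Ḣ¹`-orthogonal to each other and span the `Ḣ¹`-orthogonal complement of `V_{θ,δ} ∩ E_N`. -/
def normalProj (q : ℝ → ℝ) (N : ℕ∞) (θ δ : ℝ) (v : cutoffSpace N) : cutoffSpace N :=
  v - h1Coeff N (tangentPhase q θ δ) v • cutoff N (toL2 (tangentPhase q θ δ))
    - h1Coeff N (tangentScale q θ δ) v • cutoff N (toL2 (tangentScale q θ δ))

/-- `V_{θ,δ} ∩ E_N`, with the `L²(𝔻)` norm. -/
abbrev normalCutoff (q : ℝ → ℝ) (N : ℕ∞) (θ δ : ℝ) : Submodule ℝ L2Disc :=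
  normalSpace q θ δ ⊓ cutoffSpace N

/-- The map `G(θ, δ, v) = P_{≤N}(e^{i(θ₀+θ)} 𝐐_{δ₀δ}) + P_{V_{θ₀+θ,δ₀δ} ∩ E_N} v` attached to the base
point `e^{iθ₀} 𝐐_{δ₀}`. -/
def bundleMap (q : ℝ → ℝ) (N : ℕ∞) (θ₀ δ₀ : ℝ)
    (p : ℝ × ℝ × normalCutoff q N θ₀ δ₀) : cutoffSpace N :=
  cutoff N (soliton q (θ₀ + p.1) (δ₀ * p.2.1)) +
    normalProj q N (θ₀ + p.1) (δ₀ * p.2.1) ⟨(p.2.2 : L2Disc), p.2.2.2.2⟩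

/-- The segment `U_ε(δ₁, δ₂)` of the `ε`-neighbourhood of the soliton manifold. -/
def neighborhood (q : ℝ → ℝ) (ε δ₁ δ₂ : ℝ) : Set L2Disc :=
  {u | u ∈ L2rad ∧ ‖u‖ ≤ massNorm q ∧
    ∃ θ : ℝ, ∃ δ ∈ Set.Ioo δ₁ δ₂, ‖u - fullSoliton q θ δ‖ ≤ ε}

end SolitonBundle

end

/-! The chart comes from a quantitative inverse function theorem. After rescaling, write `tᵢ` for
the two tangent vectors projected to `E_N` and `nᵢ` for the projections of their negative
Laplacians; the `Ḣ¹` projection then only involves `L²` pairings with `nᵢ`. Since `v` is orthogonal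
to both `nᵢ` at the base point, the components of `v` that `G` removes are of second order, and the
derivative of `G` there is `(θ, s, v) ↦ θ t₁ + s t₂ + v`. The cross pairings `⟨t₁, n₂⟩`, `⟨t₂, n₁⟩`
vanish, because up to the common phase one direction is real and the other imaginary. So the
linearization is inverted with a bound depending only on an upper bound `M` for the size and
Lipschitz constants of the frame and a lower bound `μ` for `⟨tᵢ, nᵢ⟩`. `exists_frame_chart` then
covers a ball of radius comparable to `μ⁴ / M⁸`, whatever `N`, `θ` and `δ` are.

Upper bounds come from scaling. All frame vectors are `L²`-critical rescalings `δ⁻¹ h(r / δ)`, up to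
constants, of fixed exponentially decaying profiles generated by `q` and `r q'`. This class is
stable under `r d/dr`, which gives smoothness in `δ`, and norms are uniform in `δ`
(`Profile.exists_isTameCurve`).

The lower bound is the analytic core (`exists_coercive`). For `N = ∞` the pairing `⟨t, -Δt⟩` is a
Dirichlet energy. For finite `N`, Green's identity diagonalizes it as a sum of nonnegative terms,
one for each Bessel mode. A mode with `z_n δ` small is nearly constant on the scale `δ` where `t`
lives, so its coefficient is about `δ ∫ ψ r dr`, and this integral is nonzero for both `ψ = q` and
`ψ = q + r q'`. With `n ≤ z_n ≤ 4n` and `‖J₀(z_n |·|)‖² ≲ 1 / z_n`, such a mode contributes at least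
a multiple of `δ⁴ n³`. Summing over `n ≲ 1/δ` gives a constant once `N δ ≳ 1`, and the first mode
alone always gives `δ⁴`. The facts on `J₀` follow from its equation by monotone energies and Sturm
comparison.

With `δ_* = min(N⁻¹, δ^*/2)` both regimes yield `μ` of order `(δ^*)⁴`, so the chart radius is of
order `(δ^*)¹⁶`. The difference between `Q_δ` and `𝐐_δ` is `Q_δ(1)`, smaller than any power of `δ`,
so points near `e^{iθ} Q_δ` also lie in the image of a chart, which is the second statement. -/

noncomputable section

namespace SolitonBundle

/-! ### Tubular charts along a tame two-parameter family of frames -/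

section Chart

open scoped RealInnerProductSpace

variable {H V : Type*} [NormedAddCommGroup H] [InnerProductSpace ℝ H]
  [NormedAddCommGroup V] [NormedSpace ℝ V]

/-- The parameter domain: pairs `(θ, s)` near `(0, 1)`. -/
def paramBall : Set (ℝ × ℝ) := Metric.ball (0, 1) (1 / 2)

theorem base_mem_paramBall : ((0, 1) : ℝ × ℝ) ∈ paramBall :=
  Metric.mem_ball_self (by norm_num)

/-- Smooth maps on the parameter domain which are bounded and Lipschitz with constant `M`. -/
structure IsTame (M : ℝ) (f : ℝ × ℝ → H) : Prop where
  contDiffOn : ContDiffOn ℝ ∞ f paramBall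
  norm_le : ∀ a ∈ paramBall, ‖f a‖ ≤ M
  lipschitz : ∀ a ∈ paramBall, ∀ b ∈ paramBall, ‖f a - f b‖ ≤ M * ‖a - b‖

/-- The component of `v` along `t a` that is removed by the projection onto `(n a)ᗮ`. -/
def frameComponent (t n : ℝ × ℝ → H) (a : ℝ × ℝ) (v : H) : H :=
  (⟪v, n a⟫ / ⟪t a, n a⟫) • t a

/-- Because `v` and `w` are orthogonal to `n (0, 1)`, pairing `v - w` with `n a` only sees `n a - n
(0, 1)`, which has size `M ρ`. Hence the dependence on the vector carries a small factor `ρ` and the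
dependence on the parameter a factor `‖w‖`: the removed components do not affect the linearization.
-/
theorem norm_frameComponent_sub_le {M μ ρ : ℝ} (hM : 1 ≤ M) (hμ : 0 < μ) (hμ1 : μ ≤ 1)
    {t n : ℝ × ℝ → H} (ht : IsTame M t) (hn : IsTame M n)
    (hm : ∀ a ∈ paramBall, μ ≤ ⟪t a, n a⟫) {a b : ℝ × ℝ} (ha : a ∈ paramBall) (hb : b ∈ paramBall)
    (hρ : ‖a - (0, 1)‖ ≤ ρ) {v w : H} (hv : ⟪v, n (0, 1)⟫ = 0) (hw : ⟪w, n (0, 1)⟫ = 0) :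
    ‖frameComponent t n a v - frameComponent t n b w‖ ≤
      7 * M ^ 4 / μ ^ 2 * (ρ * ‖v - w‖ + ‖w‖ * ‖a - b‖) := by
  have hM0 : 0 < M := by linarith
  have hma := hm a ha
  have hmb := hm b hb
  have hma0 : 0 < ⟪t a, n a⟫ := by linarith
  have hmb0 : 0 < ⟪t b, n b⟫ := by linarith
  have hd := norm_nonneg (a - b)
  have hwn := norm_nonneg w
  have hvw := norm_nonneg (v - w)
  have h0 := base_mem_paramBall
  have hρ0 : 0 ≤ ρ := (norm_nonneg _).trans hρ
  have cs := fun x y : H => abs_real_inner_le_norm x y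
  have hwb : |⟪w, n b⟫| ≤ ‖w‖ * M :=
    (cs w (n b)).trans (mul_le_mul_of_nonneg_left (hn.norm_le b hb) hwn)
  have hmdiff : |⟪t a, n a⟫ - ⟪t b, n b⟫| ≤ 2 * M ^ 2 * ‖a - b‖ := by
    have e : ⟪t a, n a⟫ - ⟪t b, n b⟫ = ⟪t a - t b, n a⟫ + ⟪t b, n a - n b⟫ := by
      rw [inner_sub_left, inner_sub_right]; ring
    rw [e]
    refine (abs_add_le _ _).trans ?_
    have h1 : |⟪t a - t b, n a⟫| ≤ (M * ‖a - b‖) * M := (cs _ _).trans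
      (mul_le_mul (ht.lipschitz a ha b hb) (hn.norm_le a ha) (norm_nonneg _) (by positivity))
    have h2 : |⟪t b, n a - n b⟫| ≤ M * (M * ‖a - b‖) := (cs _ _).trans
      (mul_le_mul (ht.norm_le b hb) (hn.lipschitz a ha b hb) (norm_nonneg _) (by positivity))
    nlinarith
  have hinv : |(⟪t a, n a⟫)⁻¹ - (⟪t b, n b⟫)⁻¹| ≤ 2 * M ^ 2 * ‖a - b‖ / μ ^ 2 := by
    have e : (⟪t a, n a⟫)⁻¹ - (⟪t b, n b⟫)⁻¹ =
        -(⟪t a, n a⟫ - ⟪t b, n b⟫) / (⟪t a, n a⟫ * ⟪t b, n b⟫) := by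
      field_simp; ring
    rw [e, abs_div, abs_neg, abs_of_pos (mul_pos hma0 hmb0)]
    refine div_le_div₀ (by positivity) hmdiff (by positivity) ?_
    rw [pow_two]; exact mul_le_mul hma hmb hμ.le hma0.le
  have hia : (⟪t a, n a⟫)⁻¹ ≤ μ⁻¹ := inv_anti₀ hμ hma
  have hib : (⟪t b, n b⟫)⁻¹ ≤ μ⁻¹ := inv_anti₀ hμ hmb
  have hia0 : 0 < (⟪t a, n a⟫)⁻¹ := inv_pos.2 hma0
  have hib0 : 0 < (⟪t b, n b⟫)⁻¹ := inv_pos.2 hmb0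
  have hμi : 1 ≤ μ⁻¹ := (one_le_inv₀ hμ).2 hμ1
  set k := μ⁻¹ with hk
  have hscal : |⟪v, n a⟫ / ⟪t a, n a⟫ - ⟪w, n b⟫ / ⟪t b, n b⟫| ≤
      ‖v - w‖ * (M * ρ) * k + ‖w‖ * (M * ‖a - b‖) * k
        + ‖w‖ * M * (2 * M ^ 2 * ‖a - b‖ * k ^ 2) := by
    -- Telescoping in the vector, then in the normal, then in the denominator; `hv` and `hw` allow
    -- `n (0, 1)` to be inserted in the first term.
    have e : ⟪v, n a⟫ / ⟪t a, n a⟫ - ⟪w, n b⟫ / ⟪t b, n b⟫ =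
        ⟪v - w, n a - n (0, 1)⟫ * (⟪t a, n a⟫)⁻¹ + ⟪w, n a - n b⟫ * (⟪t a, n a⟫)⁻¹
          + ⟪w, n b⟫ * ((⟪t a, n a⟫)⁻¹ - (⟪t b, n b⟫)⁻¹) := by
      simp only [inner_sub_left, inner_sub_right, hv, hw]; ring
    rw [e]
    refine (abs_add_three _ _ _).trans (add_le_add (add_le_add ?_ ?_) ?_)
    · rw [abs_mul, abs_of_pos hia0]
      refine mul_le_mul ?_ hia hia0.le (by positivity)
      refine (cs _ _).trans (mul_le_mul_of_nonneg_left ?_ hvw)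
      exact (hn.lipschitz a ha _ h0).trans (mul_le_mul_of_nonneg_left hρ hM0.le)
    · rw [abs_mul, abs_of_pos hia0]
      refine mul_le_mul ?_ hia hia0.le (by positivity)
      exact (cs _ _).trans (mul_le_mul_of_nonneg_left (hn.lipschitz a ha b hb) hwn)
    · rw [abs_mul]
      refine mul_le_mul hwb ?_ (abs_nonneg _) (by positivity)
      refine hinv.trans (le_of_eq ?_)
      rw [hk]; field_simp
  have hcb : |⟪w, n b⟫ / ⟪t b, n b⟫| ≤ ‖w‖ * M * k := by
    rw [div_eq_mul_inv, abs_mul, abs_of_pos hib0]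
    exact mul_le_mul hwb hib hib0.le (by positivity)
  have e : frameComponent t n a v - frameComponent t n b w =
      (⟪v, n a⟫ / ⟪t a, n a⟫ - ⟪w, n b⟫ / ⟪t b, n b⟫) • t a +
        (⟪w, n b⟫ / ⟪t b, n b⟫) • (t a - t b) := by
    simp only [frameComponent, sub_smul, smul_sub]; abel
  rw [e]
  refine (norm_add_le _ _).trans ?_
  rw [norm_smul, norm_smul, Real.norm_eq_abs, Real.norm_eq_abs]
  have hA := mul_le_mul hscal (ht.norm_le a ha) (norm_nonneg _) (by positivity)
  have hB := mul_le_mul hcb (ht.lipschitz a ha b hb) (norm_nonneg _) (by positivity)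
  refine (add_le_add hA hB).trans ?_
  have e2 : 7 * M ^ 4 / μ ^ 2 = 7 * M ^ 4 * k ^ 2 := by rw [hk]; field_simp
  rw [e2]
  have hMk : 1 ≤ M ^ 2 := one_le_pow₀ hM
  have hp : M ^ 2 * k ≤ M ^ 4 * k ^ 2 := by
    have : 1 ≤ M ^ 2 * k := one_le_mul_of_one_le_of_one_le hMk hμi
    nlinarith
  have hX : 0 ≤ ρ * ‖v - w‖ := by positivity
  have hY : 0 ≤ ‖w‖ * ‖a - b‖ := by positivity
  have i1 := mul_le_mul_of_nonneg_left hp hX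
  have i2 := mul_le_mul_of_nonneg_left hp hY
  have i3 : 0 ≤ M ^ 4 * k ^ 2 * (ρ * ‖v - w‖) := by positivity
  have i4 : 0 ≤ M ^ 4 * k ^ 2 * (‖w‖ * ‖a - b‖) := by positivity
  nlinarith

/-- `(a, v) ↦ F(a) + v - ∑ᵢ (⟪v, nᵢ(a)⟫ / ⟪tᵢ(a), nᵢ(a)⟫) tᵢ(a)`. -/
def frameMap (ι : V → H) (F t₁ t₂ n₁ n₂ : ℝ × ℝ → H) (p : ℝ × ℝ × V) : H :=
  F (p.1, p.2.1) + (ι p.2.2 - frameComponent t₁ n₁ (p.1, p.2.1) (ι p.2.2)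
    - frameComponent t₂ n₂ (p.1, p.2.1) (ι p.2.2))

/-- The linearization of `frameMap` at the base point. -/
def frameLinear (ι : V →ₗᵢ[ℝ] H) (x y : H) : ℝ × ℝ × V →L[ℝ] H :=
  (ContinuousLinearMap.fst ℝ ℝ (ℝ × V)).smulRight x +
    (((ContinuousLinearMap.fst ℝ ℝ V).comp (ContinuousLinearMap.snd ℝ ℝ (ℝ × V))).smulRight y +
      ι.toContinuousLinearMap.comp
        ((ContinuousLinearMap.snd ℝ ℝ V).comp (ContinuousLinearMap.snd ℝ ℝ (ℝ × V))))

theorem frameLinear_apply (ι : V →ₗᵢ[ℝ] H) (x y : H) (p : ℝ × ℝ × V) :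
    frameLinear ι x y p = p.1 • x + (p.2.1 • y + ι p.2.2) := rfl

/-- The vectors `n` and `m` are dual to `x` and `y`: pairing with them reads off the two scalar
coordinates, and what remains lies in their orthogonal complement, which is the range of `ι`. Each
scalar costs `M / μ`; the remainder costs `1 + 2 M² / μ`, at most `3 M² / μ`. -/
theorem exists_frameLinear_equiv [CompleteSpace H] [CompleteSpace V] (ι : V →ₗᵢ[ℝ] H)
    {M μ : ℝ} (hM : 1 ≤ M) (hμ : 0 < μ) (hμ1 : μ ≤ 1) {x y n m : H}
    (hx : ‖x‖ ≤ M) (hy : ‖y‖ ≤ M) (hn : ‖n‖ ≤ M) (hm : ‖m‖ ≤ M)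
    (hxn : μ ≤ ⟪x, n⟫) (hym : μ ≤ ⟪y, m⟫) (hxm : ⟪x, m⟫ = 0) (hyn : ⟪y, n⟫ = 0)
    (hι : ∀ z : H, z ∈ Set.range ι ↔ ⟪z, n⟫ = 0 ∧ ⟪z, m⟫ = 0) :
    ∃ L : (ℝ × ℝ × V) ≃L[ℝ] H, (L : ℝ × ℝ × V →L[ℝ] H) = frameLinear ι x y ∧
      ‖(L.symm : H →L[ℝ] ℝ × ℝ × V)‖ ≤ 3 * M ^ 2 / μ := by
  have hxn0 : 0 < ⟪x, n⟫ := by linarith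
  have hym0 : 0 < ⟪y, m⟫ := by linarith
  have hM0 : 0 < M := by linarith
  have hιn : ∀ v, ⟪ι v, n⟫ = 0 := fun v => ((hι _).1 ⟨v, rfl⟩).1
  have hιm : ∀ v, ⟪ι v, m⟫ = 0 := fun v => ((hι _).1 ⟨v, rfl⟩).2
  have h1 : ∀ p : ℝ × ℝ × V, ⟪frameLinear ι x y p, n⟫ = p.1 * ⟪x, n⟫ := fun p => by
    simp [frameLinear_apply, inner_add_left, real_inner_smul_left, hyn, hιn]
  have h2 : ∀ p : ℝ × ℝ × V, ⟪frameLinear ι x y p, m⟫ = p.2.1 * ⟪y, m⟫ := fun p => by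
    simp [frameLinear_apply, inner_add_left, real_inner_smul_left, hxm, hιm]
  have hbound : ∀ p : ℝ × ℝ × V, ‖p‖ ≤ 3 * M ^ 2 / μ * ‖frameLinear ι x y p‖ := by
    intro p
    set u := frameLinear ι x y p with hu
    have hun := norm_nonneg u
    have b1 : |p.1| ≤ M / μ * ‖u‖ := by
      have e : p.1 = ⟪u, n⟫ / ⟪x, n⟫ := by rw [hu, h1]; field_simp
      rw [e, abs_div, abs_of_pos hxn0, div_mul_eq_mul_div]
      refine div_le_div₀ (by positivity) ?_ hμ hxn
      refine (abs_real_inner_le_norm _ _).trans ?_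
      rw [mul_comm]; gcongr
    have b2 : |p.2.1| ≤ M / μ * ‖u‖ := by
      have e : p.2.1 = ⟪u, m⟫ / ⟪y, m⟫ := by rw [hu, h2]; field_simp
      rw [e, abs_div, abs_of_pos hym0, div_mul_eq_mul_div]
      refine div_le_div₀ (by positivity) ?_ hμ hym
      refine (abs_real_inner_le_norm _ _).trans ?_
      rw [mul_comm]; gcongr
    have hM2 : M / μ ≤ M ^ 2 / μ := by gcongr; nlinarith
    have h1μ : 1 ≤ M ^ 2 / μ := by rw [le_div_iff₀ hμ]; nlinarith
    have b3 : ‖p.2.2‖ ≤ 3 * M ^ 2 / μ * ‖u‖ := by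
      have e : ι p.2.2 = u - p.1 • x - p.2.1 • y := by
        rw [hu, frameLinear_apply]; abel
      rw [← ι.norm_map, e]
      refine (norm_sub_le _ _).trans ((add_le_add (norm_sub_le _ _) le_rfl).trans ?_)
      rw [norm_smul, norm_smul, Real.norm_eq_abs, Real.norm_eq_abs]
      have i1 : |p.1| * ‖x‖ ≤ M / μ * ‖u‖ * M := by gcongr
      have i2 : |p.2.1| * ‖y‖ ≤ M / μ * ‖u‖ * M := by gcongr
      have i3 : 3 * M ^ 2 / μ * ‖u‖ = M ^ 2 / μ * ‖u‖ + (M / μ * ‖u‖ * M + M / μ * ‖u‖ * M) := by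
        ring
      nlinarith
    have hle : M / μ * ‖u‖ ≤ 3 * M ^ 2 / μ * ‖u‖ := by
      have : 3 * M ^ 2 / μ = 3 * (M ^ 2 / μ) := by ring
      rw [this]
      refine mul_le_mul_of_nonneg_right ?_ hun
      nlinarith
    exact max_le (b1.trans hle) (max_le (b2.trans hle) b3)
  have hinj : Function.Injective (frameLinear ι x y) := by
    intro p p' hpp
    have := hbound (p - p')
    rw [map_sub, hpp, sub_self, norm_zero, mul_zero] at this
    exact sub_eq_zero.1 (norm_le_zero_iff.1 this)
  have hsurj : Function.Surjective (frameLinear ι x y) := by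
    intro u
    obtain ⟨v, hv⟩ := (hι (u - (⟪u, n⟫ / ⟪x, n⟫) • x - (⟪u, m⟫ / ⟪y, m⟫) • y)).2 (by
      simp only [inner_sub_left, real_inner_smul_left, hyn, hxm]
      constructor <;> field_simp <;> ring)
    refine ⟨(⟪u, n⟫ / ⟪x, n⟫, ⟪u, m⟫ / ⟪y, m⟫, v), ?_⟩
    rw [frameLinear_apply]; simp only [hv]; abel
  refine ⟨ContinuousLinearEquiv.ofBijective (frameLinear ι x y)
    (LinearMap.ker_eq_bot.2 hinj) (LinearMap.range_eq_top.2 hsurj), ?_, ?_⟩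
  · ext p <;> rfl
  · refine ContinuousLinearMap.opNorm_le_bound _ (by positivity) fun u => ?_
    obtain ⟨p, rfl⟩ := hsurj u
    have : (ContinuousLinearEquiv.ofBijective (frameLinear ι x y)
        (LinearMap.ker_eq_bot.2 hinj) (LinearMap.range_eq_top.2 hsurj)).symm
        (frameLinear ι x y p) = p :=
      ContinuousLinearEquiv.ofBijective_symm_apply_apply _ _ _ p
    rw [ContinuousLinearEquiv.coe_coe, this]
    exact hbound p

theorem contDiffOn_frameComponent (ι : V →ₗᵢ[ℝ] H) {M μ : ℝ} (hμ : 0 < μ) {t n : ℝ × ℝ → H}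
    (ht : IsTame M t) (hn : IsTame M n) (hm : ∀ a ∈ paramBall, μ ≤ ⟪t a, n a⟫) :
    ContDiffOn ℝ ∞ (fun p : ℝ × ℝ × V => frameComponent t n (p.1, p.2.1) (ι p.2.2))
      {p | (p.1, p.2.1) ∈ paramBall} := by
  have hπ : ContDiffOn ℝ ∞ (fun p : ℝ × ℝ × V => ((p.1, p.2.1) : ℝ × ℝ))
      {p | (p.1, p.2.1) ∈ paramBall} := by fun_prop
  have hv : ContDiffOn ℝ ∞ (fun p : ℝ × ℝ × V => ι p.2.2) {p | (p.1, p.2.1) ∈ paramBall} :=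
    (ι.contDiff.comp (contDiff_snd.comp contDiff_snd)).contDiffOn
  have ht' := ht.contDiffOn.comp hπ fun p hp => hp
  have hn' := hn.contDiffOn.comp hπ fun p hp => hp
  exact ((hv.inner ℝ hn').div (ht'.inner ℝ hn') fun p hp => by
    have := hm _ hp
    simp only [Function.comp]
    linarith).smul ht'

/-- The point is the explicit radius, which depends on the frame only through `M` and `μ`. On a ball
of radius `ρ` the map stays within `c` of its linearization `L`, with `2 c ≤ ‖L⁻¹‖⁻¹`; it is
therefore injective there, and its image contains a ball of radius nearly `c ρ`. -/
theorem exists_frame_chart [CompleteSpace H] [CompleteSpace V] (ι : V →ₗᵢ[ℝ] H)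
    {M μ : ℝ} (hM : 1 ≤ M) (hμ : 0 < μ) (hμ1 : μ ≤ 1) {F t₁ t₂ n₁ n₂ : ℝ × ℝ → H}
    (hFs : ContDiffOn ℝ ∞ F paramBall)
    (hF : ∀ a ∈ paramBall, HasFDerivAt F ((ContinuousLinearMap.fst ℝ ℝ ℝ).smulRight (t₁ a) +
      (ContinuousLinearMap.snd ℝ ℝ ℝ).smulRight (t₂ a)) a)
    (ht₁ : IsTame M t₁) (ht₂ : IsTame M t₂) (hn₁ : IsTame M n₁) (hn₂ : IsTame M n₂)
    (hm₁ : ∀ a ∈ paramBall, μ ≤ ⟪t₁ a, n₁ a⟫) (hm₂ : ∀ a ∈ paramBall, μ ≤ ⟪t₂ a, n₂ a⟫)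
    (h12 : ⟪t₁ (0, 1), n₂ (0, 1)⟫ = 0) (h21 : ⟪t₂ (0, 1), n₁ (0, 1)⟫ = 0)
    (hι : ∀ z : H, z ∈ Set.range ι ↔ ⟪z, n₁ (0, 1)⟫ = 0 ∧ ⟪z, n₂ (0, 1)⟫ = 0) :
    ∃ Φ : OpenPartialHomeomorph (ℝ × ℝ × V) H, ((0, 1, 0) : ℝ × ℝ × V) ∈ Φ.source ∧
      (∀ p ∈ Φ.source, (p.1, p.2.1) ∈ paramBall) ∧
      Set.EqOn Φ (frameMap ι F t₁ t₂ n₁ n₂) Φ.source ∧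
      ContDiffOn ℝ ∞ Φ Φ.source ∧ ContDiffOn ℝ ∞ Φ.symm Φ.target ∧
      ∀ u : H, ‖u - F (0, 1)‖ ≤ μ ^ 4 / (1200 * M ^ 8) → u ∈ Φ.target := by
  have hM0 : 0 < M := by linarith
  have h0 := base_mem_paramBall
  obtain ⟨L, hL, hLsymm⟩ := exists_frameLinear_equiv ι hM hμ hμ1 (ht₁.norm_le _ h0)
    (ht₂.norm_le _ h0) (hn₁.norm_le _ h0) (hn₂.norm_le _ h0) (hm₁ _ h0) (hm₂ _ h0) h12 h21 hι
  set G := frameMap ι F t₁ t₂ n₁ n₂ with hG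
  have hιn : ∀ v, ⟪ι v, n₁ (0, 1)⟫ = 0 := fun v => ((hι _).1 ⟨v, rfl⟩).1
  have hιm : ∀ v, ⟪ι v, n₂ (0, 1)⟫ = 0 := fun v => ((hι _).1 ⟨v, rfl⟩).2
  -- Chosen so that `30 (M⁴ / μ²) ρ = μ / (6 M²)`: the nonlinear error below is at most `2 M ρ` from
  -- `F` and `14 (M⁴ / μ²) ρ` from each of the two components.
  set ρ : ℝ := μ ^ 3 / (180 * M ^ 6) with hρ
  have hρ0 : 0 < ρ := by positivity
  have hM6 : 1 ≤ M ^ 6 := one_le_pow₀ hM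
  have hμ3 : μ ^ 3 ≤ 1 := pow_le_one₀ hμ.le hμ1
  have hρ2 : ρ ≤ 1 / 2 := by
    rw [hρ, div_le_div_iff₀ (by positivity) (by norm_num)]; linarith
  set s : Set (ℝ × ℝ × V) := Metric.ball (0, 1, 0) ρ with hs
  have hsn : ∀ p ∈ s, ‖(p.1, p.2.1) - ((0, 1) : ℝ × ℝ)‖ < ρ ∧ ‖p.2.2‖ < ρ := by
    intro p hp
    rw [hs, mem_ball_iff_norm] at hp
    have h1 : ‖p.1 - 0‖ < ρ := lt_of_le_of_lt (le_max_left _ _) hp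
    have h2 : ‖p.2 - (1, 0)‖ < ρ := lt_of_le_of_lt (le_max_right _ _) hp
    have h3 : ‖p.2.1 - 1‖ < ρ := lt_of_le_of_lt (le_max_left _ _) h2
    have h4 : ‖p.2.2 - 0‖ < ρ := lt_of_le_of_lt (le_max_right _ _) h2
    rw [sub_zero] at h4
    exact ⟨max_lt h1 h3, h4⟩
  have hsB : ∀ p ∈ s, (p.1, p.2.1) ∈ paramBall := fun p hp => by
    rw [paramBall, mem_ball_iff_norm]
    exact lt_of_lt_of_le (hsn p hp).1 hρ2
  have hFdiff : ∀ a b : ℝ × ℝ, a ∈ Metric.ball ((0, 1) : ℝ × ℝ) ρ →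
      b ∈ Metric.ball ((0, 1) : ℝ × ℝ) ρ →
      ‖F a - F b - ((a - b).1 • t₁ (0, 1) + (a - b).2 • t₂ (0, 1))‖ ≤ 2 * M * ρ * ‖a - b‖ := by
    intro a b ha hb
    have hsub : Metric.ball ((0, 1) : ℝ × ℝ) ρ ⊆ paramBall := Metric.ball_subset_ball hρ2
    refine (convex_ball ((0, 1) : ℝ × ℝ) ρ).norm_image_sub_le_of_norm_hasFDerivWithin_le'
      (φ := (ContinuousLinearMap.fst ℝ ℝ ℝ).smulRight (t₁ (0, 1)) +
      (ContinuousLinearMap.snd ℝ ℝ ℝ).smulRight (t₂ (0, 1)))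
      (fun x hx => (hF x (hsub hx)).hasFDerivWithinAt) (fun x hx => ?_) hb ha
    have hxρ : ‖x - (0, 1)‖ ≤ ρ := (mem_ball_iff_norm.1 hx).le
    refine ContinuousLinearMap.opNorm_le_bound _ (by positivity) fun z => ?_
    have e : ((ContinuousLinearMap.fst ℝ ℝ ℝ).smulRight (t₁ x) +
        (ContinuousLinearMap.snd ℝ ℝ ℝ).smulRight (t₂ x) -
        ((ContinuousLinearMap.fst ℝ ℝ ℝ).smulRight (t₁ (0, 1)) +
        (ContinuousLinearMap.snd ℝ ℝ ℝ).smulRight (t₂ (0, 1)))) z =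
        z.1 • (t₁ x - t₁ (0, 1)) + z.2 • (t₂ x - t₂ (0, 1)) := by
      simp [smul_sub]; abel
    rw [e]
    refine (norm_add_le _ _).trans ?_
    rw [norm_smul, norm_smul]
    have i1 := mul_le_mul (norm_fst_le z) ((ht₁.lipschitz x (hsub hx) _ h0).trans
      (mul_le_mul_of_nonneg_left hxρ hM0.le)) (norm_nonneg _) (norm_nonneg _)
    have i2 := mul_le_mul (norm_snd_le z) ((ht₂.lipschitz x (hsub hx) _ h0).trans
      (mul_le_mul_of_nonneg_left hxρ hM0.le)) (norm_nonneg _) (norm_nonneg _)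
    linarith
  -- Half the inverse of the bound `3 M² / μ` for `L⁻¹`.
  set c : NNReal := ⟨μ / (6 * M ^ 2), by positivity⟩ with hc
  have happ : ApproximatesLinearOn G (L : ℝ × ℝ × V →L[ℝ] H) s c := by
    refine ApproximatesLinearOn.approximatesLinearOn_iff_lipschitzOnWith.2 (LipschitzOnWith.of_dist_le_mul ?_)
    intro p hp p' hp'
    rw [dist_eq_norm, dist_eq_norm]
    obtain ⟨hpa, hpv⟩ := hsn p hp
    obtain ⟨hpa', hpv'⟩ := hsn p' hp'
    set a : ℝ × ℝ := (p.1, p.2.1) with ha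
    set b : ℝ × ℝ := (p'.1, p'.2.1) with hb
    have hab : ‖a - b‖ ≤ ‖p - p'‖ := max_le (norm_fst_le (p - p'))
      ((norm_fst_le (p - p').2).trans (norm_snd_le (p - p')))
    have hvw : ‖p.2.2 - p'.2.2‖ ≤ ‖p - p'‖ :=
      (norm_snd_le (p - p').2).trans (norm_snd_le (p - p'))
    have e : (G - ⇑(L : ℝ × ℝ × V →L[ℝ] H)) p - (G - ⇑(L : ℝ × ℝ × V →L[ℝ] H)) p' =
        (F a - F b - ((a - b).1 • t₁ (0, 1) + (a - b).2 • t₂ (0, 1)))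
        - (frameComponent t₁ n₁ a (ι p.2.2) - frameComponent t₁ n₁ b (ι p'.2.2))
        - (frameComponent t₂ n₂ a (ι p.2.2) - frameComponent t₂ n₂ b (ι p'.2.2)) := by
      simp only [Pi.sub_apply, hL, frameLinear_apply, hG, frameMap, ha, hb, Prod.fst_sub,
        Prod.snd_sub, sub_smul]
      abel
    rw [e]
    have j0 := hFdiff a b (mem_ball_iff_norm.2 hpa) (mem_ball_iff_norm.2 hpa')
    have j1 := norm_frameComponent_sub_le hM hμ hμ1 ht₁ hn₁ hm₁ (hsB p hp) (hsB p' hp') hpa.le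
      (hιn p.2.2) (hιn p'.2.2)
    have j2 := norm_frameComponent_sub_le hM hμ hμ1 ht₂ hn₂ hm₂ (hsB p hp) (hsB p' hp') hpa.le
      (hιm p.2.2) (hιm p'.2.2)
    rw [← map_sub, ι.norm_map, ι.norm_map] at j1 j2
    have hin : ρ * ‖p.2.2 - p'.2.2‖ + ‖p'.2.2‖ * ‖a - b‖ ≤ 2 * ρ * ‖p - p'‖ := by
      have := mul_le_mul hpv'.le hab (norm_nonneg _) hρ0.le
      have := mul_le_mul_of_nonneg_left hvw hρ0.le
      linarith
    have hK : 0 ≤ 7 * M ^ 4 / μ ^ 2 := by positivity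
    have hin' := mul_le_mul_of_nonneg_left hin hK
    have hfin : 2 * M * ρ + 2 * (7 * M ^ 4 / μ ^ 2 * (2 * ρ)) ≤ μ / (6 * M ^ 2) := by
      have i1 : M ≤ M ^ 4 / μ ^ 2 := by
        rw [le_div_iff₀ (by positivity)]
        have : μ ^ 2 ≤ 1 := pow_le_one₀ hμ.le hμ1
        have : M ≤ M ^ 4 := le_self_pow₀ hM (by norm_num)
        nlinarith
      have i2 : 30 * (M ^ 4 / μ ^ 2) * ρ = μ / (6 * M ^ 2) := by
        rw [hρ]; field_simp; norm_num
      rw [← i2]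
      have i3 : 7 * M ^ 4 / μ ^ 2 = 7 * (M ^ 4 / μ ^ 2) := by ring
      rw [i3]
      nlinarith
    have j0' : 2 * M * ρ * ‖a - b‖ ≤ 2 * M * ρ * ‖p - p'‖ := by gcongr
    have hfin' := mul_le_mul_of_nonneg_right hfin (norm_nonneg (p - p'))
    have t1 := norm_sub_le (F a - F b - ((a - b).1 • t₁ (0, 1) + (a - b).2 • t₂ (0, 1))
        - (frameComponent t₁ n₁ a (ι p.2.2) - frameComponent t₁ n₁ b (ι p'.2.2)))
        (frameComponent t₂ n₂ a (ι p.2.2) - frameComponent t₂ n₂ b (ι p'.2.2))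
    have t2 := norm_sub_le (F a - F b - ((a - b).1 • t₁ (0, 1) + (a - b).2 • t₂ (0, 1)))
        (frameComponent t₁ n₁ a (ι p.2.2) - frameComponent t₁ n₁ b (ι p'.2.2))
    change _ ≤ μ / (6 * M ^ 2) * ‖p - p'‖
    linarith
  have hlam : 2 * (c : ℝ) ≤ ‖(L.symm : H →L[ℝ] ℝ × ℝ × V)‖⁻¹ := by
    have hpos : 0 < ‖(L.symm : H →L[ℝ] ℝ × ℝ × V)‖ := by
      rw [norm_pos_iff]
      intro h
      have h' : (0, 1, 0) = (0 : ℝ × ℝ × V) := by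
        rw [← L.symm_apply_apply (0, 1, 0), ← ContinuousLinearEquiv.coe_coe L.symm, h]; rfl
      simpa using congrArg (fun p : ℝ × ℝ × V => p.2.1) h'
    have e : 2 * (c : ℝ) = (3 * M ^ 2 / μ)⁻¹ := by
      change 2 * (μ / (6 * M ^ 2)) = _
      field_simp; norm_num
    rw [e]
    exact inv_anti₀ hpos hLsymm
  have hc0 : 0 < (c : ℝ) := by change 0 < μ / (6 * M ^ 2); positivity
  have hclt : c < ‖(L.symm : H →L[ℝ] ℝ × ℝ × V)‖₊⁻¹ := by
    rw [← NNReal.coe_lt_coe, NNReal.coe_inv, coe_nnnorm]; linarith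
  have hGs : ContDiffOn ℝ ∞ G {p | (p.1, p.2.1) ∈ paramBall} := by
    have hπ : ContDiffOn ℝ ∞ (fun p : ℝ × ℝ × V => ((p.1, p.2.1) : ℝ × ℝ))
      {p | (p.1, p.2.1) ∈ paramBall} := by fun_prop
    have hv : ContDiffOn ℝ ∞ (fun p : ℝ × ℝ × V => ι p.2.2) {p | (p.1, p.2.1) ∈ paramBall} :=
      (ι.contDiff.comp (contDiff_snd.comp contDiff_snd)).contDiffOn
    exact (hFs.comp hπ fun p hp => hp).add ((hv.sub
      (contDiffOn_frameComponent ι hμ ht₁ hn₁ hm₁)).sub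
      (contDiffOn_frameComponent ι hμ ht₂ hn₂ hm₂))
  have hGat : ∀ p ∈ s, ContDiffAt ℝ ∞ G p := fun p hp =>
    (hGs.mono hsB).contDiffAt (Metric.isOpen_ball.mem_nhds hp)
  set Φ := happ.toOpenPartialHomeomorph G s (Or.inr hclt) Metric.isOpen_ball with hΦ
  have hsrc : Φ.source = s := rfl
  have hcoe : ⇑Φ = G := rfl
  refine ⟨Φ, ?_, hsB, fun p _ => rfl, hGs.mono hsB, ?_, ?_⟩
  · rw [hsrc]; exact Metric.mem_ball_self hρ0
  · intro u hu
    have hp : Φ.symm u ∈ s := Φ.map_target hu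
    set p := Φ.symm u
    have hd : HasFDerivAt G (fderiv ℝ G p) p :=
      ((hGat p hp).differentiableAt (by simp)).hasFDerivAt
    have hnear : ‖fderiv ℝ G p - (L : ℝ × ℝ × V →L[ℝ] H)‖ ≤ c :=
      (hd.sub (L : ℝ × ℝ × V →L[ℝ] H).hasFDerivAt).le_of_lipschitzOn
        (Metric.isOpen_ball.mem_nhds hp) (ApproximatesLinearOn.approximatesLinearOn_iff_lipschitzOnWith.1 happ)
    -- The derivative at any point of the ball is itself within `c` of `L`, so the criterion used
    -- for `G`, applied on the whole space, shows that it is bijective. This makes the inverse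
    -- smooth on all of the target, not only near the image of the base point.
    have happ' : ApproximatesLinearOn (fderiv ℝ G p) (L : ℝ × ℝ × V →L[ℝ] H) Set.univ c := by
      intro x _ y _
      rw [← map_sub, ← sub_apply]
      exact (ContinuousLinearMap.le_opNorm _ _).trans
        (mul_le_mul_of_nonneg_right hnear (norm_nonneg _))
    have hinj : Function.Injective (fderiv ℝ G p) := by
      have := happ'.injOn (Or.inr hclt)
      exact Set.injOn_univ.1 this
    have hsurj := happ'.surjective (Or.inr hclt)
    refine (Φ.contDiffAt_symm (f₀' := ContinuousLinearEquiv.ofBijective (fderiv ℝ G p)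
      (LinearMap.ker_eq_bot.2 hinj) (LinearMap.range_eq_top.2 hsurj)) hu ?_ (hGat p hp)
      ).contDiffWithinAt
    rw [ContinuousLinearEquiv.coe_ofBijective]
    exact hd
  · intro u hu
    have hG0 : G (0, 1, 0) = F (0, 1) := by
      simp [hG, frameMap, frameComponent]
    -- The surjectivity criterion needs a closed ball inside the open one. The factor `50/55` turns
    -- `c ρ = μ⁴ / (1080 M⁸)` into `μ⁴ / (1188 M⁸)`, still above the claimed radius.
    have hr0 : 0 ≤ 50 / 55 * ρ := by positivity
    have hsurj := happ.surjOn_closedBall_of_nonlinearRightInverse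
      L.toNonlinearRightInverse (b := (0, 1, 0)) hr0
      (Metric.closedBall_subset_ball (by linarith))
    have hmem : u ∈ Metric.closedBall (G (0, 1, 0))
        (((L.toNonlinearRightInverse.nnnorm : ℝ)⁻¹ - c) * (50 / 55 * ρ)) := by
      rw [mem_closedBall_iff_norm, hG0]
      refine hu.trans ?_
      have e : ((L.toNonlinearRightInverse.nnnorm : ℝ)⁻¹ - c) ≥ c := by
        change ‖(L.symm : H →L[ℝ] ℝ × ℝ × V)‖⁻¹ - c ≥ c
        linarith
      have e2 : (c : ℝ) * (50 / 55 * ρ) = μ ^ 4 / (1188 * M ^ 8) := by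
        change μ / (6 * M ^ 2) * (50 / 55 * (μ ^ 3 / (180 * M ^ 6))) = _
        field_simp; norm_num
      have e3 : μ ^ 4 / (1200 * M ^ 8) ≤ μ ^ 4 / (1188 * M ^ 8) := by gcongr; norm_num
      rw [← e2] at e3
      exact e3.trans (mul_le_mul_of_nonneg_right e (by positivity))
    obtain ⟨p, hp, hpu⟩ := hsurj hmem
    rw [← hpu, ← hcoe]
    exact Φ.map_source (Metric.closedBall_subset_ball (by linarith) hp)

end Chart

/-! ### The Bessel function and its zeros -/

/-! ### The Bessel function `J₀` -/

theorem summable_mul_pow_of_abs_le {c : ℕ → ℝ} (hc : ∀ m, |c m| ≤ 1 / (m.factorial : ℝ)) (y : ℝ) :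
    Summable fun m => c m * y ^ m := by
  refine Summable.of_norm_bounded (Real.summable_pow_div_factorial |y|) fun m => ?_
  rw [Real.norm_eq_abs, abs_mul, abs_pow, div_eq_inv_mul, ← one_div]
  exact mul_le_mul_of_nonneg_right (hc m) (by positivity)

/-- The bound by `1 / m!` survives termwise differentiation, so `hasDerivAt_tsum_pow` can be
iterated. -/
theorem abs_succ_mul_le {c : ℕ → ℝ} (hc : ∀ m, |c m| ≤ 1 / (m.factorial : ℝ)) (m : ℕ) :
    |((m : ℝ) + 1) * c (m + 1)| ≤ 1 / (m.factorial : ℝ) := by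
  have h := hc (m + 1)
  rw [Nat.factorial_succ, Nat.cast_mul] at h
  rw [abs_mul, abs_of_pos (by positivity : (0 : ℝ) < m + 1)]
  refine (mul_le_mul_of_nonneg_left h (by positivity)).trans (le_of_eq ?_)
  push_cast
  field_simp

/-- On the ball of radius `|y| + 1` the differentiated series is dominated by an exponential series,
which justifies differentiating term by term. -/
theorem hasDerivAt_tsum_pow {c : ℕ → ℝ} (hc : ∀ m, |c m| ≤ 1 / (m.factorial : ℝ)) (y : ℝ) :
    HasDerivAt (fun z => ∑' m, c m * z ^ m) (∑' m : ℕ, (((m : ℝ) + 1) * c (m + 1)) * y ^ m) y := by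
  set R : ℝ := |y| + 1 with hR
  have hR0 : 0 < R := by positivity
  have hu : Summable fun n : ℕ => (n : ℝ) * (1 / (n.factorial : ℝ)) * R ^ (n - 1) := by
    rw [← summable_nat_add_iff 1]
    refine (Real.summable_pow_div_factorial R).congr fun m => ?_
    rw [Nat.factorial_succ, Nat.add_sub_cancel]; push_cast
    field_simp
  have key := hasDerivAt_tsum_of_isPreconnected (g := fun n z => c n * z ^ n)
    (g' := fun n z => c n * (n * z ^ (n - 1))) (t := Metric.ball (0 : ℝ) R) (y₀ := y) (y := y) hu
    Metric.isOpen_ball (convex_ball _ _).isPreconnected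
    (fun n z _ => (hasDerivAt_pow n z).const_mul (c n))
    (fun n z hz => by
      have hz' : |z| ≤ R := by simpa using (mem_ball_zero_iff.1 hz).le
      rw [Real.norm_eq_abs, abs_mul, abs_mul, abs_pow, Nat.abs_cast]
      have := pow_le_pow_left₀ (abs_nonneg z) hz' (n - 1)
      have := hc n
      calc |c n| * (n * |z| ^ (n - 1)) ≤ (1 / (n.factorial : ℝ)) * (n * R ^ (n - 1)) := by gcongr
        _ = _ := by ring)
    (by simp [hR]) (summable_mul_pow_of_abs_le hc y) (by simp [hR])
  refine key.congr_deriv ?_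
  have hs : Summable fun n : ℕ => c n * (n * y ^ (n - 1)) := by
    rw [← summable_nat_add_iff 1]
    refine (summable_mul_pow_of_abs_le (abs_succ_mul_le hc) y).congr fun m => ?_
    rw [Nat.add_sub_cancel]; push_cast; ring
  rw [hs.tsum_eq_zero_add]
  simp only [Nat.cast_zero, zero_mul, mul_zero, zero_add]
  refine tsum_congr fun m => ?_
  rw [Nat.add_sub_cancel]; push_cast; ring

/-- The coefficients of `J₀` as a power series in `r² / 4`. -/
def besselCoeff (m : ℕ) : ℝ := (-1) ^ m / (m.factorial : ℝ) ^ 2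

theorem abs_besselCoeff_le (m : ℕ) : |besselCoeff m| ≤ 1 / (m.factorial : ℝ) := by
  have h : (1 : ℝ) ≤ m.factorial := by exact_mod_cast m.factorial_pos
  rw [besselCoeff, abs_div, abs_pow, abs_neg, abs_one, one_pow, abs_of_pos (by positivity)]
  exact one_div_le_one_div_of_le (by positivity) (by nlinarith)

/-- This recurrence is Bessel's equation read on coefficients. -/
theorem besselCoeff_succ (m : ℕ) : ((m : ℝ) + 1) ^ 2 * besselCoeff (m + 1) = -besselCoeff m := by
  rw [besselCoeff, besselCoeff, Nat.factorial_succ]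
  push_cast
  field_simp
  ring

/-- The entire function `f` with `J₀(r) = f(r² / 4)`, together with `f'` and, for every index from
`2` on, `f''`. The variable `r² / 4` avoids the singularity of Bessel's equation at the origin. -/
def besselSeries (k : ℕ) (y : ℝ) : ℝ :=
  match k with
  | 0 => ∑' m, besselCoeff m * y ^ m
  | 1 => ∑' m : ℕ, (((m : ℝ) + 1) * besselCoeff (m + 1)) * y ^ m
  | _ => ∑' m : ℕ, (((m : ℝ) + 1) * ((((m + 1 : ℕ) : ℝ) + 1) * besselCoeff (m + 1 + 1))) * y ^ m

theorem hasDerivAt_besselSeries_zero (y : ℝ) :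
    HasDerivAt (besselSeries 0) (besselSeries 1 y) y :=
  hasDerivAt_tsum_pow abs_besselCoeff_le y

theorem hasDerivAt_besselSeries_one (y : ℝ) :
    HasDerivAt (besselSeries 1) (besselSeries 2 y) y :=
  hasDerivAt_tsum_pow (abs_succ_mul_le abs_besselCoeff_le) y

theorem besselSeries_ode (y : ℝ) :
    y * besselSeries 2 y + besselSeries 1 y + besselSeries 0 y = 0 := by
  have hc1 := abs_succ_mul_le abs_besselCoeff_le
  have s0 := summable_mul_pow_of_abs_le abs_besselCoeff_le y
  have s1 := summable_mul_pow_of_abs_le hc1 y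
  have s2 := summable_mul_pow_of_abs_le (abs_succ_mul_le hc1) y
  have hy : Summable fun m : ℕ => (m : ℝ) * (((m : ℝ) + 1) * besselCoeff (m + 1)) * y ^ m := by
    rw [← summable_nat_add_iff 1]
    refine (s2.mul_left y).congr fun m => ?_
    push_cast; ring
  have e2 : y * besselSeries 2 y =
      ∑' m : ℕ, (m : ℝ) * (((m : ℝ) + 1) * besselCoeff (m + 1)) * y ^ m := by
    rw [hy.tsum_eq_zero_add]
    simp only [besselSeries, Nat.cast_zero, zero_mul, zero_add]
    rw [← tsum_mul_left]
    refine tsum_congr fun m => ?_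
    push_cast; ring
  rw [e2]
  simp only [besselSeries]
  rw [← hy.tsum_add s1, ← (hy.add s1).tsum_add s0]
  refine (tsum_congr fun m => ?_).trans tsum_zero
  linear_combination (y ^ m) * besselCoeff_succ m

theorem besselJ0_eq (r : ℝ) : besselJ0 r = besselSeries 0 (r ^ 2 / 4) := by
  simp only [besselJ0, besselSeries, besselCoeff]
  refine tsum_congr fun m => ?_
  rw [pow_mul, div_pow]; norm_num

/-- The derivative of `J₀`. -/
def besselJ0Deriv (r : ℝ) : ℝ := besselSeries 1 (r ^ 2 / 4) * (r / 2)

theorem hasDerivAt_sq_div_four (r : ℝ) : HasDerivAt (fun x : ℝ => x ^ 2 / 4) (r / 2) r := by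
  have := (hasDerivAt_pow 2 r).div_const 4
  exact this.congr_deriv (by norm_num; ring)

theorem hasDerivAt_besselJ0 (r : ℝ) : HasDerivAt besselJ0 (besselJ0Deriv r) r := by
  have : besselJ0 = fun r => besselSeries 0 (r ^ 2 / 4) := funext besselJ0_eq
  rw [this]
  exact (hasDerivAt_besselSeries_zero _).comp r (hasDerivAt_sq_div_four r)

/-- This form has no division by `r`, so it also gives continuity of `J₀'` at the origin. -/
theorem hasDerivAt_besselJ0Deriv_all (r : ℝ) :
    HasDerivAt besselJ0Deriv (-besselJ0 r - besselSeries 1 (r ^ 2 / 4) / 2) r := by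
  have h := ((hasDerivAt_besselSeries_one _).comp r (hasDerivAt_sq_div_four r)).mul
    ((hasDerivAt_id r).div_const 2)
  refine h.congr_deriv ?_
  have o := besselSeries_ode (r ^ 2 / 4)
  rw [besselJ0_eq]
  simp only [Function.comp, id]
  linear_combination o

theorem hasDerivAt_besselJ0Deriv {r : ℝ} (hr : r ≠ 0) :
    HasDerivAt besselJ0Deriv (-besselJ0 r - besselJ0Deriv r / r) r := by
  refine (hasDerivAt_besselJ0Deriv_all r).congr_deriv ?_
  rw [besselJ0Deriv]; field_simp

theorem continuous_besselJ0 : Continuous besselJ0 :=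
  continuous_iff_continuousAt.2 fun r => (hasDerivAt_besselJ0 r).continuousAt

theorem continuous_besselJ0Deriv : Continuous besselJ0Deriv :=
  continuous_iff_continuousAt.2 fun r => (hasDerivAt_besselJ0Deriv_all r).continuousAt

theorem besselJ0_zero : besselJ0 0 = 1 := by
  rw [besselJ0, tsum_eq_single 0]
  · simp
  · intro m hm
    simp [hm]

theorem besselJ0Deriv_zero : besselJ0Deriv 0 = 0 := by simp [besselJ0Deriv]

/-- Nonincreasing on `[0, ∞)` by the damping term `J₀' / r`. It controls the size and slope of `J₀`
and, through them, the spacing of the zeros. -/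
def besselEnergy (r : ℝ) : ℝ := besselJ0Deriv r ^ 2 + besselJ0 r ^ 2

theorem hasDerivAt_besselEnergy {r : ℝ} (hr : r ≠ 0) :
    HasDerivAt besselEnergy (-2 * besselJ0Deriv r ^ 2 / r) r := by
  have h := ((hasDerivAt_besselJ0Deriv hr).pow 2).add ((hasDerivAt_besselJ0 r).pow 2)
  refine h.congr_deriv ?_
  field_simp; ring

theorem continuous_besselEnergy : Continuous besselEnergy :=
  (continuous_besselJ0Deriv.pow 2).add (continuous_besselJ0.pow 2)

theorem antitoneOn_besselEnergy : AntitoneOn besselEnergy (Set.Ici 0) := by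
  refine antitoneOn_of_hasDerivWithinAt_nonpos (convex_Ici 0) continuous_besselEnergy.continuousOn
    (f' := fun r => -2 * besselJ0Deriv r ^ 2 / r) ?_ ?_
  · intro r hr
    rw [interior_Ici] at hr
    exact (hasDerivAt_besselEnergy (ne_of_gt hr)).hasDerivWithinAt
  · intro r hr
    rw [interior_Ici] at hr
    have hr' : 0 < r := hr
    exact div_nonpos_of_nonpos_of_nonneg (by nlinarith [sq_nonneg (besselJ0Deriv r)]) hr'.le

theorem besselEnergy_zero : besselEnergy 0 = 1 := by
  simp [besselEnergy, besselJ0_zero, besselJ0Deriv_zero]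

theorem besselEnergy_le_one {r : ℝ} (hr : 0 ≤ r) : besselEnergy r ≤ 1 :=
  besselEnergy_zero ▸ antitoneOn_besselEnergy (Set.self_mem_Ici) hr hr

/-- Multiplication by `r²` overcompensates the damping: `(r² E)' = 2 r J₀² ≥ 0`. Since `E` is
positive near `0`, it can never vanish. -/
theorem besselEnergy_pos {r : ℝ} (hr : 0 < r) : 0 < besselEnergy r := by
  have hmono : MonotoneOn (fun r => r ^ 2 * besselEnergy r) (Set.Ici 0) := by
    refine monotoneOn_of_hasDerivWithinAt_nonneg (convex_Ici 0)
      ((continuous_pow 2).mul continuous_besselEnergy).continuousOn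
      (f' := fun r => 2 * r * besselJ0 r ^ 2) ?_ ?_
    · intro r hr
      rw [interior_Ici] at hr
      have hr' : r ≠ 0 := ne_of_gt hr
      refine (((hasDerivAt_pow 2 r).mul (hasDerivAt_besselEnergy hr')).congr_deriv
        ?_).hasDerivWithinAt
      simp only [besselEnergy]; field_simp; norm_num; ring
    · intro r hr
      rw [interior_Ici] at hr
      have hr' : 0 < r := hr
      positivity
  have hev : ∀ᶠ s in 𝓝[>] (0 : ℝ), 0 < besselEnergy s :=
    (continuous_besselEnergy.continuousAt.eventually
      (lt_mem_nhds (by rw [besselEnergy_zero]; norm_num))).filter_mono nhdsWithin_le_nhds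
  obtain ⟨s, hs1, hs2⟩ := (hev.and (Ioo_mem_nhdsGT hr)).exists
  have h := hmono (Set.mem_Ici.2 hs2.1.le) (Set.mem_Ici.2 hr.le) hs2.2.le
  have h1 : 0 < s ^ 2 * besselEnergy s := mul_pos (pow_pos hs2.1 2) hs1
  have h2 : 0 < r ^ 2 * besselEnergy r := lt_of_lt_of_le h1 h
  exact pos_of_mul_pos_right h2 (by positivity)

theorem abs_besselJ0_le_one {r : ℝ} (hr : 0 ≤ r) : |besselJ0 r| ≤ 1 := by
  rw [← sq_le_one_iff_abs_le_one]
  have := besselEnergy_le_one hr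
  have : 0 ≤ besselJ0Deriv r ^ 2 := sq_nonneg _
  simp only [besselEnergy] at *
  linarith

theorem abs_besselJ0_sub_le {a b : ℝ} (ha : 0 ≤ a) (hab : a ≤ b) :
    |besselJ0 b - besselJ0 a| ≤ Real.sqrt (besselEnergy a) * (b - a) := by
  have h := (convex_Icc a b).norm_image_sub_le_of_norm_hasDerivWithin_le
    (f := besselJ0) (f' := besselJ0Deriv) (C := Real.sqrt (besselEnergy a))
    (fun x _ => (hasDerivAt_besselJ0 x).hasDerivWithinAt)
    (fun x hx => by
      rw [Real.norm_eq_abs]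
      refine Real.abs_le_sqrt ?_
      have := antitoneOn_besselEnergy (Set.mem_Ici.2 ha) (Set.mem_Ici.2 (ha.trans hx.1)) hx.1
      refine le_trans ?_ this
      simp only [besselEnergy]
      nlinarith [sq_nonneg (besselJ0 x)])
    (Set.left_mem_Icc.2 hab) (Set.right_mem_Icc.2 hab)
  rwa [Real.norm_eq_abs, Real.norm_eq_abs, abs_of_nonneg (sub_nonneg.2 hab)] at h

theorem abs_besselJ0_sub_one_le {r : ℝ} (hr : 0 ≤ r) : |besselJ0 r - 1| ≤ r := by
  have := abs_besselJ0_sub_le le_rfl hr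
  rwa [besselEnergy_zero, besselJ0_zero, Real.sqrt_one, one_mul, sub_zero] at this

theorem one_le_of_besselJ0_eq_zero {r : ℝ} (hr : 0 ≤ r) (h : besselJ0 r = 0) : 1 ≤ r := by
  have := abs_besselJ0_sub_one_le hr
  rw [h] at this
  simpa using this

/-- At a critical point `ξ` between the zeros the energy is `J₀(ξ)²`, so beyond `ξ` the slope is at
most `|J₀(ξ)|` and the graph needs at least unit length to come down to zero. -/
theorem one_le_sub_of_besselJ0_eq_zero {a b : ℝ} (ha : 0 ≤ a) (hab : a < b)
    (h1 : besselJ0 a = 0) (h2 : besselJ0 b = 0) : 1 ≤ b - a := by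
  obtain ⟨ξ, hξ, hξ0⟩ := exists_hasDerivAt_eq_zero hab continuous_besselJ0.continuousOn
    (h1.trans h2.symm) fun x _ => hasDerivAt_besselJ0 x
  have hξpos : 0 < ξ := lt_of_le_of_lt ha hξ.1
  have hE := besselEnergy_pos hξpos
  have h := abs_besselJ0_sub_le hξpos.le hξ.2.le
  have hEξ : Real.sqrt (besselEnergy ξ) = |besselJ0 ξ| := by
    rw [besselEnergy, hξ0, zero_pow two_ne_zero, zero_add, Real.sqrt_sq_eq_abs]
  have hpos : 0 < |besselJ0 ξ| := by rw [← hEξ]; exact Real.sqrt_pos.2 hE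
  rw [h2, zero_sub, abs_neg, hEξ] at h
  have : 1 ≤ b - ξ := le_of_mul_le_mul_left (by linarith) hpos
  linarith [hξ.1]

/-- `√x J₀(x)`, which solves `w'' + (1 + 1 / (4x²)) w = 0`. -/
def besselW (x : ℝ) : ℝ := Real.sqrt x * besselJ0 x

def besselWDeriv (x : ℝ) : ℝ := besselJ0 x / (2 * Real.sqrt x) + Real.sqrt x * besselJ0Deriv x

theorem hasDerivAt_besselW {x : ℝ} (hx : 0 < x) : HasDerivAt besselW (besselWDeriv x) x := by
  refine ((Real.hasDerivAt_sqrt hx.ne').mul (hasDerivAt_besselJ0 x)).congr_deriv ?_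
  rw [besselWDeriv]; ring

theorem hasDerivAt_besselWDeriv {x : ℝ} (hx : 0 < x) :
    HasDerivAt besselWDeriv (-(1 + 1 / (4 * x ^ 2)) * besselW x) x := by
  have hs : 0 < Real.sqrt x := Real.sqrt_pos.2 hx
  refine (((hasDerivAt_besselJ0 x).div ((Real.hasDerivAt_sqrt hx.ne').const_mul 2)
    (by positivity)).add ((Real.hasDerivAt_sqrt hx.ne').mul
    (hasDerivAt_besselJ0Deriv hx.ne'))).congr_deriv ?_
  rw [besselW]
  obtain ⟨s, hs', rfl⟩ : ∃ s, 0 < s ∧ x = s ^ 2 :=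
    ⟨Real.sqrt x, hs, (Real.sq_sqrt hx.le).symm⟩
  rw [Real.sqrt_sq hs'.le]
  field_simp
  ring

/-- Sturm comparison: `√x J₀` oscillates at least as fast as a solution of `w'' + w = 0`, so it
cannot keep its sign over a half period of `sin (x - a)`. -/
theorem exists_besselJ0_zero {a : ℝ} (ha : 0 < a) :
    ∃ b, a < b ∧ b ≤ a + Real.pi ∧ besselJ0 b = 0 := by
  by_contra! hne
  have hπ := Real.pi_pos
  have hconn : IsPreconnected (Set.Ioc a (a + Real.pi)) := isPreconnected_Ioc
  -- It suffices to treat a function `σ J₀` with `σ = ±1` that is positive on the interval.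
  obtain ⟨σ, hσ⟩ : ∃ σ : ℝ, ∀ x ∈ Set.Ioc a (a + Real.pi), 0 < σ * besselJ0 x := by
    rcases lt_or_gt_of_ne (hne (a + Real.pi) (by linarith) le_rfl) with h | h
    · refine ⟨-1, fun x hx => ?_⟩
      by_contra hx'
      have hx0 : 0 ≤ besselJ0 x := by linarith
      obtain ⟨y, hy, hy0⟩ := intermediate_value_Icc hx.2 continuous_besselJ0.continuousOn.neg
        (show (0 : ℝ) ∈ Set.Icc (-besselJ0 x) (-besselJ0 (a + Real.pi)) from
          ⟨by linarith, by linarith⟩)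
      exact hne y (lt_of_lt_of_le hx.1 hy.1) hy.2 (neg_eq_zero.1 hy0)
    · refine ⟨1, fun x hx => ?_⟩
      by_contra hx'
      have hx0 : besselJ0 x ≤ 0 := by linarith
      obtain ⟨y, hy, hy0⟩ := intermediate_value_Icc hx.2 continuous_besselJ0.continuousOn
        (show (0 : ℝ) ∈ Set.Icc (besselJ0 x) (besselJ0 (a + Real.pi)) from
          ⟨by linarith, by linarith⟩)
      exact hne y (lt_of_lt_of_le hx.1 hy.1) hy.2 hy0
  have hσa : 0 ≤ σ * besselJ0 a := by
    have hc : Tendsto (fun x => σ * besselJ0 x) (𝓝[>] a) (𝓝 (σ * besselJ0 a)) :=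
      ((continuous_const.mul continuous_besselJ0).continuousAt).tendsto.mono_left
        nhdsWithin_le_nhds
    refine ge_of_tendsto hc ?_
    filter_upwards [Ioc_mem_nhdsGT (show a < a + Real.pi by linarith)] with x hx
    exact (hσ x hx).le
  -- The Wronskian of `√x J₀` with `sin (x - a)`. It would be nondecreasing on the interval, yet it
  -- is nonnegative at `a` and negative at `a + π`.
  set Wr : ℝ → ℝ := fun x =>
    σ * (besselW x * Real.cos (x - a) - besselWDeriv x * Real.sin (x - a)) with hWr
  have hd : ∀ x, 0 < x → HasDerivAt Wr
      (σ * (1 / (4 * x ^ 2) * besselW x * Real.sin (x - a))) x := by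
    intro x hx
    have hsub : HasDerivAt (fun x => x - a) 1 x := (hasDerivAt_id x).sub_const a
    refine ((((hasDerivAt_besselW hx).mul hsub.cos).sub
      ((hasDerivAt_besselWDeriv hx).mul hsub.sin)).const_mul σ).congr_deriv ?_
    ring
  have hmono : MonotoneOn Wr (Set.Icc a (a + Real.pi)) := by
    refine monotoneOn_of_hasDerivWithinAt_nonneg (convex_Icc _ _)
      (fun x hx => (hd x (lt_of_lt_of_le ha hx.1)).continuousAt.continuousWithinAt)
      (fun x hx => (hd x ?_).hasDerivWithinAt) fun x hx => ?_
    · rw [interior_Icc] at hx; exact ha.trans hx.1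
    · rw [interior_Icc] at hx
      have h1 := hσ x ⟨hx.1, hx.2.le⟩
      have h2 : 0 ≤ Real.sin (x - a) :=
        Real.sin_nonneg_of_nonneg_of_le_pi (by linarith [hx.1]) (by linarith [hx.2])
      have e : σ * (1 / (4 * x ^ 2) * besselW x * Real.sin (x - a)) =
          1 / (4 * x ^ 2) * Real.sqrt x * (σ * besselJ0 x) * Real.sin (x - a) := by
        rw [besselW]; ring
      rw [e]
      positivity
  have h := hmono (Set.left_mem_Icc.2 (by linarith)) (Set.right_mem_Icc.2 (by linarith))
    (by linarith)
  have e1 : Wr a = Real.sqrt a * (σ * besselJ0 a) := by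
    simp only [hWr, besselW, sub_self, Real.cos_zero, Real.sin_zero]; ring
  have e2 : Wr (a + Real.pi) = -(Real.sqrt (a + Real.pi) * (σ * besselJ0 (a + Real.pi))) := by
    simp only [hWr, besselW, add_sub_cancel_left, Real.cos_pi, Real.sin_pi]; ring
  rw [e1, e2] at h
  have h1 : 0 ≤ Real.sqrt a * (σ * besselJ0 a) := by positivity
  have h2 : 0 < Real.sqrt (a + Real.pi) * (σ * besselJ0 (a + Real.pi)) :=
    mul_pos (Real.sqrt_pos.2 (by linarith)) (hσ _ ⟨by linarith, le_rfl⟩)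
  linarith

/-- For `x ≥ 1`, `x J₀(x)²` is the square of `√x J₀` and is dominated by the energy of the equation
of `√x J₀`, which is nonincreasing because the potential `1 + 1 / (4x²)` is; for `x ≤ 1` the bound
`|J₀| ≤ 1` suffices. -/
theorem exists_besselJ0_sq_le : ∃ B : ℝ, 0 < B ∧ ∀ x : ℝ, 0 < x → x * besselJ0 x ^ 2 ≤ B := by
  set E : ℝ → ℝ := fun x => besselWDeriv x ^ 2 + (1 + 1 / (4 * x ^ 2)) * besselW x ^ 2 with hE
  have hd : ∀ x, 0 < x → HasDerivAt E (-(1 / (2 * x ^ 3)) * besselW x ^ 2) x := by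
    intro x hx
    have h4 : HasDerivAt (fun x : ℝ => 1 + 1 / (4 * x ^ 2)) (-(1 / (2 * x ^ 3))) x := by
      have := (((hasDerivAt_pow 2 x).const_mul 4).inv (by positivity)).const_add 1
      simp only [one_div]
      refine this.congr_deriv ?_
      field_simp; norm_num; ring
    refine (((hasDerivAt_besselWDeriv hx).pow 2).add
      (h4.mul ((hasDerivAt_besselW hx).pow 2))).congr_deriv ?_
    simp only [Pi.pow_apply]
    ring
  have hanti : AntitoneOn E (Set.Ici 1) := by
    refine antitoneOn_of_hasDerivWithinAt_nonpos (convex_Ici 1)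
      (fun x hx => (hd x (lt_of_lt_of_le one_pos hx)).continuousAt.continuousWithinAt)
      (fun x hx => (hd x ?_).hasDerivWithinAt) fun x hx => ?_
    · rw [interior_Ici] at hx; exact one_pos.trans hx
    · rw [interior_Ici] at hx
      have hx' : 0 < x := one_pos.trans hx
      have : 0 ≤ (1 / (2 * x ^ 3)) * besselW x ^ 2 := by positivity
      linarith
  refine ⟨max 1 (E 1), by positivity, fun x hx => ?_⟩
  rcases le_total x 1 with h1 | h1
  · refine le_max_of_le_left ?_
    have := (sq_le_one_iff_abs_le_one _).2 (abs_besselJ0_le_one hx.le)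
    nlinarith
  · refine le_max_of_le_right (le_trans ?_ (hanti Set.self_mem_Ici h1 h1))
    have e : x * besselJ0 x ^ 2 = besselW x ^ 2 := by
      rw [besselW, mul_pow, Real.sq_sqrt hx.le]
    rw [e, hE]
    have h2 : 0 ≤ besselWDeriv x ^ 2 := sq_nonneg _
    have h3 : 0 ≤ 1 / (4 * x ^ 2) * besselW x ^ 2 := by positivity
    simp only
    linarith

/-! ### The zeros of `J₀` -/

/-- The unit gap keeps the later zeros away from the current one, so their set is closed and the
infimum defining the next zero is attained. -/
theorem besselZero_succ_aux {n : ℕ} (h0 : 0 ≤ besselZero n)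
    (hz : besselZero n = 0 ∨ besselJ0 (besselZero n) = 0) :
    besselJ0 (besselZero (n + 1)) = 0 ∧ besselZero n + 1 ≤ besselZero (n + 1) ∧
      besselZero (n + 1) ≤ besselZero n + 4 := by
  set z := besselZero n with hzdef
  set S : Set ℝ := {r : ℝ | z < r ∧ besselJ0 r = 0} with hS
  have hgap : ∀ r ∈ S, z + 1 ≤ r := by
    intro r hr
    rcases hz with h | h
    · have := one_le_of_besselJ0_eq_zero (h0.trans hr.1.le) hr.2
      rw [h]; linarith
    · have := one_le_sub_of_besselJ0_eq_zero h0 hr.1 h hr.2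
      linarith
  have hne : ∃ b ∈ S, b ≤ z + 4 := by
    have hπ := Real.pi_lt_d2
    -- The search starts at `z + 1/2` since the comparison needs a positive left endpoint and `z =
    -- 0` when `n = 0`; `1/2 + π < 4`.
    obtain ⟨b, hb1, hb2, hb3⟩ := exists_besselJ0_zero (a := z + 1 / 2) (by linarith)
    exact ⟨b, ⟨by linarith, hb3⟩, by linarith⟩
  have hbdd : BddBelow S := ⟨z + 1, fun r hr => hgap r hr⟩
  have hclosed : IsClosed S := by
    have : S = Set.Ici (z + 1) ∩ {r | besselJ0 r = 0} := by
      ext r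
      exact ⟨fun hr => ⟨hgap r hr, hr.2⟩, fun hr => ⟨by
        have : z + 1 ≤ r := hr.1
        linarith, hr.2⟩⟩
    rw [this]
    exact isClosed_Ici.inter (isClosed_eq continuous_besselJ0 continuous_const)
  obtain ⟨b, hbS, hb⟩ := hne
  have hmem : sInf S ∈ S := hclosed.csInf_mem ⟨b, hbS⟩ hbdd
  have heq : besselZero (n + 1) = sInf S := rfl
  rw [heq]
  exact ⟨hmem.2, hgap _ hmem, (csInf_le hbdd hbS).trans hb⟩

theorem besselZero_bounds (n : ℕ) : (n : ℝ) ≤ besselZero n ∧ besselZero n ≤ 4 * n ∧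
    (besselZero n = 0 ∨ besselJ0 (besselZero n) = 0) := by
  induction n with
  | zero => simp [besselZero]
  | succ n ih =>
    obtain ⟨h1, h2, h3⟩ := ih
    obtain ⟨k1, k2, k3⟩ := besselZero_succ_aux ((Nat.cast_nonneg n).trans h1) h3
    push_cast
    exact ⟨by linarith, by linarith, Or.inr k1⟩

theorem le_besselZero (n : ℕ) : (n : ℝ) ≤ besselZero n := (besselZero_bounds n).1

theorem besselZero_le (n : ℕ) : besselZero n ≤ 4 * n := (besselZero_bounds n).2.1

theorem besselZero_pos {n : ℕ} (hn : 1 ≤ n) : 0 < besselZero n :=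
  lt_of_lt_of_le (by exact_mod_cast hn) (le_besselZero n)

theorem besselJ0_besselZero {n : ℕ} (hn : 1 ≤ n) : besselJ0 (besselZero n) = 0 :=
  (besselZero_bounds n).2.2.resolve_left (besselZero_pos hn).ne'

theorem strictMono_besselZero : StrictMono besselZero :=
  strictMono_nat_of_lt_succ fun n => by
    have := (besselZero_succ_aux ((Nat.cast_nonneg n).trans (le_besselZero n))
      (besselZero_bounds n).2.2).2.1
    linarith

/-! ### Radial solutions, profiles and radial Laplacians -/

/-! ### The Laplacian of radial functions on the plane -/

theorem hasFDerivAt_norm_of_ne_zero {E : Type*} [NormedAddCommGroup E] [InnerProductSpace ℝ E]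
    {x : E} (hx : x ≠ 0) :
    HasFDerivAt (fun y : E => ‖y‖) (‖x‖⁻¹ • innerSL ℝ x) x := by
  have hn : 0 < ‖x‖ := norm_pos_iff.2 hx
  have h := (hasStrictFDerivAt_norm_sq x).hasFDerivAt.sqrt (by positivity)
  simp only [Real.sqrt_sq (norm_nonneg _)] at h
  refine h.congr_fderiv ?_
  ext y
  simp only [smul_apply, smul_eq_mul, nsmul_eq_mul]
  field_simp
  norm_num

/-- In the plane `Δh = r⁻¹ (r h')'`, so data for `h₁ = r h'` suffice and `h''` need not appear. Only
points off the origin, where the norm is smooth, are covered; in `L²` nothing else matters. -/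
theorem laplacian_radial {E : Type*} [NormedAddCommGroup E] [NormedSpace ℝ E] {h h₁ k : ℝ → E}
    (hh : ∀ r, 0 < r → HasDerivAt h (r⁻¹ • h₁ r) r)
    (hh₁ : ∀ r, 0 < r → HasDerivAt h₁ (r • k r) r) {x : Plane} (hx : x ≠ 0) :
    (Δ (fun y : Plane => h ‖y‖)) x = k ‖x‖ := by
  have hf : ∀ y : Plane, y ≠ 0 → HasFDerivAt (fun y : Plane => h ‖y‖)
      ((innerSL ℝ y).smulRight ((‖y‖ ^ 2)⁻¹ • h₁ ‖y‖)) y := by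
    intro y hy
    have hn : 0 < ‖y‖ := norm_pos_iff.2 hy
    refine ((hh _ hn).hasFDerivAt.comp y (hasFDerivAt_norm_of_ne_zero hy)).congr_fderiv ?_
    ext z
    simp [smul_smul]
    congr 1; field_simp
  have hev : fderiv ℝ (fun y : Plane => h ‖y‖) =ᶠ[𝓝 x]
      fun y => (innerSL ℝ y).smulRight ((‖y‖ ^ 2)⁻¹ • h₁ ‖y‖) := by
    filter_upwards [isOpen_ne.mem_nhds hx] with y hy using (hf y hy).fderiv
  have hn : 0 < ‖x‖ := norm_pos_iff.2 hx
  have hcoef : HasDerivAt (fun r : ℝ => (r ^ 2)⁻¹ • h₁ r)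
      ((‖x‖ ^ 2)⁻¹ • (‖x‖ • k ‖x‖) + (-(2 * ‖x‖) / (‖x‖ ^ 2) ^ 2) • h₁ ‖x‖) ‖x‖ := by
    have := ((hasDerivAt_pow 2 ‖x‖).inv (by positivity)).smul (hh₁ _ hn)
    refine this.congr_deriv ?_
    simp
  set c' := (‖x‖ ^ 2)⁻¹ • (‖x‖ • k ‖x‖) + (-(2 * ‖x‖) / (‖x‖ ^ 2) ^ 2) • h₁ ‖x‖ with hc'
  have hval : ∀ v w : Plane, fderiv ℝ (fderiv ℝ (fun y : Plane => h ‖y‖)) x v w =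
      (inner ℝ x w * (‖x‖⁻¹ * inner ℝ x v)) • c' +
        (inner ℝ v w : ℝ) • ((‖x‖ ^ 2)⁻¹ • h₁ ‖x‖) := by
    intro v w
    rw [hev.fderiv_eq]
    have h1 : HasFDerivAt (fun y : Plane => (‖y‖ ^ 2)⁻¹ • h₁ ‖y‖) _ x :=
      hcoef.hasFDerivAt.comp x (hasFDerivAt_norm_of_ne_zero hx)
    have h2 : HasFDerivAt (fun y : Plane => innerSL ℝ y) (innerSL ℝ) x :=
      (innerSL ℝ : Plane →L[ℝ] _).hasFDerivAt
    have h3 := ((ContinuousLinearMap.smulRightL ℝ Plane E).isBoundedBilinearMap.hasFDerivAt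
      (innerSL ℝ x, (‖x‖ ^ 2)⁻¹ • h₁ ‖x‖)).comp x (h2.prodMk h1)
    have h4 : fderiv ℝ (fun y : Plane => (innerSL ℝ y).smulRight ((‖y‖ ^ 2)⁻¹ • h₁ ‖y‖)) x = _ :=
      h3.fderiv
    rw [h4]
    simp [smul_smul]
    rfl
  rw [congrFun (InnerProductSpace.laplacian_eq_iteratedFDeriv_orthonormalBasis (fun y : Plane => h ‖y‖)
    (EuclideanSpace.basisFun (Fin 2) ℝ)) x]
  simp only [iteratedFDeriv_two_apply, hval, Fin.sum_univ_two]
  have hx2 : ‖x‖ ^ 2 = x 0 ^ 2 + x 1 ^ 2 := by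
    rw [EuclideanSpace.norm_sq_eq]; simp
  simp only [Matrix.cons_val_zero, Matrix.cons_val_one, EuclideanSpace.basisFun_apply,
    EuclideanSpace.inner_single_right]
  simp only [one_mul, conj_trivial, hc']
  simp only [PiLp.single_apply, if_true, smul_add, smul_smul]
  have e : ∀ (a b c d : ℝ) , a + c = 1 → b + d = -(2 * (‖x‖ ^ 2)⁻¹) →
    (a • k ‖x‖ + b • h₁ ‖x‖ + (1 * (‖x‖ ^ 2)⁻¹) • h₁ ‖x‖ + (c • k ‖x‖ + d • h₁ ‖x‖ +
      (1 * (‖x‖ ^ 2)⁻¹) • h₁ ‖x‖)) = k ‖x‖ := by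
    intro a b c d h1 h2
    have : (a • k ‖x‖ + b • h₁ ‖x‖ + (1 * (‖x‖ ^ 2)⁻¹) • h₁ ‖x‖ + (c • k ‖x‖ + d • h₁ ‖x‖ +
      (1 * (‖x‖ ^ 2)⁻¹) • h₁ ‖x‖)) = (a + c) • k ‖x‖ +
        (b + d + 2 * (‖x‖ ^ 2)⁻¹) • h₁ ‖x‖ := by module
    rw [this, h1, h2]; simp
  refine e _ _ _ _ ?_ ?_
  · field_simp; linarith
  · field_simp; linarith

/-! ### Profiles built from the ground state -/

/-- `q` solves `q'' + q'/r = q - q³` on `(0, ∞)`, `p = r q'`, and both decay exponentially. -/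
structure IsRadialSolution (q p : ℝ → ℝ) : Prop where
  continuousOn : ContinuousOn q (Set.Ici 0)
  continuousOn' : ContinuousOn p (Set.Ici 0)
  zero' : p 0 = 0
  hasDerivAt : ∀ r, 0 < r → HasDerivAt q (p r / r) r
  hasDerivAt' : ∀ r, 0 < r → HasDerivAt p (r * (q r - q r ^ 3)) r
  pos : ∀ r, 0 ≤ r → 0 < q r
  decay : ∃ A c : ℝ, 0 < c ∧ ∀ r, 0 ≤ r → |q r| ≤ A * Real.exp (-c * r)
  decay' : ∃ A c : ℝ, 0 < c ∧ ∀ r, 0 ≤ r → |p r| ≤ A * Real.exp (-c * r)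

/-! ### Exponential decay of `r q'`. -/

theorem mul_exp_neg_le {c : ℝ} (hc : 0 < c) (r : ℝ) :
    r * Real.exp (-c * r) ≤ 2 / c * Real.exp (-(c / 2) * r) := by
  have h1 : c / 2 * r ≤ Real.exp (c / 2 * r) := by
    linarith [Real.add_one_le_exp (c / 2 * r)]
  have h2 : r ≤ 2 / c * Real.exp (c / 2 * r) := by
    have e : r = 2 / c * (c / 2 * r) := by field_simp
    calc r = 2 / c * (c / 2 * r) := e
      _ ≤ _ := by gcongr
  calc r * Real.exp (-c * r) ≤ 2 / c * Real.exp (c / 2 * r) * Real.exp (-c * r) := by gcongr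
    _ = 2 / c * Real.exp (-(c / 2) * r) := by rw [mul_assoc, ← Real.exp_add]; ring_nf

/-- If `q → 0` and `r q' ` stays above a positive constant then we reach a contradiction. -/
theorem not_lower_bound_of_tendsto_zero {q p : ℝ → ℝ} (hq : Tendsto q atTop (𝓝 0))
    (hd : ∀ r, 0 < r → HasDerivAt q (p r / r) r) {r κ : ℝ} (hκ : 0 < κ)
    (h : ∀ s, r ≤ s → κ ≤ p s) : False := by
  have h2 : Tendsto (fun s => q (2 * s) - q s) atTop (𝓝 0) := by
    have := (hq.comp (tendsto_id.const_mul_atTop (by norm_num : (0 : ℝ) < 2))).sub hq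
    simpa using this
  obtain ⟨s, hs1, hs2⟩ := ((h2.eventually (gt_mem_nhds (by positivity : 0 < κ / 2))).and
    (eventually_ge_atTop (max r 1))).exists
  have hs0 : 0 < s := lt_of_lt_of_le one_pos ((le_max_right _ _).trans hs2)
  have hsr : r ≤ s := (le_max_left _ _).trans hs2
  obtain ⟨ξ, hξ, hξ'⟩ := exists_hasDerivAt_eq_slope q (fun x => p x / x)
    (show s < 2 * s by linarith)
    (fun x hx => (hd x (lt_of_lt_of_le hs0 hx.1)).continuousAt.continuousWithinAt)
    (fun x hx => hd x (hs0.trans hx.1))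
  have hξ0 : 0 < ξ := hs0.trans hξ.1
  have hp := h ξ (hsr.trans hξ.1.le)
  rw [eq_div_iff (by linarith)] at hξ'
  have h3 : κ / 2 ≤ p ξ / ξ * (2 * s - s) := by
    rw [div_mul_eq_mul_div, le_div_iff₀ hξ0]
    nlinarith [hξ.2]
  linarith

/-- The difference `p - C e^{-c r}` is nondecreasing. Were it positive somewhere, `r q'` would stay
above a positive constant, forcing logarithmic growth of `q` against `q → 0`. -/
theorem le_of_deriv_decay {q p g : ℝ → ℝ} (hq : Tendsto q atTop (𝓝 0))
    (hd : ∀ r, 0 < r → HasDerivAt q (p r / r) r) (hd' : ∀ r, 0 < r → HasDerivAt p (g r) r)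
    {C c : ℝ} (hC : 0 ≤ C) (hg : ∀ r, 0 < r → |g r| ≤ c * C * Real.exp (-c * r))
    {r : ℝ} (hr : 0 < r) : p r ≤ C * Real.exp (-c * r) := by
  by_contra! hlt
  have hψ : ∀ s, HasDerivAt (fun s => C * Real.exp (-c * s)) (-(c * C * Real.exp (-c * s))) s := by
    intro s
    refine ((((hasDerivAt_id s).const_mul (-c)).exp).const_mul C).congr_deriv ?_
    simp; ring
  have hmono : MonotoneOn (fun s => p s - C * Real.exp (-c * s)) (Set.Ioi 0) := by
    refine monotoneOn_of_hasDerivWithinAt_nonneg (convex_Ioi 0)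
      (fun s hs => ((hd' s hs).sub (hψ s)).continuousAt.continuousWithinAt)
      (fun s hs => ((hd' s (by simpa using hs)).sub (hψ s)).hasDerivWithinAt) fun s hs => ?_
    have := (abs_le.1 (hg s (by simpa using hs))).1
    linarith
  refine not_lower_bound_of_tendsto_zero hq hd (sub_pos.2 hlt) (r := r) fun s hs => ?_
  have h1 := hmono (Set.mem_Ioi.2 hr) (Set.mem_Ioi.2 (hr.trans_le hs)) hs
  simp only at h1
  have : 0 ≤ C * Real.exp (-c * s) := by positivity
  linarith

theorem tendsto_exp_neg_mul_atTop {c : ℝ} (hc : 0 < c) (A : ℝ) :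
    Tendsto (fun r => A * Real.exp (-c * r)) atTop (𝓝 0) := by
  have h : Tendsto (fun r : ℝ => -c * r) atTop atBot :=
    tendsto_id.const_mul_atTop_of_neg (neg_neg_of_pos hc)
  simpa using (Real.tendsto_exp_atBot.comp h).const_mul A

theorem tendsto_zero_of_exp_decay {h : ℝ → ℝ} {A c : ℝ} (hc : 0 < c)
    (hd : ∀ r, 0 ≤ r → |h r| ≤ A * Real.exp (-c * r)) : Tendsto h atTop (𝓝 0) := by
  refine squeeze_zero_norm' ?_ (tendsto_exp_neg_mul_atTop hc A)
  filter_upwards [eventually_ge_atTop 0] with r hr using hd r hr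

/-- Restriction to a ray turns the equation into `(r q')' = r (q - q³)`. Decay of `r q'` is not part
of the definition of a ground state: it follows from decay of the right-hand side, applied to `q`
and to `-q`. -/
theorem IsGroundState.isRadialSolution {q : ℝ → ℝ} (hq : IsGroundState q) :
    IsRadialSolution q (fun r => r * deriv q r) := by
  obtain ⟨A, c, hc, hA⟩ := hq.decay
  set e : Plane := EuclideanSpace.single 0 1 with he
  have hen : ‖e‖ = 1 := by simp [he]
  -- The even extension of `q` restricted to `[0, ∞)`; the profile itself is unconstrained at
  -- negative arguments.
  set f : ℝ → ℝ := fun r => q ‖r • e‖ with hf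
  have hfs : ContDiff ℝ 2 f := by
    have h1 : ContDiff ℝ 2 (fun r : ℝ => r • e) := by fun_prop
    exact hq.contDiff.comp h1
  have hfq : ∀ r, 0 ≤ r → f r = q r := fun r hr => by
    simp [hf, norm_smul, hen, abs_of_nonneg hr]
  have hev : ∀ r, 0 < r → f =ᶠ[𝓝 r] q := fun r hr => by
    filter_upwards [lt_mem_nhds hr] with s hs using hfq s hs.le
  have hdf : ContDiff ℝ 1 (deriv f) := by
    have h2 : ContDiff ℝ (1 + 1) f := by norm_num; exact hfs
    exact (contDiff_succ_iff_deriv.1 h2).2.2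
  have hdq : ∀ r, 0 < r → deriv q r = deriv f r := fun r hr => ((hev r hr).deriv_eq).symm
  have hd1 : ∀ r, 0 < r → HasDerivAt q (deriv q r) r := fun r hr => by
    rw [hdq r hr]
    exact ((hfs.differentiable (by norm_num)).differentiableAt.hasDerivAt).congr_of_eventuallyEq
      (hev r hr).symm
  have hd1' : ∀ r, 0 < r → HasDerivAt q (r * deriv q r / r) r := fun r hr =>
    (hd1 r hr).congr_deriv (by field_simp)
  have hd2 : ∀ r, 0 < r → HasDerivAt (deriv q) (deriv (deriv f) r) r := fun r hr => by
    refine ((hdf.differentiable (by norm_num)).differentiableAt.hasDerivAt).congr_of_eventuallyEq ?_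
    filter_upwards [lt_mem_nhds hr] with s hs using hdq s hs
  have hode : ∀ r, 0 < r → (1 * deriv q r + r * deriv (deriv f) r) / r = q r - q r ^ 3 := by
    intro r hr
    have hx : r • e ≠ 0 := smul_ne_zero hr.ne' (norm_pos_iff.1 (by rw [hen]; norm_num))
    have hxn : ‖r • e‖ = r := by rw [norm_smul, hen, Real.norm_eq_abs, abs_of_pos hr, mul_one]
    have hΔ := laplacian_radial (h := q) (h₁ := fun r => r * deriv q r)
      (k := fun r => (1 * deriv q r + r * deriv (deriv f) r) / r)
      (fun s hs => (hd1 s hs).congr_deriv (by rw [smul_eq_mul]; field_simp))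
      (fun s hs => ((hasDerivAt_id s).mul (hd2 s hs)).congr_deriv (by
        rw [smul_eq_mul]; simp only [id]; field_simp)) hx
    have h1 := hq.equation (r • e)
    rw [hΔ, hxn] at h1
    linarith
  have hd3 : ∀ r, 0 < r → HasDerivAt (fun r => r * deriv q r) (r * (q r - q r ^ 3)) r :=
    fun r hr => ((hasDerivAt_id r).mul (hd2 r hr)).congr_deriv (by
      rw [← hode r hr]; simp only [id]; field_simp)
  have hA' : ∀ r, 0 ≤ r → |q r| ≤ A * Real.exp (-c * r) := fun r hr => by
    rw [abs_of_pos (hq.pos r hr)]; exact hA r hr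
  have hA0 : 0 < A := by
    have := (hq.pos 0 le_rfl).trans_le (hA 0 le_rfl)
    simpa using this
  have hlim : Tendsto q atTop (𝓝 0) := tendsto_zero_of_exp_decay hc hA'
  set C : ℝ := 2 / c * (2 / c * (A + A ^ 3)) with hC
  have hC0 : 0 ≤ C := by positivity
  have hg : ∀ r, 0 < r → |r * (q r - q r ^ 3)| ≤ c / 2 * C * Real.exp (-(c / 2) * r) := by
    intro r hr
    have hq0 := hq.pos r hr.le
    have hqA := hA r hr.le
    have hE1 : Real.exp (-c * r) ≤ 1 := Real.exp_le_one_iff.2 (by nlinarith)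
    have hE0 := Real.exp_pos (-c * r)
    have h3 : q r ^ 3 ≤ A ^ 3 * Real.exp (-c * r) := by
      calc q r ^ 3 ≤ (A * Real.exp (-c * r)) ^ 3 := pow_le_pow_left₀ hq0.le hqA 3
        _ = A ^ 3 * Real.exp (-c * r) ^ 3 := by ring
        _ ≤ A ^ 3 * Real.exp (-c * r) := by
          gcongr
          exact pow_le_of_le_one hE0.le hE1 (by norm_num)
    have h4 : |q r - q r ^ 3| ≤ (A + A ^ 3) * Real.exp (-c * r) := by
      rw [abs_le]
      have : 0 ≤ q r ^ 3 := by positivity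
      have : 0 ≤ A ^ 3 * Real.exp (-c * r) := by positivity
      constructor <;> nlinarith
    rw [abs_mul, abs_of_pos hr]
    calc r * |q r - q r ^ 3| ≤ r * ((A + A ^ 3) * Real.exp (-c * r)) := by gcongr
      _ = (A + A ^ 3) * (r * Real.exp (-c * r)) := by ring
      _ ≤ (A + A ^ 3) * (2 / c * Real.exp (-(c / 2) * r)) := by
        exact mul_le_mul_of_nonneg_left (mul_exp_neg_le hc r) (by positivity)
      _ = _ := by rw [hC]; field_simp
  have hup : ∀ r, 0 < r → r * deriv q r ≤ C * Real.exp (-(c / 2) * r) := fun r hr =>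
    le_of_deriv_decay (p := fun r => r * deriv q r) hlim hd1' hd3 hC0 hg hr
  have hdown : ∀ r, 0 < r → -(r * deriv q r) ≤ C * Real.exp (-(c / 2) * r) := fun r hr =>
    le_of_deriv_decay (q := fun r => -q r) (p := fun r => -(r * deriv q r))
      (by simpa using hlim.neg)
      (fun s hs => (hd1' s hs).neg.congr_deriv (by ring)) (fun s hs => (hd3 s hs).neg) hC0
      (fun s hs => by rw [abs_neg]; exact hg s hs) hr
  exact
    { continuousOn := hfs.continuous.continuousOn.congr fun r hr => (hfq r hr).symm
      continuousOn' := by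
        refine (continuous_id.mul hdf.continuous).continuousOn.congr fun r hr => ?_
        rcases eq_or_lt_of_le (show (0 : ℝ) ≤ r from hr) with h | h
        · simp [← h]
        · simp [hdq r h]
      zero' := by simp
      hasDerivAt := hd1'
      hasDerivAt' := hd3
      pos := hq.pos
      decay := ⟨A, c, hc, hA'⟩
      decay' := ⟨C, c / 2, by positivity, fun r hr => by
        rcases eq_or_lt_of_le hr with h | h
        · rw [← h]; simpa using hC0
        · exact abs_le.2 ⟨by linarith [hdown r h], hup r h⟩⟩ }

/-- The functions generated from `q` and `p = r q'` by sums, products, real multiples and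
multiplication by `r`. -/
inductive Profile (q p : ℝ → ℝ) : (ℝ → ℝ) → Prop
  | base : Profile q p q
  | base' : Profile q p p
  | add {f g : ℝ → ℝ} : Profile q p f → Profile q p g → Profile q p fun r => f r + g r
  | smul {f : ℝ → ℝ} (c : ℝ) : Profile q p f → Profile q p fun r => c * f r
  | mul {f g : ℝ → ℝ} : Profile q p f → Profile q p g → Profile q p fun r => f r * g r
  | radius {f : ℝ → ℝ} : Profile q p f → Profile q p fun r => r * f r

namespace Profile

variable {q p h : ℝ → ℝ}

theorem continuousOn (hs : IsRadialSolution q p) (hh : Profile q p h) :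
    ContinuousOn h (Set.Ici 0) := by
  induction hh with
  | base => exact hs.continuousOn
  | base' => exact hs.continuousOn'
  | add _ _ h1 h2 => exact h1.add h2
  | smul c _ h1 => exact continuousOn_const.mul h1
  | mul _ _ h1 h2 => exact h1.mul h2
  | radius _ h1 => exact continuousOn_id.mul h1

theorem decay (hs : IsRadialSolution q p) (hh : Profile q p h) :
    ∃ A c : ℝ, 0 < c ∧ ∀ r, 0 ≤ r → |h r| ≤ A * Real.exp (-c * r) := by
  have nonneg : ∀ {f : ℝ → ℝ} {A c : ℝ}, (∀ r, 0 ≤ r → |f r| ≤ A * Real.exp (-c * r)) →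
      0 ≤ A := fun hf => by simpa using (abs_nonneg _).trans (hf 0 le_rfl)
  induction hh with
  | base => exact hs.decay
  | base' => exact hs.decay'
  | add _ _ h1 h2 =>
    obtain ⟨A, c, hc, hA⟩ := h1
    obtain ⟨B, d, hd, hB⟩ := h2
    refine ⟨A + B, min c d, lt_min hc hd, fun r hr => (abs_add_le _ _).trans ?_⟩
    rw [add_mul]
    refine add_le_add ((hA r hr).trans ?_) ((hB r hr).trans ?_)
    · exact mul_le_mul_of_nonneg_left (Real.exp_le_exp.2 (mul_le_mul_of_nonneg_right
        (neg_le_neg (min_le_left _ _)) hr)) (nonneg hA)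
    · exact mul_le_mul_of_nonneg_left (Real.exp_le_exp.2 (mul_le_mul_of_nonneg_right
        (neg_le_neg (min_le_right _ _)) hr)) (nonneg hB)
  | smul k _ h1 =>
    obtain ⟨A, c, hc, hA⟩ := h1
    refine ⟨|k| * A, c, hc, fun r hr => ?_⟩
    rw [abs_mul, mul_assoc]
    exact mul_le_mul_of_nonneg_left (hA r hr) (abs_nonneg _)
  | mul _ _ h1 h2 =>
    obtain ⟨A, c, hc, hA⟩ := h1
    obtain ⟨B, d, hd, hB⟩ := h2
    refine ⟨A * B, c + d, by positivity, fun r hr => ?_⟩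
    rw [abs_mul]
    refine (mul_le_mul (hA r hr) (hB r hr) (abs_nonneg _)
      (mul_nonneg (nonneg hA) (Real.exp_pos _).le)).trans (le_of_eq ?_)
    rw [show -(c + d) * r = -c * r + -d * r by ring, Real.exp_add]
    ring
  | radius _ h1 =>
    obtain ⟨A, c, hc, hA⟩ := h1
    refine ⟨A * (2 / c), c / 2, by positivity, fun r hr => ?_⟩
    rw [abs_mul, abs_of_nonneg hr]
    calc r * |_| ≤ r * (A * Real.exp (-c * r)) := mul_le_mul_of_nonneg_left (hA r hr) hr
      _ = A * (r * Real.exp (-c * r)) := by ring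
      _ ≤ A * (2 / c * Real.exp (-(c / 2) * r)) :=
        mul_le_mul_of_nonneg_left (mul_exp_neg_le hc r) (nonneg hA)
      _ = _ := by ring

/-- The class is closed under `r d/dr`. -/
theorem exists_hasDerivAt (hs : IsRadialSolution q p) (hh : Profile q p h) :
    ∃ h', Profile q p h' ∧ ∀ r, 0 < r → HasDerivAt h (h' r / r) r := by
  induction hh with
  | base => exact ⟨p, base', hs.hasDerivAt⟩
  | base' =>
    refine ⟨_, ((base.add ((base.mul (base.mul base)).smul (-1))).radius).radius, fun r hr =>
      (hs.hasDerivAt' r hr).congr_deriv ?_⟩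
    field_simp; ring
  | add _ _ h1 h2 =>
    obtain ⟨f', hf, hf'⟩ := h1
    obtain ⟨g', hg, hg'⟩ := h2
    exact ⟨_, hf.add hg, fun r hr => ((hf' r hr).add (hg' r hr)).congr_deriv (by ring)⟩
  | smul c _ h1 =>
    obtain ⟨f', hf, hf'⟩ := h1
    exact ⟨_, hf.smul c, fun r hr => ((hf' r hr).const_mul c).congr_deriv (by ring)⟩
  | mul h1 h2 ih1 ih2 =>
    obtain ⟨f', hf, hf'⟩ := ih1
    obtain ⟨g', hg, hg'⟩ := ih2
    exact ⟨_, (hf.mul h2).add (h1.mul hg), fun r hr =>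
      ((hf' r hr).mul (hg' r hr)).congr_deriv (by ring)⟩
  | radius h1 ih1 =>
    obtain ⟨f', hf, hf'⟩ := ih1
    exact ⟨_, h1.radius.add hf.radius, fun r hr =>
      ((hasDerivAt_id r).mul (hf' r hr)).congr_deriv (by simp only [id]; field_simp)⟩

end Profile

/-- A decaying profile `ψ` with `ψ₁ = r ψ'` and two-dimensional Laplacian `γ`. -/
structure IsLaplaceTriple (q p ψ ψ₁ γ : ℝ → ℝ) : Prop where
  profile : Profile q p ψ
  profile₁ : Profile q p ψ₁
  profileΔ : Profile q p γ
  zero : ψ₁ 0 = 0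
  hasDerivAt : ∀ r, 0 < r → HasDerivAt ψ (ψ₁ r / r) r
  hasDerivAt₁ : ∀ r, 0 < r → HasDerivAt ψ₁ (r * γ r) r
  integral_ne_zero : ∫ r in Set.Ioi (0 : ℝ), ψ r * r ≠ 0

theorem Profile.integrableOn {q p h : ℝ → ℝ} (hs : IsRadialSolution q p) (hh : Profile q p h) :
    IntegrableOn h (Set.Ioi 0) := by
  obtain ⟨A, c, hc, hA⟩ := hh.decay hs
  refine Integrable.mono' ((exp_neg_integrableOn_Ioi 0 hc).const_mul A)
    ((hh.continuousOn hs).mono Set.Ioi_subset_Ici_self |>.aestronglyMeasurable measurableSet_Ioi) ?_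
  filter_upwards [ae_restrict_mem measurableSet_Ioi] with r hr using hA r (le_of_lt hr)

/-- `f₁ = r f'` and `Δ f` for `f = q`. -/
theorem isLaplaceTriple_base {q p : ℝ → ℝ} (hs : IsRadialSolution q p) :
    IsLaplaceTriple q p q p (fun r => q r - q r ^ 3) where
  profile := .base
  profile₁ := .base'
  profileΔ := by
    have := Profile.base (q := q) (p := p)
    have h := this.add ((this.mul (this.mul this)).smul (-1))
    convert h using 2
    ring
  zero := hs.zero'
  hasDerivAt := hs.hasDerivAt
  hasDerivAt₁ := hs.hasDerivAt'
  integral_ne_zero := by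
    refine ne_of_gt ?_
    rw [setIntegral_pos_iff_support_of_nonneg_ae]
    · have : Function.support (fun r => q r * r) ∩ Set.Ioi 0 = Set.Ioi 0 :=
        Set.inter_eq_right.2 fun r hr =>
          mul_ne_zero (hs.pos r (le_of_lt hr)).ne' (ne_of_gt hr)
      rw [this]; simp
    · filter_upwards [ae_restrict_mem measurableSet_Ioi] with r hr
      exact mul_nonneg (hs.pos r (le_of_lt hr)).le (le_of_lt hr)
    · have := (Profile.base (q := q) (p := p)).radius.integrableOn hs
      exact this.congr_fun (fun r _ => mul_comm _ _) measurableSet_Ioi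

/-- The generator of the scaling, `Λ q = q + r q'`. -/
theorem isLaplaceTriple_scaling {q p : ℝ → ℝ} (hs : IsRadialSolution q p) :
    IsLaplaceTriple q p (fun r => q r + p r) (fun r => p r + r * (r * (q r - q r ^ 3)))
      (fun r => 3 * (q r - q r ^ 3) + (p r - 3 * q r ^ 2 * p r)) where
  profile := Profile.base.add .base'
  profile₁ := Profile.base'.add (isLaplaceTriple_base hs).profileΔ.radius.radius
  profileΔ := by
    have hb := Profile.base (q := q) (p := p)
    have h := ((isLaplaceTriple_base hs).profileΔ.smul 3).add
      (Profile.base'.add (((hb.mul hb).mul .base').smul (-3)))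
    convert h using 2
    ring
  zero := by simp [hs.zero']
  hasDerivAt r hr := ((hs.hasDerivAt r hr).add (hs.hasDerivAt' r hr)).congr_deriv
    (by field_simp)
  hasDerivAt₁ r hr := by
    have h1 := hs.hasDerivAt r hr
    have h2 := (hasDerivAt_id r).mul ((hasDerivAt_id r).mul (h1.sub (h1.pow 3)))
    refine ((hs.hasDerivAt' r hr).add h2).congr_deriv ?_
    simp only [id, Pi.sub_apply, Pi.pow_apply, Pi.mul_apply]
    field_simp
    ring
  integral_ne_zero := by
    have hi1 : IntegrableOn (fun r => q r * r) (Set.Ioi 0) :=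
      ((Profile.base (q := q) (p := p)).radius.integrableOn hs).congr_fun
        (fun r _ => mul_comm _ _) measurableSet_Ioi
    have hi2 : IntegrableOn (fun r => p r * r) (Set.Ioi 0) :=
      ((Profile.base' (q := q) (p := p)).radius.integrableOn hs).congr_fun
        (fun r _ => mul_comm _ _) measurableSet_Ioi
    have hcont : ContinuousWithinAt (fun r => r * (r * q r)) (Set.Ici 0) 0 :=
      (Profile.base (q := q) (p := p)).radius.radius.continuousOn hs 0 Set.self_mem_Ici
    obtain ⟨A, c, hc, hA⟩ := (Profile.base (q := q) (p := p)).radius.radius.decay hs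
    -- Integrating `(r² q)' = 2 q r + (r q') r` shows that the integral of `(q + r q') r` is minus
    -- that of `q r`, hence nonzero.
    have hzero := integral_Ioi_of_hasDerivAt_of_tendsto
      (f := fun r => r * (r * q r)) (f' := fun r => 2 * (q r * r) + p r * r) hcont
      (fun r hr => ((hasDerivAt_id r).mul ((hasDerivAt_id r).mul (hs.hasDerivAt r hr))).congr_deriv
        (by
          have hr' : r ≠ 0 := ne_of_gt hr
          simp only [id, Pi.mul_apply]; field_simp; ring))
      ((hi1.const_mul 2).add hi2) (tendsto_zero_of_exp_decay hc hA)
    rw [integral_add (hi1.const_mul 2) hi2, integral_const_mul] at hzero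
    have e : ∀ r, (q r + p r) * r = q r * r + p r * r := fun r => by ring
    simp only [e]
    rw [integral_add hi1 hi2]
    have := (isLaplaceTriple_base hs).integral_ne_zero
    intro h
    apply this
    simp only [zero_mul, sub_zero] at hzero
    linarith

/-! ### Radial functions in `L²(𝔻)` and their dependence on the scale -/

/-! ### Radial real-valued functions in `L²(𝔻)` -/

/-- Twice the area of the unit disc. -/
def discConst : ℝ := 2 * (volume : Measure Plane).real (Metric.ball 0 1)

theorem discConst_pos : 0 < discConst := by
  have : 0 < (volume : Measure Plane).real (Metric.ball 0 1) :=
    ENNReal.toReal_pos (Metric.measure_ball_pos _ _ one_pos).ne' measure_ball_lt_top.ne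
  unfold discConst; linarith

instance : IsFiniteMeasure ((volume : Measure Plane).restrict disc) :=
  ⟨by rw [Measure.restrict_apply_univ]; exact measure_ball_lt_top⟩

theorem integral_disc_radial (φ : ℝ → ℝ) :
    ∫ x in disc, φ ‖x‖ = discConst * ∫ r in (0 : ℝ)..1, φ r * r := by
  have hdisc : MeasurableSet disc := Metric.isOpen_ball.measurableSet
  rw [← integral_indicator hdisc]
  have e : (disc.indicator fun x : Plane => φ ‖x‖) =
      fun x : Plane => (Set.Iio (1 : ℝ)).indicator φ ‖x‖ := by
    ext x
    by_cases hx : x ∈ disc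
    · have : ‖x‖ < 1 := by simpa [disc] using hx
      rw [Set.indicator_of_mem hx, Set.indicator_of_mem (Set.mem_Iio.2 this)]
    · have : ¬ ‖x‖ < 1 := by simpa [disc] using hx
      rw [Set.indicator_of_notMem hx, Set.indicator_of_notMem (by simpa using this)]
  rw [e, integral_fun_norm_addHaar]
  simp only [finrank_euclideanSpace, Fintype.card_fin, smul_eq_mul, nsmul_eq_mul]
  rw [intervalIntegral.integral_of_le zero_le_one, integral_Ioc_eq_integral_Ioo]
  have e2 : ∀ y : ℝ, y ^ (2 - 1) * (Set.Iio (1 : ℝ)).indicator φ y =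
      (Set.Iio (1 : ℝ)).indicator (fun y => φ y * y) y := by
    intro y
    by_cases hy : y ∈ Set.Iio (1 : ℝ)
    · rw [Set.indicator_of_mem hy, Set.indicator_of_mem hy]; ring
    · rw [Set.indicator_of_notMem hy, Set.indicator_of_notMem hy, mul_zero]
  simp only [e2]
  rw [integral_indicator measurableSet_Iio, Measure.restrict_restrict measurableSet_Iio,
    Set.inter_comm, Set.Ioi_inter_Iio, discConst]
  push_cast
  ring

/-- The class in `L²(𝔻)` of `φ(|x|)`. -/
def radial (φ : ℝ → ℝ) : L2Disc := toL2 fun x => (φ ‖x‖ : ℂ)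

theorem norm_mem_Ico_of_mem_disc {x : Plane} (hx : x ∈ disc) : ‖x‖ ∈ Set.Ico (0 : ℝ) 1 :=
  ⟨norm_nonneg x, by simpa [disc] using hx⟩

theorem memLp_radial {φ : ℝ → ℝ} (hφ : ContinuousOn φ (Set.Icc 0 1)) (c : ℂ) :
    MemLp (fun x : Plane => c * (φ ‖x‖ : ℂ)) 2 (volume.restrict disc) := by
  obtain ⟨C, hC⟩ := isCompact_Icc.exists_bound_of_continuousOn hφ
  have hdisc : MeasurableSet disc := Metric.isOpen_ball.measurableSet
  refine MemLp.of_bound ?_ (‖c‖ * C) ?_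
  · refine ContinuousOn.aestronglyMeasurable ?_ hdisc
    refine continuousOn_const.mul (Complex.continuous_ofReal.comp_continuousOn
      (hφ.comp continuous_norm.continuousOn fun x hx => ?_))
    exact Set.Ico_subset_Icc_self (norm_mem_Ico_of_mem_disc hx)
  · filter_upwards [ae_restrict_mem hdisc] with x hx
    rw [norm_mul, Complex.norm_real]
    exact mul_le_mul_of_nonneg_left
      (hC _ (Set.Ico_subset_Icc_self (norm_mem_Ico_of_mem_disc hx))) (norm_nonneg c)

theorem ae_disc_ne_zero : ∀ᵐ x : Plane ∂(volume.restrict disc), x ∈ disc ∧ x ≠ 0 := by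
  have hdisc : MeasurableSet disc := Metric.isOpen_ball.measurableSet
  have h0 : ∀ᵐ x : Plane ∂(volume.restrict disc), x ≠ 0 :=
    ae_restrict_of_ae (by simp [ae_iff])
  filter_upwards [ae_restrict_mem hdisc, h0] with x h1 h2 using ⟨h1, h2⟩

/-- The origin is a null set, so formulas for radial derivatives and Laplacians are needed only away
from it. -/
theorem toL2_congr {f g : Plane → ℂ} (h : ∀ x ∈ disc, x ≠ 0 → f x = g x) : toL2 f = toL2 g := by
  have hae : f =ᵐ[volume.restrict disc] g := by
    filter_upwards [ae_disc_ne_zero] with x hx using h x hx.1 hx.2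
  unfold toL2
  by_cases hf : MemLp f 2 (volume.restrict disc)
  · have hg := (memLp_congr_ae hae).1 hf
    rw [dif_pos hf, dif_pos hg]
    exact (MemLp.toLp_eq_toLp_iff hf hg).2 hae
  · have hg := fun h' => hf ((memLp_congr_ae hae).2 h')
    rw [dif_neg hf, dif_neg hg]

theorem toL2_mul_radial {φ : ℝ → ℝ} (hφ : ContinuousOn φ (Set.Icc 0 1)) (c : ℂ) :
    toL2 (fun x => c * (φ ‖x‖ : ℂ)) = c • radial φ := by
  have h1 := memLp_radial hφ c
  have h2 : MemLp (fun x : Plane => (φ ‖x‖ : ℂ)) 2 (volume.restrict disc) := by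
    simpa using memLp_radial hφ 1
  rw [radial, toL2, dif_pos h1, toL2, dif_pos h2, ← MemLp.toLp_const_smul]
  rfl

theorem toL2_eq_smul_radial {g : Plane → ℂ} {φ : ℝ → ℝ} (hφ : ContinuousOn φ (Set.Icc 0 1)) (c : ℂ)
    (h : ∀ x ∈ disc, x ≠ 0 → g x = c * (φ ‖x‖ : ℂ)) : toL2 g = c • radial φ :=
  (toL2_congr h).trans (toL2_mul_radial hφ c)

theorem coeFn_radial {φ : ℝ → ℝ} (hφ : ContinuousOn φ (Set.Icc 0 1)) :
    radial φ =ᵐ[volume.restrict disc] fun x => (φ ‖x‖ : ℂ) := by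
  have h2 : MemLp (fun x : Plane => (φ ‖x‖ : ℂ)) 2 (volume.restrict disc) := by
    simpa using memLp_radial hφ 1
  rw [radial, toL2, dif_pos h2]
  exact h2.coeFn_toLp

theorem smul_radial_mem_L2rad {φ : ℝ → ℝ} (hφ : ContinuousOn φ (Set.Icc 0 1)) (c : ℂ) :
    c • radial φ ∈ L2rad := by
  refine ⟨fun r => c * φ r, ?_⟩
  filter_upwards [coeFn_radial hφ, Lp.coeFn_smul c (radial φ)] with x h1 h2
  rw [h2, Pi.smul_apply, h1, smul_eq_mul]

theorem radial_mem_L2rad {φ : ℝ → ℝ} (hφ : ContinuousOn φ (Set.Icc 0 1)) : radial φ ∈ L2rad := by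
  simpa using smul_radial_mem_L2rad hφ 1

theorem radial_add {φ ψ : ℝ → ℝ} (hφ : ContinuousOn φ (Set.Icc 0 1))
    (hψ : ContinuousOn ψ (Set.Icc 0 1)) : radial (fun r => φ r + ψ r) = radial φ + radial ψ := by
  refine Lp.ext ?_
  have hs : ContinuousOn (fun r => φ r + ψ r) (Set.Icc 0 1) := hφ.add hψ
  filter_upwards [coeFn_radial hφ, coeFn_radial hψ, coeFn_radial hs,
    Lp.coeFn_add (radial φ) (radial ψ)] with x h1 h2 h3 h4
  rw [h4, Pi.add_apply, h1, h2, h3]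
  push_cast; rfl

theorem radial_smul {φ : ℝ → ℝ} (hφ : ContinuousOn φ (Set.Icc 0 1)) (c : ℝ) :
    radial (fun r => c * φ r) = c • radial φ := by
  refine Lp.ext ?_
  have hc : ContinuousOn (fun r => c * φ r) (Set.Icc 0 1) := continuousOn_const.mul hφ
  filter_upwards [coeFn_radial hφ, coeFn_radial hc, Lp.coeFn_smul c (radial φ)] with x h1 h3 h4
  rw [h4, Pi.smul_apply, h1, h3]
  simp

theorem radial_sub {φ ψ : ℝ → ℝ} (hφ : ContinuousOn φ (Set.Icc 0 1))
    (hψ : ContinuousOn ψ (Set.Icc 0 1)) : radial (fun r => φ r - ψ r) = radial φ - radial ψ := by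
  have hn : ContinuousOn (fun r => -1 * ψ r) (Set.Icc 0 1) := continuousOn_const.mul hψ
  rw [sub_eq_add_neg, ← neg_one_smul ℝ (radial ψ), ← radial_smul hψ, ← radial_add hφ hn]
  congr 1
  ext r; ring

theorem inner_radial {φ ψ : ℝ → ℝ} (hφ : ContinuousOn φ (Set.Icc 0 1))
    (hψ : ContinuousOn ψ (Set.Icc 0 1)) :
    inner ℝ (radial φ) (radial ψ) = discConst * ∫ r in (0 : ℝ)..1, φ r * ψ r * r := by
  rw [← integral_disc_radial fun r => φ r * ψ r, L2.inner_def]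
  refine integral_congr_ae ?_
  filter_upwards [coeFn_radial hφ, coeFn_radial hψ] with x h1 h2
  rw [h1, h2, Complex.inner]
  simp [mul_comm]

/-- Real and imaginary functions are orthogonal for the real inner product. This is what decouples
the phase direction from the scaling direction. -/
theorem inner_radial_I_smul {φ ψ : ℝ → ℝ} (hφ : ContinuousOn φ (Set.Icc 0 1))
    (hψ : ContinuousOn ψ (Set.Icc 0 1)) :
    inner ℝ (radial φ) (Complex.I • radial ψ) = 0 := by
  rw [L2.inner_def, ← integral_zero Plane ℝ]
  refine integral_congr_ae ?_
  filter_upwards [coeFn_radial hφ, coeFn_radial hψ, Lp.coeFn_smul Complex.I (radial ψ)]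
    with x h1 h2 h3
  rw [h1, h3, Pi.smul_apply, h2, Complex.inner]
  simp

/-- Multiplication by a complex number is adjoint to multiplication by its conjugate. -/
theorem inner_smul_complex (c : ℂ) (u v : L2Disc) :
    inner ℝ (c • u) v = inner ℝ u ((starRingEnd ℂ) c • v) := by
  rw [L2.inner_def, L2.inner_def]
  refine integral_congr_ae ?_
  filter_upwards [Lp.coeFn_smul c u, Lp.coeFn_smul ((starRingEnd ℂ) c) v] with x h1 h2
  rw [h1, h2, Pi.smul_apply, Pi.smul_apply, Complex.inner, Complex.inner, smul_eq_mul, smul_eq_mul,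
    map_mul]
  ring_nf

theorem norm_radial_sq {φ : ℝ → ℝ} (hφ : ContinuousOn φ (Set.Icc 0 1)) :
    ‖radial φ‖ ^ 2 = discConst * ∫ r in (0 : ℝ)..1, φ r ^ 2 * r := by
  rw [← real_inner_self_eq_norm_sq, inner_radial hφ hφ]
  congr 1
  refine intervalIntegral.integral_congr fun r _ => ?_
  ring

theorem norm_radial_sq_le {φ ψ : ℝ → ℝ} (hφ : ContinuousOn φ (Set.Icc 0 1))
    (hψ : ContinuousOn ψ (Set.Icc 0 1)) (h : ∀ r, 0 < r → r < 1 → φ r ^ 2 ≤ ψ r) :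
    ‖radial φ‖ ^ 2 ≤ discConst * ∫ r in (0 : ℝ)..1, ψ r * r := by
  rw [norm_radial_sq hφ]
  refine mul_le_mul_of_nonneg_left ?_ discConst_pos.le
  refine intervalIntegral.integral_mono_on_of_le_Ioo zero_le_one ?_ ?_ fun r hr =>
    mul_le_mul_of_nonneg_right (h r hr.1 hr.2) hr.1.le
  · exact ((hφ.pow 2).mul continuousOn_id).intervalIntegrable_of_Icc zero_le_one
  · exact (hψ.mul continuousOn_id).intervalIntegrable_of_Icc zero_le_one

theorem norm_radial_le {φ : ℝ → ℝ} (hφ : ContinuousOn φ (Set.Icc 0 1)) {C : ℝ}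
    (h : ∀ r, 0 < r → r < 1 → |φ r| ≤ C) : ‖radial φ‖ ≤ Real.sqrt discConst * C := by
  have hC : 0 ≤ C := (abs_nonneg _).trans (h (1 / 2) (by norm_num) (by norm_num))
  have h1 := norm_radial_sq_le hφ (ψ := fun _ => C ^ 2) continuousOn_const fun r h0 h1 =>
    sq_le_sq' (abs_le.1 (h r h0 h1)).1 (abs_le.1 (h r h0 h1)).2
  have h2 : ∫ r in (0 : ℝ)..1, C ^ 2 * r = C ^ 2 / 2 := by
    rw [intervalIntegral.integral_const_mul, integral_id]; ring
  rw [h2] at h1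
  refine abs_le_of_sq_le_sq' ?_ (by positivity) |>.2
  rw [mul_pow, Real.sq_sqrt discConst_pos.le]
  have := mul_nonneg discConst_pos.le (sq_nonneg C)
  linarith

/-- The pointwise Taylor remainder is at most `C |s - δ|²` uniformly in `r`, and the disc has finite
measure, so the expansion holds in `L²`. -/
theorem hasDerivAt_radial {φ φ₁ φ₂ : ℝ → ℝ → ℝ} {δ ε C : ℝ} (hε : 0 < ε)
    (hφ : ∀ s ∈ Metric.ball δ ε, ContinuousOn (φ s) (Set.Icc 0 1))
    (hφ₁ : ContinuousOn (φ₁ δ) (Set.Icc 0 1))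
    (hd : ∀ s ∈ Metric.ball δ ε, ∀ r, 0 < r → r < 1 → HasDerivAt (fun s => φ s r) (φ₁ s r) s)
    (hd₁ : ∀ s ∈ Metric.ball δ ε, ∀ r, 0 < r → r < 1 → HasDerivAt (fun s => φ₁ s r) (φ₂ s r) s)
    (hC : ∀ s ∈ Metric.ball δ ε, ∀ r, 0 < r → r < 1 → |φ₂ s r| ≤ C) :
    HasDerivAt (fun s => radial (φ s)) (radial (φ₁ δ)) δ := by
  have hδ : δ ∈ Metric.ball δ ε := Metric.mem_ball_self hε
  have hball : ∀ s ∈ Metric.ball δ ε, Set.uIcc δ s ⊆ Metric.ball δ ε := fun s hs =>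
    (convex_ball δ ε).ordConnected.uIcc_subset hδ hs
  have hC0 : 0 ≤ C := (abs_nonneg _).trans (hC δ hδ (1 / 2) (by norm_num) (by norm_num))
  have hpt : ∀ s ∈ Metric.ball δ ε, ∀ r, 0 < r → r < 1 →
      |φ s r - φ δ r - (s - δ) * φ₁ δ r| ≤ C * |s - δ| ^ 2 := by
    intro s hs r h0 h1
    have hlip : ∀ x ∈ Set.uIcc δ s, |φ₁ x r - φ₁ δ r| ≤ C * |s - δ| := by
      intro x hx
      have hmv := (convex_uIcc δ s).norm_image_sub_le_of_norm_hasDerivWithin_le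
        (f := fun y => φ₁ y r) (f' := fun y => φ₂ y r) (C := C)
        (fun y hy => (hd₁ y (hball s hs hy) r h0 h1).hasDerivWithinAt)
        (fun y hy => hC y (hball s hs hy) r h0 h1) Set.left_mem_uIcc hx
      rw [Real.norm_eq_abs, Real.norm_eq_abs] at hmv
      exact hmv.trans (mul_le_mul_of_nonneg_left (Set.abs_sub_left_of_mem_uIcc hx) hC0)
    have hmv := (convex_uIcc δ s).norm_image_sub_le_of_norm_hasDerivWithin_le
      (f := fun y => φ y r - y * φ₁ δ r) (f' := fun y => φ₁ y r - 1 * φ₁ δ r) (C := C * |s - δ|)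
      (fun y hy => ((hd y (hball s hs hy) r h0 h1).sub
        ((hasDerivAt_id y).mul_const _)).hasDerivWithinAt)
      (fun y hy => by rw [one_mul]; exact hlip y hy) Set.left_mem_uIcc Set.right_mem_uIcc
    rw [Real.norm_eq_abs, Real.norm_eq_abs] at hmv
    calc |φ s r - φ δ r - (s - δ) * φ₁ δ r| = |φ s r - s * φ₁ δ r - (φ δ r - δ * φ₁ δ r)| := by
          congr 1; ring
      _ ≤ C * |s - δ| * |s - δ| := hmv
      _ = _ := by ring
  rw [hasDerivAt_iff_isLittleO]
  refine Asymptotics.IsBigO.trans_isLittleO (g := fun s => |s - δ| ^ 2) ?_ ?_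
  · refine Asymptotics.IsBigO.of_bound (Real.sqrt discConst * C) ?_
    filter_upwards [Metric.ball_mem_nhds δ hε] with s hs
    have e : radial (φ s) - radial (φ δ) - (s - δ) • radial (φ₁ δ) =
        radial fun r => φ s r - φ δ r - (s - δ) * φ₁ δ r := by
      rw [radial_sub (φ := fun r => φ s r - φ δ r) ((hφ s hs).sub (hφ δ hδ))
        (ψ := fun r => (s - δ) * φ₁ δ r) (continuousOn_const.mul hφ₁), radial_sub (hφ s hs) (hφ δ hδ), radial_smul hφ₁]
    rw [e]
    refine (norm_radial_le (((hφ s hs).sub (hφ δ hδ)).sub (continuousOn_const.mul hφ₁))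
      (hpt s hs)).trans (le_of_eq ?_)
    rw [Real.norm_eq_abs, abs_of_nonneg (sq_nonneg |s - δ|)]; ring
  · have : (fun s => |s - δ| ^ 2) = fun s => (s - δ) * (s - δ) := by
      ext s; rw [sq_abs]; ring
    rw [this]
    have h1 : (fun s : ℝ => s - δ) =o[𝓝 δ] fun _ => (1 : ℝ) := by
      rw [Asymptotics.isLittleO_one_iff]
      have : Tendsto (fun s : ℝ => s - δ) (𝓝 δ) (𝓝 (δ - δ)) :=
        (continuous_id.sub continuous_const).continuousAt
      simpa using this
    simpa using h1.mul_isBigO (Asymptotics.isBigO_refl (fun s : ℝ => s - δ) (𝓝 δ))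

/-! ### Rescaled profiles -/

/-- The radial profile of `h_δ - b h_δ(1)`. -/
def shifted (h : ℝ → ℝ) (b δ r : ℝ) : ℝ := rescaled h δ r - b * rescaled h δ 1

/-- `h_δ - b h_δ(1)` as an element of `L²(𝔻)`. -/
def scaledL2 (h : ℝ → ℝ) (b δ : ℝ) : L2Disc := radial (shifted h b δ)

theorem continuousOn_rescaled {h : ℝ → ℝ} (hh : ContinuousOn h (Set.Ici 0)) {δ : ℝ} (hδ : 0 < δ) :
    ContinuousOn (rescaled h δ) (Set.Icc 0 1) := by
  unfold rescaled
  refine continuousOn_const.mul (hh.comp (continuousOn_const.mul continuousOn_id) fun r hr => ?_)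
  exact mul_nonneg (inv_pos.2 hδ).le hr.1

theorem continuousOn_shifted {h : ℝ → ℝ} (hh : ContinuousOn h (Set.Ici 0)) (b : ℝ) {δ : ℝ}
    (hδ : 0 < δ) : ContinuousOn (shifted h b δ) (Set.Icc 0 1) :=
  (continuousOn_rescaled hh hδ).sub continuousOn_const

/-- Differentiating in the scale replaces `h` by `h + r h'` and produces a factor `-s⁻¹`; the result
is again a rescaled profile, so the process can be repeated. -/
theorem hasDerivAt_rescaled {h h' : ℝ → ℝ} (hd : ∀ r, 0 < r → HasDerivAt h (h' r / r) r) {s r : ℝ}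
    (hs : 0 < s) (hr : 0 < r) :
    HasDerivAt (fun s => rescaled h s r) (-s⁻¹ * rescaled (fun r => h r + h' r) s r) s := by
  have hpos : 0 < s⁻¹ * r := by positivity
  have h1 : HasDerivAt (fun s : ℝ => s⁻¹ * r) (-(s ^ 2)⁻¹ * r) s :=
    (hasDerivAt_inv hs.ne').mul_const r
  refine ((hasDerivAt_inv hs.ne').mul ((hd _ hpos).comp s h1)).congr_deriv ?_
  simp only [rescaled, Function.comp]
  field_simp
  ring

theorem hasDerivAt_shifted {h h' : ℝ → ℝ} (hd : ∀ r, 0 < r → HasDerivAt h (h' r / r) r) (b : ℝ)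
    {s r : ℝ} (hs : 0 < s) (hr : 0 < r) :
    HasDerivAt (fun s => shifted h b s r) (-s⁻¹ * shifted (fun r => h r + h' r) b s r) s := by
  refine ((hasDerivAt_rescaled hd hs hr).sub
    ((hasDerivAt_rescaled hd hs one_pos).const_mul b)).congr_deriv ?_
  simp only [shifted]; ring

namespace Profile

variable {q p h h' : ℝ → ℝ}

theorem exists_bound (hs : IsRadialSolution q p) (hh : Profile q p h) :
    ∃ A : ℝ, 0 ≤ A ∧ ∀ r, 0 ≤ r → |h r| ≤ A := by
  obtain ⟨A, c, hc, hA⟩ := hh.decay hs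
  have hA0 : 0 ≤ A := by simpa using (abs_nonneg _).trans (hA 0 le_rfl)
  refine ⟨A, hA0, fun r hr => (hA r hr).trans ?_⟩
  have : Real.exp (-c * r) ≤ 1 := Real.exp_le_one_iff.2 (by nlinarith)
  nlinarith

theorem hasDerivAt_scaledL2 (hs : IsRadialSolution q p) (hh : Profile q p h) (hh' : Profile q p h')
    (hd : ∀ r, 0 < r → HasDerivAt h (h' r / r) r) (b : ℝ) {δ : ℝ} (hδ : 0 < δ) :
    HasDerivAt (scaledL2 h b) (-δ⁻¹ • scaledL2 (fun r => h r + h' r) b δ) δ := by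
  have hΛ : Profile q p (fun r => h r + h' r) := hh.add hh'
  obtain ⟨k, hk, hkd⟩ := hΛ.exists_hasDerivAt hs
  have hΛk := hΛ.add hk
  obtain ⟨A, hA0, hA⟩ := hΛ.exists_bound hs
  obtain ⟨B, hB0, hB⟩ := hΛk.exists_bound hs
  have hcΛ := continuousOn_shifted (hΛ.continuousOn hs) b hδ
  have hpos : ∀ s ∈ Metric.ball δ (δ / 2), δ / 2 < s := fun s hs' => by
    rw [Metric.mem_ball, Real.dist_eq] at hs'
    linarith [(abs_lt.1 hs').1]
  have hsh : ∀ {f : ℝ → ℝ} {D : ℝ}, 0 ≤ D → (∀ r, 0 ≤ r → |f r| ≤ D) → ∀ s, δ / 2 < s → ∀ r, 0 < r →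
      |shifted f b s r| ≤ 2 / δ * D * (1 + |b|) := by
    intro f D hD0 hD s hs' r hr
    have hs0 : 0 < s := by linarith
    have hinv : s⁻¹ ≤ 2 / δ := by
      rw [inv_eq_one_div, div_le_div_iff₀ hs0 hδ]; linarith
    have hres : ∀ r, 0 < r → |rescaled f s r| ≤ 2 / δ * D := fun r hr => by
      rw [rescaled, abs_mul, abs_of_pos (inv_pos.2 hs0)]
      exact mul_le_mul hinv (hD _ (by positivity)) (abs_nonneg _) (by positivity)
    rw [shifted]
    refine (abs_sub _ _).trans ?_
    rw [abs_mul]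
    have h1 := hres r hr
    have h2 := mul_le_mul_of_nonneg_left (hres 1 one_pos) (abs_nonneg b)
    linarith
  have key := hasDerivAt_radial (φ := shifted h b)
    (φ₁ := fun s r => -s⁻¹ * shifted (fun r => h r + h' r) b s r)
    (φ₂ := fun s r => (s ^ 2)⁻¹ * (shifted (fun r => h r + h' r) b s r +
      shifted (fun r => (h r + h' r) + k r) b s r)) (δ := δ) (ε := δ / 2)
    (C := (2 / δ) ^ 2 * (2 / δ * A * (1 + |b|) + 2 / δ * B * (1 + |b|))) (by positivity)
    (fun s hs' => continuousOn_shifted (hh.continuousOn hs) b (by linarith [hpos s hs']))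
    (continuousOn_const.mul hcΛ)
    (fun s hs' r h0 _ => hasDerivAt_shifted hd b (by linarith [hpos s hs']) h0)
    (fun s hs' r h0 _ => by
      have hs0 : 0 < s := by linarith [hpos s hs']
      refine (((hasDerivAt_inv hs0.ne').neg).mul
        (hasDerivAt_shifted hkd b hs0 h0)).congr_deriv ?_
      simp only [Pi.neg_apply]
      field_simp)
    (fun s hs' r h0 _ => by
      have hs1 := hpos s hs'
      have hs0 : 0 < s := by linarith
      have hinv : s⁻¹ ≤ 2 / δ := by
        rw [inv_eq_one_div, div_le_div_iff₀ hs0 hδ]; linarith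
      rw [abs_mul, ← inv_pow, abs_of_nonneg (by positivity)]
      exact mul_le_mul (pow_le_pow_left₀ (by positivity) hinv 2)
        ((abs_add_le _ _).trans (add_le_add (hsh hA0 hA s hs1 r h0) (hsh hB0 hB s hs1 r h0)))
        (abs_nonneg _) (by positivity))
  refine key.congr_deriv ?_
  rw [scaledL2, ← radial_smul hcΛ]

/-- Induction on the order, over all profiles at once, since each derivative is `-δ⁻¹` times the
curve of another profile. -/
theorem contDiffOn_scaledL2 (hs : IsRadialSolution q p) (hh : Profile q p h) (b : ℝ) :
    ContDiffOn ℝ ∞ (scaledL2 h b) (Set.Ioi 0) := by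
  rw [contDiffOn_infty]
  intro n
  induction n generalizing h with
  | zero =>
    obtain ⟨h', hh', hd⟩ := hh.exists_hasDerivAt hs
    exact contDiffOn_zero.2 fun δ hδ =>
      (hh.hasDerivAt_scaledL2 hs hh' hd b hδ).continuousAt.continuousWithinAt
  | succ n ih =>
    obtain ⟨h', hh', hd⟩ := hh.exists_hasDerivAt hs
    push_cast
    rw [contDiffOn_succ_iff_deriv_of_isOpen isOpen_Ioi]
    refine ⟨fun δ hδ => (hh.hasDerivAt_scaledL2 hs hh' hd b
      hδ).differentiableAt.differentiableWithinAt, by simp, ?_⟩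
    refine ContDiffOn.congr (f := fun δ => -δ⁻¹ • scaledL2 (fun r => h r + h' r) b δ) ?_
      fun δ hδ => (hh.hasDerivAt_scaledL2 hs hh' hd b hδ).deriv
    exact ((contDiffOn_id.inv fun δ hδ => ne_of_gt hδ).neg).smul (ih (hh.add hh'))

/-- Bounds for `h_δ(1)`, of arbitrary polynomial order as `δ → 0`. -/
theorem exists_rescaled_one_le (hs : IsRadialSolution q p) (hh : Profile q p h) (n : ℕ) :
    ∃ A : ℝ, 0 ≤ A ∧ ∀ δ, 0 < δ → |rescaled h δ 1| ≤ A * δ ^ n := by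
  have hp : ∀ m : ℕ, Profile q p fun r => r ^ m * h r := by
    intro m
    induction m with
    | zero => simpa using hh
    | succ m ih =>
      have := ih.radius
      convert this using 2
      ring
  obtain ⟨A, hA0, hA⟩ := (hp (n + 1)).exists_bound hs
  refine ⟨A, hA0, fun δ hδ => ?_⟩
  have h1 := hA δ⁻¹ (by positivity)
  rw [abs_mul, abs_of_pos (by positivity : 0 < δ⁻¹ ^ (n + 1))] at h1
  rw [rescaled, mul_one, abs_mul, abs_of_pos (inv_pos.2 hδ)]
  calc δ⁻¹ * |h δ⁻¹| = δ ^ n * (δ⁻¹ ^ (n + 1) * |h δ⁻¹|) := by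
        rw [inv_pow, pow_succ]; field_simp
    _ ≤ δ ^ n * A := by gcongr
    _ = _ := mul_comm _ _

/-- The rescaling is `L²`-critical in two dimensions: exponential decay of `h` and the explicit
integral of `r e^{-a r}` with `a = 2c / δ` give a bound in which all powers of `δ` cancel. The
boundary constant is bounded separately. -/
theorem exists_norm_scaledL2_le (hs : IsRadialSolution q p) (hh : Profile q p h) :
    ∃ M : ℝ, 0 ≤ M ∧ ∀ b δ, |b| ≤ 1 → 0 < δ → δ ≤ 1 → ‖scaledL2 h b δ‖ ≤ M := by
  obtain ⟨A, c, hc, hA⟩ := hh.decay hs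
  obtain ⟨B, hB0, hB⟩ := hh.exists_rescaled_one_le hs 0
  have hω := discConst_pos
  refine ⟨Real.sqrt (discConst * (A ^ 2 / (2 * c) ^ 2)) + Real.sqrt discConst * B, by positivity,
    fun b δ hb hδ hδ1 => ?_⟩
  have hcont := continuousOn_rescaled (hh.continuousOn hs) hδ
  have e : scaledL2 h b δ = radial (rescaled h δ) - radial fun _ => b * rescaled h δ 1 :=
    radial_sub hcont continuousOn_const
  rw [e]
  refine (norm_sub_le _ _).trans (add_le_add ?_ (norm_radial_le continuousOn_const fun r _ _ => ?_))
  · refine Real.le_sqrt_of_sq_le ((norm_radial_sq_le hcont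
      (ψ := fun r => (δ⁻¹) ^ 2 * A ^ 2 * Real.exp (-(2 * c / δ) * r)) (by fun_prop) ?_).trans ?_)
    · intro r h0 _
      rw [rescaled, mul_pow, mul_assoc]
      refine mul_le_mul_of_nonneg_left ?_ (by positivity)
      have h1 := hA (δ⁻¹ * r) (by positivity)
      calc h (δ⁻¹ * r) ^ 2 ≤ (A * Real.exp (-c * (δ⁻¹ * r))) ^ 2 :=
            sq_le_sq' (abs_le.1 h1).1 (abs_le.1 h1).2
        _ = A ^ 2 * Real.exp (-(2 * c / δ) * r) := by
            rw [mul_pow, ← Real.exp_nat_mul]; congr 2; push_cast; field_simp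
    · refine mul_le_mul_of_nonneg_left ?_ hω.le
      set a := 2 * c / δ with ha
      have ha0 : 0 < a := by positivity
      have hF : ∀ r ∈ Set.uIcc (0 : ℝ) 1, HasDerivAt
          (fun r => -(r / a + 1 / a ^ 2) * Real.exp (-a * r)) (Real.exp (-a * r) * r) r := by
        intro r _
        have h1 := (((hasDerivAt_id r).div_const a).add_const (1 / a ^ 2)).neg
        have h2 := ((hasDerivAt_id r).const_mul (-a)).exp
        refine (h1.mul h2).congr_deriv ?_
        simp only [id, Pi.neg_apply]
        field_simp
        ring
      have hint : ∫ r in (0 : ℝ)..1, Real.exp (-a * r) * r ≤ 1 / a ^ 2 := by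
        rw [intervalIntegral.integral_eq_sub_of_hasDerivAt hF
          (Continuous.intervalIntegrable (by fun_prop) _ _)]
        have : 0 ≤ (1 / a + 1 / a ^ 2) * Real.exp (-a * 1) := by positivity
        simp only [mul_zero, Real.exp_zero, zero_div]
        linarith
      have e2 : ∀ r, (δ⁻¹) ^ 2 * A ^ 2 * Real.exp (-a * r) * r =
          (δ⁻¹) ^ 2 * A ^ 2 * (Real.exp (-a * r) * r) := fun r => by ring
      simp only [e2]
      rw [intervalIntegral.integral_const_mul]
      refine (mul_le_mul_of_nonneg_left hint (by positivity)).trans (le_of_eq ?_)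
      rw [ha]; field_simp
  · rw [abs_mul]
    have := hB δ hδ
    rw [pow_zero, mul_one] at this
    nlinarith [abs_nonneg b, abs_nonneg (rescaled h δ 1)]

end Profile

/-! ### Solitons, tangent vectors and the spectral cutoff -/

/-! ### Solitons and tangent vectors as rescaled profiles -/

theorem norm_phase (θ : ℝ) : ‖phase θ‖ = 1 := Complex.norm_exp_ofReal_mul_I θ

/-- The subtracted constant is invisible to the Laplacian and each scaling costs `δ⁻²`; hence the
right-hand side carries the shift `0`. -/
theorem laplacian_shifted {q p ψ ψ₁ γ : ℝ → ℝ} (ht : IsLaplaceTriple q p ψ ψ₁ γ) (b : ℝ) {δ : ℝ}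
    (hδ : 0 < δ) (c : ℂ) {x : Plane} (hx : x ≠ 0) :
    (Δ (fun y : Plane => c * (shifted ψ b δ ‖y‖ : ℂ))) x =
      c * (((δ ^ 2)⁻¹ * shifted γ 0 δ ‖x‖ : ℝ) : ℂ) := by
  have hlin : ∀ r, 0 < r → HasDerivAt (fun r : ℝ => δ⁻¹ * r) δ⁻¹ r := fun r _ => by
    simpa using (hasDerivAt_id r).const_mul δ⁻¹
  refine laplacian_radial (h := fun r => c * (shifted ψ b δ r : ℂ))
    (h₁ := fun r => c * (rescaled ψ₁ δ r : ℂ))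
    (k := fun r => c * (((δ ^ 2)⁻¹ * shifted γ 0 δ r : ℝ) : ℂ)) (fun r hr => ?_) (fun r hr => ?_) hx
  · have h1 := (((ht.hasDerivAt _ (by positivity : 0 < δ⁻¹ * r)).comp r (hlin r hr)).const_mul
      δ⁻¹).sub_const (b * rescaled ψ δ 1)
    refine (h1.ofReal_comp.const_mul c).congr_deriv ?_
    simp only [rescaled, Complex.real_smul]
    push_cast
    field_simp
  · have h1 := ((ht.hasDerivAt₁ _ (by positivity : 0 < δ⁻¹ * r)).comp r (hlin r hr)).const_mul δ⁻¹
    refine (h1.ofReal_comp.const_mul c).congr_deriv ?_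
    simp only [rescaled, shifted, Complex.real_smul]
    push_cast
    field_simp
    ring

theorem soliton_eq {q p : ℝ → ℝ} (hs : IsRadialSolution q p) (θ : ℝ) {δ : ℝ} (hδ : 0 < δ) :
    soliton q θ δ = phase θ • scaledL2 q 1 δ :=
  toL2_eq_smul_radial (continuousOn_shifted hs.continuousOn 1 hδ) _ fun x _ _ => by
    simp [bold, shifted]

theorem fullSoliton_eq {q p : ℝ → ℝ} (hs : IsRadialSolution q p) (θ : ℝ) {δ : ℝ} (hδ : 0 < δ) :
    fullSoliton q θ δ = phase θ • scaledL2 q 0 δ :=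
  toL2_eq_smul_radial (continuousOn_shifted hs.continuousOn 0 hδ) _ fun x _ _ => by
    simp [shifted]

theorem toL2_tangentPhase {q p : ℝ → ℝ} (hs : IsRadialSolution q p) (θ : ℝ) {δ : ℝ} (hδ : 0 < δ) :
    toL2 (tangentPhase q θ δ) = (Complex.I * phase θ) • scaledL2 q 1 δ :=
  toL2_eq_smul_radial (continuousOn_shifted hs.continuousOn 1 hδ) _ fun x _ _ => by
    simp [tangentPhase, bold, shifted]

theorem boldDeriv_eq {q p : ℝ → ℝ} (hs : IsRadialSolution q p) {δ r : ℝ} (hδ : 0 < δ)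
    (hr : 0 < r) : boldDeriv q δ r = -δ⁻¹ * shifted (fun r => q r + p r) 1 δ r := by
  have h := (hasDerivAt_shifted hs.hasDerivAt 1 hδ hr).deriv
  rw [← h, boldDeriv]
  congr 1
  ext s
  simp [bold, shifted]

theorem toL2_tangentScale {q p : ℝ → ℝ} (hs : IsRadialSolution q p) (θ : ℝ) {δ : ℝ} (hδ : 0 < δ) :
    toL2 (tangentScale q θ δ) = (-δ⁻¹) • phase θ • scaledL2 (fun r => q r + p r) 1 δ := by
  have hc := continuousOn_shifted (h := fun r => q r + p r)
    (hs.continuousOn.add hs.continuousOn') 1 hδ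
  rw [smul_comm, scaledL2, ← radial_smul hc]
  exact toL2_eq_smul_radial (φ := fun r => -δ⁻¹ * shifted (fun r => q r + p r) 1 δ r)
    (continuousOn_const.mul hc) _ fun x _ hx => by
    rw [tangentScale, boldDeriv_eq hs hδ (norm_pos_iff.2 hx)]

theorem negLaplacian_tangentPhase {q p : ℝ → ℝ} (hs : IsRadialSolution q p) (θ : ℝ) {δ : ℝ}
    (hδ : 0 < δ) : negLaplacian (tangentPhase q θ δ) =
      (-(δ ^ 2)⁻¹) • (Complex.I * phase θ) • scaledL2 (fun r => q r - q r ^ 3) 0 δ := by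
  have hc := continuousOn_shifted ((isLaplaceTriple_base hs).profileΔ.continuousOn hs) 0 hδ
  rw [smul_comm, scaledL2, ← radial_smul hc]
  refine toL2_eq_smul_radial
    (φ := fun r => -(δ ^ 2)⁻¹ * shifted (fun r => q r - q r ^ 3) 0 δ r)
    (continuousOn_const.mul hc) _ fun x _ hx => ?_
  have e : tangentPhase q θ δ = fun y => (Complex.I * phase θ) * (shifted q 1 δ ‖y‖ : ℂ) := by
    ext y; simp [tangentPhase, bold, shifted]
  rw [e, laplacian_shifted (isLaplaceTriple_base hs) 1 hδ _ hx]
  push_cast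
  ring

theorem negLaplacian_tangentScale {q p : ℝ → ℝ} (hs : IsRadialSolution q p) (θ : ℝ) {δ : ℝ}
    (hδ : 0 < δ) : negLaplacian (tangentScale q θ δ) =
      (δ ^ 3)⁻¹ • phase θ •
        scaledL2 (fun r => 3 * (q r - q r ^ 3) + (p r - 3 * q r ^ 2 * p r)) 0 δ := by
  have hc := continuousOn_shifted ((isLaplaceTriple_scaling hs).profileΔ.continuousOn hs) 0 hδ
  rw [smul_comm, scaledL2, ← radial_smul hc]
  refine toL2_eq_smul_radial (φ := fun r => (δ ^ 3)⁻¹ *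
    shifted (fun r => 3 * (q r - q r ^ 3) + (p r - 3 * q r ^ 2 * p r)) 0 δ r)
    (continuousOn_const.mul hc) _ fun x _ hx => ?_
  -- The formula for `∂_δ 𝐐_δ` is available only off the origin, so the two functions are compared
  -- near `x`.
  have e : tangentScale q θ δ =ᶠ[𝓝 x] fun y =>
      (phase θ * (-δ⁻¹ : ℝ)) * (shifted (fun r => q r + p r) 1 δ ‖y‖ : ℂ) := by
    filter_upwards [isOpen_ne.mem_nhds hx] with y hy
    rw [tangentScale, boldDeriv_eq hs hδ (norm_pos_iff.2 hy)]
    push_cast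
    ring
  rw [(InnerProductSpace.laplacian_congr_nhds e).eq_of_nhds,
    laplacian_shifted (isLaplaceTriple_scaling hs) 1 hδ _ hx]
  have hδ' : (δ : ℂ) ≠ 0 := Complex.ofReal_ne_zero.2 hδ.ne'
  push_cast
  field_simp

/-! ### Bessel modes and the spectral cutoff -/

/-- The profile of `J₀(z |x|)`. -/
def besselProfile (z r : ℝ) : ℝ := besselJ0 (z * r)

theorem continuous_besselProfile (z : ℝ) : Continuous (besselProfile z) :=
  continuous_besselJ0.comp (continuous_const.mul continuous_id)

theorem besselMode_eq (n : ℕ) : besselMode n = radial (besselProfile (besselZero n)) := rfl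

/-- Green's identity on the disc for a radial function vanishing at the boundary. -/
theorem integral_mul_besselProfile {u u₁ k : ℝ → ℝ} (hu : ContinuousOn u (Set.Icc 0 1))
    (hu₁ : ContinuousOn u₁ (Set.Icc 0 1)) (hk : ContinuousOn k (Set.Icc 0 1))
    (hd : ∀ r, 0 < r → r < 1 → HasDerivAt u (u₁ r / r) r)
    (hd₁ : ∀ r, 0 < r → r < 1 → HasDerivAt u₁ (r * k r) r) (h0 : u₁ 0 = 0) (h1 : u 1 = 0)
    {z : ℝ} (hz : 0 < z) (hJ : besselJ0 z = 0) :
    ∫ r in (0 : ℝ)..1, k r * besselProfile z r * r =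
      -z ^ 2 * ∫ r in (0 : ℝ)..1, u r * besselProfile z r * r := by
  have hφc := continuous_besselProfile z
  have hφ₁c : Continuous fun r : ℝ => z * r * besselJ0Deriv (z * r) :=
    (continuous_const.mul continuous_id).mul
      (continuous_besselJ0Deriv.comp (continuous_const.mul continuous_id))
  have hlin : ∀ r : ℝ, HasDerivAt (fun r => z * r) z r := fun r => by
    simpa using (hasDerivAt_id r).const_mul z
  have i1 : IntervalIntegrable (fun r => k r * besselProfile z r * r) volume 0 1 :=
    ((hk.mul hφc.continuousOn).mul continuousOn_id).intervalIntegrable_of_Icc zero_le_one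
  have i2 : IntervalIntegrable (fun r => z ^ 2 * (u r * besselProfile z r * r)) volume 0 1 :=
    (continuousOn_const.mul
      ((hu.mul hφc.continuousOn).mul continuousOn_id)).intervalIntegrable_of_Icc zero_le_one
  have key := intervalIntegral.integral_eq_sub_of_hasDerivAt_of_le zero_le_one
    (f := fun r => u₁ r * besselProfile z r - u r * (z * r * besselJ0Deriv (z * r)))
    (f' := fun r => k r * besselProfile z r * r + z ^ 2 * (u r * besselProfile z r * r))
    ((hu₁.mul hφc.continuousOn).sub (hu.mul hφ₁c.continuousOn))
    (fun r hr => by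
      have hr0 : r ≠ 0 := hr.1.ne'
      have hJd := (hasDerivAt_besselJ0 (z * r)).comp r (hlin r)
      have hJd1 := (hasDerivAt_besselJ0Deriv (mul_ne_zero hz.ne' hr0)).comp r (hlin r)
      refine (((hd₁ r hr.1 hr.2).mul hJd).sub ((hd r hr.1 hr.2).mul
        ((hlin r).mul hJd1))).congr_deriv ?_
      simp only [besselProfile, Function.comp, Pi.mul_apply]
      field_simp
      ring)
    (i1.add i2)
  rw [intervalIntegral.integral_add i1 i2, intervalIntegral.integral_const_mul] at key
  simp only [h0, h1, besselProfile, mul_one, hJ, mul_zero, zero_mul, sub_zero] at key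
  simp only [besselProfile]
  linarith

/-- Green's identity gives `(z_n² - z_m²) ⟨J₀(z_n |·|), J₀(z_m |·|)⟩ = 0`, and distinct indices give
distinct zeros. -/
theorem inner_besselMode {n m : ℕ} (hn : 1 ≤ n) (hm : 1 ≤ m) (hnm : n ≠ m) :
    inner ℝ (besselMode n) (besselMode m) = 0 := by
  have hzn := besselZero_pos hn
  have hzm := besselZero_pos hm
  rw [besselMode_eq, besselMode_eq, inner_radial (continuous_besselProfile _).continuousOn
    (continuous_besselProfile _).continuousOn]
  set z := besselZero n with hz
  have hlin : ∀ r : ℝ, HasDerivAt (fun r => z * r) z r := fun r => by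
    simpa using (hasDerivAt_id r).const_mul z
  have key := integral_mul_besselProfile (u := besselProfile z)
    (u₁ := fun r => z * r * besselJ0Deriv (z * r)) (k := fun r => -z ^ 2 * besselProfile z r)
    (continuous_besselProfile _).continuousOn
    ((continuous_const.mul continuous_id).mul
      (continuous_besselJ0Deriv.comp (continuous_const.mul continuous_id))).continuousOn
    (continuous_const.mul (continuous_besselProfile _)).continuousOn
    (fun r hr _ => ((hasDerivAt_besselJ0 (z * r)).comp r (hlin r)).congr_deriv (by field_simp))
    (fun r hr _ => ((hlin r).mul ((hasDerivAt_besselJ0Deriv (by positivity)).comp r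
      (hlin r))).congr_deriv (by
        simp only [besselProfile, Function.comp]
        field_simp
        ring))
    (by simp) (by simp [besselProfile, hz, besselJ0_besselZero hn]) hzm (besselJ0_besselZero hm)
  simp only [mul_assoc] at key
  rw [intervalIntegral.integral_const_mul] at key
  simp only [mul_assoc]
  have hne : z ^ 2 ≠ besselZero m ^ 2 := fun h => hnm (strictMono_besselZero.injective
    ((pow_left_inj₀ hzn.le hzm.le two_ne_zero).1 h))
  have : (z ^ 2 - besselZero m ^ 2) *
      ∫ r in (0 : ℝ)..1, besselProfile z r * (besselProfile (besselZero m) r * r) = 0 := by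
    linarith
  rw [(mul_eq_zero.1 this).resolve_left (sub_ne_zero.2 hne), mul_zero]

theorem besselMode_ne_zero (n : ℕ) : besselMode n ≠ 0 := by
  intro h
  have hc := continuous_besselProfile (besselZero n)
  have h1 := norm_radial_sq (φ := besselProfile (besselZero n)) hc.continuousOn
  rw [← besselMode_eq, h, norm_zero, zero_pow two_ne_zero] at h1
  have h2 : ∫ r in (0 : ℝ)..1, besselProfile (besselZero n) r ^ 2 * r = 0 :=
    (mul_eq_zero.1 h1.symm).resolve_left discConst_pos.ne'
  have hz : 0 ≤ besselZero n := (Nat.cast_nonneg n).trans (le_besselZero n)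
  -- At `r = ε / 2` the argument `z_n r` is below `1`, where `|J₀ - 1| ≤ z_n r` keeps `J₀` positive.
  set ε : ℝ := 1 / (besselZero n + 1) with hε
  have hε0 : 0 < ε := by positivity
  have hε1 : ε ≤ 1 := by rw [hε, div_le_one (by positivity)]; linarith
  have hpos : 0 < ∫ r in (0 : ℝ)..1, besselProfile (besselZero n) r ^ 2 * r := by
    refine intervalIntegral.integral_pos zero_lt_one ((hc.pow 2).mul continuous_id).continuousOn
      (fun r hr => mul_nonneg (sq_nonneg _) hr.1.le) ⟨ε / 2, ⟨by positivity, by linarith⟩, ?_⟩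
    have hlt : besselZero n * (ε / 2) < 1 := by
      have : besselZero n * ε < 1 := by
        rw [hε, mul_one_div, div_lt_one (by positivity)]; linarith
      nlinarith
    have := (abs_le.1 (abs_besselJ0_sub_one_le (r := besselZero n * (ε / 2)) (by positivity))).1
    have hJ : 0 < besselProfile (besselZero n) (ε / 2) := by
      rw [besselProfile]; linarith
    positivity
  linarith

/-- The weight `r` of polar coordinates exactly balances the decay `J₀(x)² ≤ B / x`: the integrand
is pointwise at most `B / z_n`. -/
theorem exists_norm_besselMode_sq_le : ∃ B : ℝ, 0 < B ∧ ∀ n : ℕ, 1 ≤ n →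
    ‖besselMode n‖ ^ 2 ≤ B / besselZero n := by
  obtain ⟨B, hB0, hB⟩ := exists_besselJ0_sq_le
  have hω := discConst_pos
  refine ⟨discConst * B, by positivity, fun n hn => ?_⟩
  have hz := besselZero_pos hn
  have hc := continuous_besselProfile (besselZero n)
  rw [besselMode_eq, norm_radial_sq hc.continuousOn, mul_div_assoc]
  refine mul_le_mul_of_nonneg_left ?_ hω.le
  have : ∫ r in (0 : ℝ)..1, B / besselZero n = B / besselZero n := by simp
  rw [← this]
  refine intervalIntegral.integral_mono_on_of_le_Ioo zero_le_one
    (((hc.pow 2).mul continuous_id).intervalIntegrable _ _) (by simp) fun r hr => ?_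
  have h1 := hB (besselZero n * r) (mul_pos hz hr.1)
  rw [le_div_iff₀ hz, besselProfile]
  linarith

theorem eigenfun_eq (n : ℕ) : eigenfun n = ‖besselMode n‖⁻¹ • besselMode n := rfl

theorem inner_eigenfun {n m : ℕ} (hn : 1 ≤ n) (hm : 1 ≤ m) :
    inner ℝ (eigenfun n) (eigenfun m) = if n = m then 1 else 0 := by
  rw [eigenfun_eq, eigenfun_eq, real_inner_smul_left, real_inner_smul_right]
  split_ifs with h
  · subst h
    rw [real_inner_self_eq_norm_sq]
    have := norm_ne_zero_iff.2 (besselMode_ne_zero n)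
    field_simp
  · rw [inner_besselMode hn hm h]; simp

theorem inner_radial_I_smul_eigenfun {φ : ℝ → ℝ} (hφ : ContinuousOn φ (Set.Icc 0 1)) (n : ℕ) :
    inner ℝ (radial φ) (Complex.I • eigenfun n) = 0 := by
  rw [eigenfun_eq, smul_comm, real_inner_smul_right, besselMode_eq,
    inner_radial_I_smul hφ (continuous_besselProfile _).continuousOn, mul_zero]

theorem inner_eigenfun_I_smul_radial {φ : ℝ → ℝ} (hφ : ContinuousOn φ (Set.Icc 0 1)) (n : ℕ) :
    inner ℝ (eigenfun n) (Complex.I • radial φ) = 0 := by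
  rw [eigenfun_eq, real_inner_smul_left, besselMode_eq,
    inner_radial_I_smul (continuous_besselProfile _).continuousOn hφ, mul_zero]

theorem eigenfun_mem_cutoffSpace {N n : ℕ} (hn : n ∈ Finset.Icc 1 N) :
    eigenfun n ∈ cutoffSpace (N : ℕ∞) :=
  Submodule.subset_span (Or.inl ⟨n, by simpa using hn, rfl⟩)

/-- A real radial function has no component along any `i e_n`, so only the `e_n` appear. -/
theorem coe_cutoff_radial {φ : ℝ → ℝ} (hφ : ContinuousOn φ (Set.Icc 0 1)) (N : ℕ) :
    (cutoff (N : ℕ∞) (radial φ) : L2Disc) =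
      ∑ n ∈ Finset.Icc 1 N, (inner ℝ (radial φ) (eigenfun n) : ℝ) • eigenfun n := by
  have hmem : ∑ n ∈ Finset.Icc 1 N, (inner ℝ (radial φ) (eigenfun n) : ℝ) • eigenfun n ∈
      cutoffSpace (N : ℕ∞) :=
    Submodule.sum_mem _ fun n hn => Submodule.smul_mem _ _ (eigenfun_mem_cutoffSpace hn)
  refine Submodule.eq_starProjection_of_mem_orthogonal hmem ?_
  rw [Submodule.mem_orthogonal']
  intro w hw
  refine Submodule.span_induction (p := fun w _ => inner ℝ (radial φ - ∑ n ∈ Finset.Icc 1 N,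
    (inner ℝ (radial φ) (eigenfun n) : ℝ) • eigenfun n) w = 0) ?_ (inner_zero_right _)
    (fun x y _ _ hx hy => by rw [inner_add_right, hx, hy, add_zero])
    (fun a x _ hx => by rw [real_inner_smul_right, hx, mul_zero]) hw
  rintro w (⟨m, hm, rfl⟩ | ⟨m, hm, rfl⟩)
  · have hm' : m ∈ Finset.Icc 1 N := by simpa using hm
    rw [inner_sub_left, sum_inner, Finset.sum_eq_single_of_mem m hm' fun n hn hnm => by
      rw [real_inner_smul_left, inner_eigenfun (Finset.mem_Icc.1 hn).1 hm.1, if_neg hnm, mul_zero],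
      real_inner_smul_left, inner_eigenfun hm.1 hm.1, if_pos rfl, mul_one, sub_self]
  · simp only
    rw [inner_sub_left, sum_inner, inner_radial_I_smul_eigenfun hφ, Finset.sum_eq_zero, sub_zero]
    intro n _
    rw [real_inner_smul_left]
    have := inner_eigenfun_I_smul_radial (φ := fun r => ‖besselMode m‖⁻¹ *
      besselProfile (besselZero m) r) (continuousOn_const.mul
      (continuous_besselProfile _).continuousOn) n
    rw [radial_smul (continuous_besselProfile _).continuousOn] at this
    rw [show eigenfun m = ‖besselMode m‖⁻¹ • radial (besselProfile (besselZero m)) from rfl, this,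
      mul_zero]

theorem coe_cutoff_top {u : L2Disc} (hu : u ∈ L2rad) : (cutoff ⊤ u : L2Disc) = u :=
  Submodule.starProjection_eq_self_iff.2 hu

theorem eigenfun_mem_L2rad (n : ℕ) (c : ℂ) : c • eigenfun n ∈ L2rad := by
  rw [eigenfun_eq, smul_comm]
  exact L2rad.smul_mem _ (smul_radial_mem_L2rad (continuous_besselProfile _).continuousOn c)

theorem cutoffSpace_le_L2rad (N : ℕ∞) : cutoffSpace N ≤ L2rad := by
  cases N with
  | top => exact le_rfl
  | coe N =>
    refine Submodule.span_le.2 ?_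
    rintro w (⟨m, -, rfl⟩ | ⟨m, -, rfl⟩)
    · simpa using eigenfun_mem_L2rad m 1
    · exact eigenfun_mem_L2rad m Complex.I

theorem ofReal_smul (a : ℝ) (v : L2Disc) : (a : ℂ) • v = a • v := algebraMap_smul ℂ a v

theorem smul_complex_mem_cutoffSpace (N : ℕ∞) (c : ℂ) {u : L2Disc} (hu : u ∈ cutoffSpace N) :
    c • u ∈ cutoffSpace N := by
  cases N with
  | top =>
    obtain ⟨f, hf⟩ := hu
    refine ⟨fun r => c * f r, ?_⟩
    filter_upwards [hf, Lp.coeFn_smul c u] with x h1 h2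
    rw [h2, Pi.smul_apply, h1, smul_eq_mul]
  | coe N =>
    have hdec : ∀ v : L2Disc, c • v = c.re • v + c.im • (Complex.I • v) := fun v => by
      conv_lhs => rw [← Complex.re_add_im c]
      rw [add_smul, mul_smul, ofReal_smul, ofReal_smul]
    refine Submodule.span_induction (p := fun w _ => c • w ∈ cutoffSpace (N : ℕ∞)) ?_
      (by rw [smul_zero]; exact Submodule.zero_mem _)
      (fun x y _ _ hx hy => by rw [smul_add]; exact Submodule.add_mem _ hx hy)
      (fun a x _ hx => by rw [smul_comm]; exact Submodule.smul_mem _ _ hx) hu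
    rintro w (⟨m, hm, rfl⟩ | ⟨m, hm, rfl⟩)
    · rw [hdec]
      exact Submodule.add_mem _ (Submodule.smul_mem _ _ (Submodule.subset_span (Or.inl ⟨m, hm, rfl⟩)))
        (Submodule.smul_mem _ _ (Submodule.subset_span (Or.inr ⟨m, hm, rfl⟩)))
    · simp only
      rw [hdec, smul_smul Complex.I, Complex.I_mul_I, neg_one_smul]
      exact Submodule.add_mem _ (Submodule.smul_mem _ _ (Submodule.subset_span (Or.inr ⟨m, hm, rfl⟩)))
        (Submodule.smul_mem _ _ (Submodule.neg_mem _ (Submodule.subset_span (Or.inl ⟨m, hm, rfl⟩))))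

/-- The cutoff commutes with multiplication by complex numbers. -/
theorem coe_cutoff_smul (N : ℕ∞) (c : ℂ) (u : L2Disc) :
    (cutoff N (c • u) : L2Disc) = c • (cutoff N u : L2Disc) := by
  refine Submodule.eq_starProjection_of_mem_orthogonal
    (smul_complex_mem_cutoffSpace N c (cutoff N u).2) ?_
  rw [Submodule.mem_orthogonal']
  intro w hw
  rw [← smul_sub, inner_smul_complex]
  exact Submodule.starProjection_inner_eq_zero _ _ (smul_complex_mem_cutoffSpace N _ hw)

/-- The cutoff keeps real functions real, so the orthogonality of real and imaginary functions
survives truncation for every `N`. -/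
theorem inner_cutoff_radial_I_smul {φ ψ : ℝ → ℝ} (hφ : ContinuousOn φ (Set.Icc 0 1))
    (hψ : ContinuousOn ψ (Set.Icc 0 1)) (N : ℕ∞) :
    inner ℝ (cutoff N (radial φ) : L2Disc) (Complex.I • radial ψ) = 0 := by
  cases N with
  | top => rw [coe_cutoff_top (radial_mem_L2rad hφ), inner_radial_I_smul hφ hψ]
  | coe N =>
    rw [coe_cutoff_radial hφ, sum_inner]
    refine Finset.sum_eq_zero fun n _ => ?_
    rw [real_inner_smul_left, inner_eigenfun_I_smul_radial hψ, mul_zero]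

/-! ### Nondegeneracy of the tangent directions -/

/-! ### Nondegeneracy of the tangent vectors -/

section

variable {q p ψ ψ₁ γ : ℝ → ℝ}

/-- Green's identity applies because `ψ_δ - ψ_δ(1)` vanishes on the unit circle. In the Bessel basis
the Laplacian then acts diagonally, also after truncation. -/
theorem inner_scaledL2_besselMode (hs : IsRadialSolution q p) (ht : IsLaplaceTriple q p ψ ψ₁ γ)
    {δ : ℝ} (hδ : 0 < δ) {n : ℕ} (hn : 1 ≤ n) :
    inner ℝ (scaledL2 γ 0 δ) (besselMode n) =
      -(δ ^ 2 * besselZero n ^ 2) * inner ℝ (scaledL2 ψ 1 δ) (besselMode n) := by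
  have hcψ := continuousOn_shifted (ht.profile.continuousOn hs) 1 hδ
  have hcγ := continuousOn_shifted (ht.profileΔ.continuousOn hs) 0 hδ
  have hcψ₁ := continuousOn_rescaled (ht.profile₁.continuousOn hs) hδ
  have hlin : ∀ r : ℝ, HasDerivAt (fun r : ℝ => δ⁻¹ * r) δ⁻¹ r := fun r => by
    simpa using (hasDerivAt_id r).const_mul δ⁻¹
  have key := integral_mul_besselProfile (u := shifted ψ 1 δ) (u₁ := rescaled ψ₁ δ)
    (k := fun r => (δ ^ 2)⁻¹ * shifted γ 0 δ r) hcψ hcψ₁ (continuousOn_const.mul hcγ)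
    (fun r hr _ => by
      refine ((((ht.hasDerivAt _ (by positivity : 0 < δ⁻¹ * r)).comp r (hlin r)).const_mul
        δ⁻¹).sub_const (1 * rescaled ψ δ 1)).congr_deriv ?_
      simp only [rescaled]
      field_simp)
    (fun r hr _ => by
      refine (((ht.hasDerivAt₁ _ (by positivity : 0 < δ⁻¹ * r)).comp r (hlin r)).const_mul
        δ⁻¹).congr_deriv ?_
      simp only [shifted, rescaled]
      field_simp
      ring)
    (by simp [rescaled, ht.zero]) (by simp [shifted]) (besselZero_pos hn) (besselJ0_besselZero hn)
  have hcJ := (continuous_besselProfile (besselZero n)).continuousOn (s := Set.Icc 0 1)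
  rw [besselMode_eq, scaledL2, scaledL2, inner_radial hcγ hcJ, inner_radial hcψ hcJ]
  simp only [mul_assoc] at key ⊢
  rw [intervalIntegral.integral_const_mul] at key
  set A := ∫ r in (0 : ℝ)..1, shifted γ 0 δ r * (besselProfile (besselZero n) r * r)
  set B := ∫ r in (0 : ℝ)..1, shifted ψ 1 δ r * (besselProfile (besselZero n) r * r)
  have hA : A = δ ^ 2 * (-besselZero n ^ 2 * B) := by rw [← key]; field_simp
  rw [hA]
  ring

theorem integral_comp_inv_mul {f : ℝ → ℝ} {δ : ℝ} (hδ : 0 < δ) :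
    ∫ r in (0 : ℝ)..1, f (δ⁻¹ * r) = δ * ∫ s in (0 : ℝ)..δ⁻¹, f s := by
  rw [intervalIntegral.integral_comp_mul_left _ (inv_ne_zero hδ.ne'), inv_inv, mul_zero, mul_one,
    smul_eq_mul]

/-- On the scale `δ` where `ψ_δ` concentrates, `J₀(z r)` is close to `1` when `z δ` is small. The
coefficient is then close to `discConst * δ` times the integral of `ψ r` over the half-line, which
is nonzero. -/
theorem exists_le_abs_inner_scaledL2 (hs : IsRadialSolution q p)
    (ht : IsLaplaceTriple q p ψ ψ₁ γ) :
    ∃ a κ δ₁ : ℝ, 0 < a ∧ 0 < κ ∧ κ ≤ 1 ∧ 0 < δ₁ ∧ δ₁ ≤ 1 ∧ ∀ δ z, 0 < δ → δ ≤ δ₁ → 0 < z →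
      z * δ ≤ κ → a * δ ≤ |inner ℝ (scaledL2 ψ 1 δ) (radial (besselProfile z))| := by
  have hω := discConst_pos
  set f : ℝ → ℝ := fun r => ψ r * r with hf
  set I : ℝ := ∫ r in Set.Ioi (0 : ℝ), f r with hI
  have hI0 : 0 < |I| := abs_pos.2 ht.integral_ne_zero
  have hfi : IntegrableOn f (Set.Ioi 0) :=
    (ht.profile.radius.integrableOn hs).congr_fun (fun r _ => mul_comm _ _) measurableSet_Ioi
  set g : ℝ → ℝ := fun r => |r * (r * ψ r)| with hg
  have hgi : IntegrableOn g (Set.Ioi 0) := (ht.profile.radius.radius.integrableOn hs).abs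
  have hψc := ht.profile.continuousOn hs
  have hfc : ContinuousOn f (Set.Ici 0) := hψc.mul continuousOn_id
  have hgc : ContinuousOn g (Set.Ici 0) := (ht.profile.radius.radius.continuousOn hs).abs
  set I₂ : ℝ := ∫ r in Set.Ioi (0 : ℝ), g r with hI₂
  have hI₂0 : 0 ≤ I₂ := integral_nonneg fun r => abs_nonneg _
  -- the tail of the integral is negligible for small `δ`
  have htail : Tendsto (fun x => ∫ s in (0 : ℝ)..x, f s) atTop (𝓝 I) :=
    intervalIntegral_tendsto_integral_Ioi 0 hfi tendsto_id
  obtain ⟨R, hR⟩ := eventually_atTop.1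
    ((Metric.tendsto_nhds.1 htail) (|I| / 8) (by positivity))
  obtain ⟨A, hA0, hA⟩ := ht.profile.exists_rescaled_one_le hs 2
  -- The error budget, in units of `δ`: `|I|/8` for the tail beyond `δ⁻¹`, `|I|/4` for replacing
  -- `J₀` by `1`, and `|I|/8` for the boundary constant, leaving `|I|/2`.
  refine ⟨discConst * (|I| / 2), min 1 (|I| / (4 * (I₂ + 1))),
    min 1 (min (1 / (|R| + 1)) (|I| / (8 * (A + 1)))), by positivity, by positivity,
    min_le_left _ _, by positivity, min_le_left _ _, fun δ z hδ hδ1 hz hzδ => ?_⟩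
  have hδR : δ ≤ 1 / (|R| + 1) := hδ1.trans ((min_le_right _ _).trans (min_le_left _ _))
  have hδA : δ ≤ |I| / (8 * (A + 1)) := hδ1.trans ((min_le_right _ _).trans (min_le_right _ _))
  have hκI : z * δ ≤ |I| / (4 * (I₂ + 1)) := hzδ.trans (min_le_right _ _)
  have hcJ := continuous_besselProfile z
  have hcψ := continuousOn_shifted hψc 1 hδ
  rw [scaledL2, inner_radial hcψ hcJ.continuousOn, abs_mul, abs_of_pos hω, mul_assoc]
  refine mul_le_mul_of_nonneg_left ?_ hω.le
  have hmaps : Set.MapsTo (fun r => δ⁻¹ * r) (Set.Icc (0 : ℝ) 1) (Set.Ici 0) := fun r hr =>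
    mul_nonneg (inv_pos.2 hδ).le hr.1
  have hlin : ContinuousOn (fun r => δ⁻¹ * r) (Set.Icc (0 : ℝ) 1) := by fun_prop
  have hfδ : ContinuousOn (fun r => f (δ⁻¹ * r)) (Set.Icc 0 1) := hfc.comp hlin hmaps
  have hgδ : ContinuousOn (fun r => g (δ⁻¹ * r)) (Set.Icc 0 1) := hgc.comp hlin hmaps
  have e : ∀ r, shifted ψ 1 δ r * besselProfile z r * r = f (δ⁻¹ * r) +
      f (δ⁻¹ * r) * (besselProfile z r - 1) - rescaled ψ δ 1 * (besselProfile z r * r) := by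
    intro r
    simp only [shifted, rescaled, hf]
    ring
  simp only [e]
  have i1 : IntervalIntegrable (fun r => f (δ⁻¹ * r)) volume 0 1 :=
    hfδ.intervalIntegrable_of_Icc zero_le_one
  have i2 : IntervalIntegrable (fun r => f (δ⁻¹ * r) * (besselProfile z r - 1)) volume 0 1 :=
    (hfδ.mul (hcJ.sub continuous_const).continuousOn).intervalIntegrable_of_Icc zero_le_one
  have i3 : IntervalIntegrable (fun r => besselProfile z r * r) volume 0 1 :=
    (hcJ.mul continuous_id).intervalIntegrable _ _
  rw [intervalIntegral.integral_sub (i1.add i2) (i3.const_mul _),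
    intervalIntegral.integral_add i1 i2, intervalIntegral.integral_const_mul,
    integral_comp_inv_mul hδ]
  have hRδ : R ≤ δ⁻¹ := by
    have : |R| + 1 ≤ δ⁻¹ := by
      rw [le_inv_comm₀ (by positivity) hδ, ← one_div]; exact hδR
    linarith [le_abs_self R]
  have h1 : |(∫ s in (0 : ℝ)..δ⁻¹, f s) - I| < |I| / 8 := by
    have := hR _ hRδ
    rwa [Real.dist_eq] at this
  have h2 : |∫ r in (0 : ℝ)..1, f (δ⁻¹ * r) * (besselProfile z r - 1)| ≤ z * δ * (δ * I₂) := by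
    have hb : ‖∫ r in (0 : ℝ)..1, f (δ⁻¹ * r) * (besselProfile z r - 1)‖ ≤
        ∫ r in (0 : ℝ)..1, z * δ * g (δ⁻¹ * r) := by
      refine intervalIntegral.norm_integral_le_of_norm_le zero_le_one ?_
        ((continuousOn_const.mul hgδ).intervalIntegrable_of_Icc zero_le_one)
      refine Eventually.of_forall fun r hr => ?_
      rw [norm_mul, Real.norm_eq_abs, Real.norm_eq_abs]
      have hJ := abs_besselJ0_sub_one_le (r := z * r) (mul_nonneg hz.le hr.1.le)
      calc |f (δ⁻¹ * r)| * |besselProfile z r - 1| ≤ |f (δ⁻¹ * r)| * (z * r) :=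
            mul_le_mul_of_nonneg_left hJ (abs_nonneg _)
        _ = z * δ * g (δ⁻¹ * r) := by
            simp only [hf, hg, abs_mul, abs_of_pos hr.1, abs_of_pos (inv_pos.2 hδ)]
            field_simp
    rw [intervalIntegral.integral_const_mul, integral_comp_inv_mul hδ, Real.norm_eq_abs] at hb
    refine hb.trans (mul_le_mul_of_nonneg_left (mul_le_mul_of_nonneg_left ?_ hδ.le) (by positivity))
    rw [intervalIntegral.integral_of_le (by positivity)]
    exact setIntegral_mono_set hgi (Eventually.of_forall fun r => abs_nonneg _)
      Set.Ioc_subset_Ioi_self.eventuallyLE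
  have h3 : |∫ r in (0 : ℝ)..1, besselProfile z r * r| ≤ 1 := by
    have := intervalIntegral.norm_integral_le_of_norm_le_const (a := 0) (b := 1) (C := 1)
      (f := fun r => besselProfile z r * r) fun r hr => by
        rw [Set.uIoc_of_le zero_le_one] at hr
        rw [norm_mul, Real.norm_eq_abs, Real.norm_eq_abs, abs_of_pos hr.1]
        exact mul_le_one₀ (abs_besselJ0_le_one (mul_nonneg hz.le hr.1.le)) hr.1.le hr.2
    simpa using this
  have h4 : |rescaled ψ δ 1 * ∫ r in (0 : ℝ)..1, besselProfile z r * r| ≤ A * δ ^ 2 := by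
    rw [abs_mul]
    exact (mul_le_mul (hA δ hδ) h3 (abs_nonneg _) (by positivity)).trans (by rw [mul_one])
  have h5 : A * δ ^ 2 ≤ δ * (|I| / 8) := by
    rw [le_div_iff₀ (by positivity)] at hδA
    nlinarith
  have h6 : z * δ * (δ * I₂) ≤ δ * (|I| / 4) := by
    rw [le_div_iff₀ (by positivity)] at hκI
    have : z * δ * I₂ ≤ |I| / 4 := by
      have : 0 < z * δ := by positivity
      nlinarith
    nlinarith
  set X := ∫ s in (0 : ℝ)..δ⁻¹, f s
  set Y := ∫ r in (0 : ℝ)..1, f (δ⁻¹ * r) * (besselProfile z r - 1)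
  set Z := rescaled ψ δ 1 * ∫ r in (0 : ℝ)..1, besselProfile z r * r
  have h7 : |I| - |I| / 8 ≤ |X| := by
    have := abs_sub_abs_le_abs_sub I X
    rw [abs_sub_comm] at this
    linarith
  have h8 : |δ * X| = δ * |X| := by rw [abs_mul, abs_of_pos hδ]
  have h9 : |δ * X| - |Y| - |Z| ≤ |δ * X + Y - Z| := by
    have t1 := abs_sub_abs_le_abs_sub (δ * X + Y) Z
    have t2 := abs_sub_abs_le_abs_sub (δ * X) (-Y)
    rw [abs_neg, sub_neg_eq_add] at t2
    linarith
  refine le_trans ?_ h9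
  rw [h8]
  nlinarith

/-- Integration by parts and rescaling turn the pairing into `discConst` times the integral of `ψ₁²
/ s` over `[0, δ⁻¹]`. This dominates the same integral over a fixed interval on which `ψ₁` is not
identically zero. -/
theorem exists_le_neg_inner_scaledL2 (hs : IsRadialSolution q p)
    (ht : IsLaplaceTriple q p ψ ψ₁ γ) :
    ∃ c δ₁ : ℝ, 0 < c ∧ 0 < δ₁ ∧ ∀ δ, 0 < δ → δ ≤ δ₁ →
      c ≤ -inner ℝ (scaledL2 ψ 1 δ) (scaledL2 γ 0 δ) := by
  have hω := discConst_pos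
  have hψc := ht.profile.continuousOn hs
  have hψ₁c := ht.profile₁.continuousOn hs
  have hγc := ht.profileΔ.continuousOn hs
  -- If `ψ₁` vanished on `(0, ∞)`, `ψ` would be constant there, hence zero by decay, against the
  -- nonvanishing of its integral.
  obtain ⟨r₀, hr₀, hne⟩ : ∃ r₀, 0 < r₀ ∧ ψ₁ r₀ ≠ 0 := by
    by_contra! hall
    apply ht.integral_ne_zero
    obtain ⟨A, c, hc, hA⟩ := ht.profile.decay hs
    have hlim := tendsto_zero_of_exp_decay hc hA
    have hconst : ∀ r, 0 < r → ψ r = 0 := by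
      intro r hr
      have heq : ∀ s, r ≤ s → ψ s = ψ r := by
        intro s hrs
        refine (convex_Ici r).is_const_of_fderivWithin_eq_zero (𝕜 := ℝ) (f := ψ) ?_ ?_ hrs
          Set.self_mem_Ici
        · exact fun x hx =>
            (ht.hasDerivAt x (hr.trans_le hx)).differentiableAt.differentiableWithinAt
        · intro x hx
          have hx0 : 0 < x := hr.trans_le hx
          have hd := ht.hasDerivAt x hx0
          rw [hall x hx0, zero_div] at hd
          have := hd.hasFDerivAt.hasFDerivWithinAt.fderivWithin (uniqueDiffOn_Ici r x hx)
          rw [this]; ext; simp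
      refine tendsto_nhds_unique (tendsto_const_nhds.congr' ?_) hlim
      filter_upwards [eventually_ge_atTop r] with s hs' using (heq s hs').symm
    rw [setIntegral_congr_fun (g := fun _ => 0) measurableSet_Ioi fun r hr => by
      simp only [hconst r hr, zero_mul]]
    simp
  -- the primitive of `ψ₁² / x`
  set H : ℝ → ℝ → ℝ := fun R x => ψ₁ x * (ψ x - ψ R) - ∫ s in (0 : ℝ)..x, (ψ s - ψ R) * γ s * s
    with hH
  have hint : ∀ R, ContinuousOn (fun s => (ψ s - ψ R) * γ s * s) (Set.Ici 0) := fun R =>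
    ((hψc.sub continuousOn_const).mul hγc).mul continuousOn_id
  have hHc : ∀ R, 0 < R → ContinuousOn (H R) (Set.Icc 0 R) := by
    intro R hR
    have h1 : ContinuousOn (fun x => ψ₁ x * (ψ x - ψ R)) (Set.Icc 0 R) :=
      (hψ₁c.mul (hψc.sub continuousOn_const)).mono Set.Icc_subset_Ici_self
    refine h1.sub ?_
    have := intervalIntegral.continuousOn_primitive_interval (a := 0) (b := R) (μ := volume)
      (f := fun s => (ψ s - ψ R) * γ s * s) (by
        rw [Set.uIcc_of_le hR.le]
        exact ((hint R).mono Set.Icc_subset_Ici_self).integrableOn_compact isCompact_Icc)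
    rwa [Set.uIcc_of_le hR.le] at this
  have hHd : ∀ R x, 0 < x → HasDerivAt (H R) (ψ₁ x ^ 2 / x) x := by
    intro R x hx
    have h1 := (ht.hasDerivAt₁ x hx).mul ((ht.hasDerivAt x hx).sub_const (ψ R))
    have hcat : ContinuousAt (fun s => (ψ s - ψ R) * γ s * s) x :=
      (hint R).continuousAt (Ici_mem_nhds hx)
    have h2 : HasDerivAt (fun x => ∫ s in (0 : ℝ)..x, (ψ s - ψ R) * γ s * s)
        ((ψ x - ψ R) * γ x * x) x := by
      refine intervalIntegral.integral_hasDerivAt_right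
        (((hint R).mono (by rw [Set.uIcc_of_le hx.le]; exact Set.Icc_subset_Ici_self)).intervalIntegrable) ?_ hcat
      exact ((hint R).mono Set.Ioi_subset_Ici_self).stronglyMeasurableAtFilter isOpen_Ioi x hx
    refine (h1.sub h2).congr_deriv ?_
    field_simp
    ring
  have hmono : ∀ R, 0 < R → MonotoneOn (H R) (Set.Icc 0 R) := fun R hR =>
    monotoneOn_of_hasDerivWithinAt_nonneg (convex_Icc 0 R) (hHc R hR)
      (f' := fun x => ψ₁ x ^ 2 / x)
      (fun x hx => by
        rw [interior_Icc] at hx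
        exact (hHd R x hx.1).hasDerivWithinAt)
      fun x hx => by
        rw [interior_Icc] at hx
        exact div_nonneg (sq_nonneg _) hx.1.le
  have hH0 : ∀ R, H R 0 = 0 := fun R => by simp [hH, ht.zero]
  -- the increment over a fixed interval is positive and independent of `R`
  have hinc : ∀ R, r₀ < R → H R (2 * r₀) - H R r₀ = H r₀ (2 * r₀) - H r₀ r₀ := by
    intro R _
    have hderiv : ∀ x ∈ Set.Ici r₀, HasDerivAt (fun x => H R x - H r₀ x) 0 x := fun x hx => by
      have hx0 : 0 < x := lt_of_lt_of_le hr₀ hx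
      exact ((hHd R x hx0).sub (hHd r₀ x hx0)).congr_deriv (sub_self _)
    have hc := (convex_Ici r₀).norm_image_sub_le_of_norm_hasDerivWithin_le (C := 0)
      (fun x hx => (hderiv x hx).hasDerivWithinAt) (fun x _ => by simp)
      (Set.self_mem_Ici) (Set.mem_Ici.2 (by linarith : r₀ ≤ 2 * r₀))
    rw [zero_mul] at hc
    have := norm_le_zero_iff.1 hc
    linarith
  have hpos : 0 < H r₀ (2 * r₀) - H r₀ r₀ := by
    obtain ⟨ξ, hξ⟩ : ∃ ξ, r₀ < ξ ∧ ξ < 2 * r₀ ∧ ∀ x ∈ Set.Icc r₀ ξ, ψ₁ x ≠ 0 := by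
      have hcat : ContinuousAt ψ₁ r₀ := hψ₁c.continuousAt (Ici_mem_nhds hr₀)
      obtain ⟨ε, hε, hball⟩ := Metric.eventually_nhds_iff.1 (hcat.eventually_ne hne)
      refine ⟨r₀ + min (ε / 2) (r₀ / 2), by have : 0 < min (ε / 2) (r₀ / 2) := by positivity
                                            linarith, ?_, fun x hx => hball ?_⟩
      · linarith [min_le_right (ε / 2) (r₀ / 2)]
      · rw [Real.dist_eq, abs_of_nonneg (by linarith [hx.1])]
        linarith [hx.2, min_le_left (ε / 2) (r₀ / 2)]
    have hcont : ∀ a b, r₀ ≤ a → ContinuousOn (H r₀) (Set.Icc a b) := fun a b ha x hx =>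
      (hHd r₀ x (by linarith [hx.1])).continuousAt.continuousWithinAt
    have hstrict : StrictMonoOn (H r₀) (Set.Icc r₀ ξ) := by
      refine strictMonoOn_of_deriv_pos (convex_Icc _ _) (hcont _ _ le_rfl) fun x hx => ?_
      rw [interior_Icc] at hx
      have hx0 : 0 < x := hr₀.trans hx.1
      rw [(hHd r₀ x hx0).deriv]
      have := hξ.2.2 x ⟨hx.1.le, hx.2.le⟩
      positivity
    have hmono' : MonotoneOn (H r₀) (Set.Icc ξ (2 * r₀)) :=
      monotoneOn_of_hasDerivWithinAt_nonneg (convex_Icc _ _) (hcont _ _ hξ.1.le)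
        (f' := fun x => ψ₁ x ^ 2 / x)
        (fun x hx => by
          rw [interior_Icc] at hx
          exact (hHd r₀ x (by linarith [hx.1, hξ.1])).hasDerivWithinAt)
        fun x hx => by
          rw [interior_Icc] at hx
          exact div_nonneg (sq_nonneg _) (by linarith [hx.1, hξ.1])
    have h1 := hstrict (Set.left_mem_Icc.2 hξ.1.le) (Set.right_mem_Icc.2 hξ.1.le) hξ.1
    have h2 := hmono' (Set.left_mem_Icc.2 hξ.2.1.le) (Set.right_mem_Icc.2 hξ.2.1.le) hξ.2.1.le
    linarith
  refine ⟨discConst * (H r₀ (2 * r₀) - H r₀ r₀), (2 * r₀)⁻¹, by positivity, by positivity,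
    fun δ hδ hδ1 => ?_⟩
  have hR : 2 * r₀ ≤ δ⁻¹ := by rw [le_inv_comm₀ (by positivity) hδ]; exact hδ1
  have hR0 : 0 < δ⁻¹ := by positivity
  rw [scaledL2, scaledL2, inner_radial (continuousOn_shifted hψc 1 hδ)
    (continuousOn_shifted hγc 0 hδ), ← mul_neg]
  refine mul_le_mul_of_nonneg_left ?_ hω.le
  have e : ∀ r, shifted ψ 1 δ r * shifted γ 0 δ r * r =
      δ⁻¹ * ((ψ (δ⁻¹ * r) - ψ δ⁻¹) * γ (δ⁻¹ * r) * (δ⁻¹ * r)) := fun r => by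
    simp only [shifted, rescaled, mul_one]; ring
  simp only [e]
  rw [intervalIntegral.integral_const_mul,
    integral_comp_inv_mul (f := fun s => (ψ s - ψ δ⁻¹) * γ s * s) hδ, ← mul_assoc,
    inv_mul_cancel₀ hδ.ne', one_mul]
  have hHR : H δ⁻¹ δ⁻¹ = -∫ s in (0 : ℝ)..δ⁻¹, (ψ s - ψ δ⁻¹) * γ s * s := by simp [hH]
  rw [← hHR, ← hinc δ⁻¹ (by linarith)]
  have m1 := hmono δ⁻¹ hR0 ⟨by positivity, hR⟩ ⟨hR0.le, le_rfl⟩ hR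
  have m2 := hmono δ⁻¹ hR0 ⟨le_rfl, hR0.le⟩ ⟨hr₀.le, by linarith⟩ hr₀.le
  rw [hH0] at m2
  linarith

/-- Parseval on `E_N` with the diagonal action of the Laplacian. Every term is nonnegative, so any
set of modes up to `N` yields a lower bound. -/
theorem neg_inner_cutoff_scaledL2 (hs : IsRadialSolution q p) (ht : IsLaplaceTriple q p ψ ψ₁ γ)
    {δ : ℝ} (hδ : 0 < δ) (N : ℕ) :
    -inner ℝ (cutoff (N : ℕ∞) (scaledL2 ψ 1 δ) : L2Disc) (scaledL2 γ 0 δ) =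
      ∑ n ∈ Finset.Icc 1 N, δ ^ 2 * besselZero n ^ 2 *
        (inner ℝ (scaledL2 ψ 1 δ) (besselMode n) ^ 2 / ‖besselMode n‖ ^ 2) := by
  rw [scaledL2, coe_cutoff_radial (continuousOn_shifted (ht.profile.continuousOn hs) 1 hδ),
    sum_inner, ← Finset.sum_neg_distrib]
  refine Finset.sum_congr rfl fun n hn => ?_
  rw [real_inner_smul_left, eigenfun_eq, real_inner_smul_right, real_inner_smul_left,
    real_inner_comm (scaledL2 γ 0 δ), inner_scaledL2_besselMode hs ht hδ (Finset.mem_Icc.1 hn).1,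
    scaledL2]
  field_simp

theorem pow_four_le_sum_cube (M : ℕ) : (M : ℝ) ^ 4 / 4 ≤ ∑ n ∈ Finset.Icc 1 M, (n : ℝ) ^ 3 := by
  induction M with
  | zero => simp
  | succ M ih =>
    rw [Finset.sum_Icc_succ_top (by omega)]
    push_cast
    have : (0 : ℝ) ≤ M := Nat.cast_nonneg M
    nlinarith [sq_nonneg (M : ℝ)]

/-- Lower bounds for `⟨P_{≤N} t, -Δ t⟩`. They are uniform for `N δ ≥ 1 / 2` and polynomial in `δ`
in general. -/
theorem exists_coercive (hs : IsRadialSolution q p) (ht : IsLaplaceTriple q p ψ ψ₁ γ) :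
    ∃ c δ₁ : ℝ, 0 < c ∧ 0 < δ₁ ∧ ∀ δ, 0 < δ → δ ≤ δ₁ →
      (c ≤ -inner ℝ (cutoff ⊤ (scaledL2 ψ 1 δ) : L2Disc) (scaledL2 γ 0 δ)) ∧
      ∀ N : ℕ, 1 ≤ N →
        (c * δ ^ 4 ≤ -inner ℝ (cutoff (N : ℕ∞) (scaledL2 ψ 1 δ) : L2Disc) (scaledL2 γ 0 δ)) ∧
        (1 / 2 ≤ N * δ →
          c ≤ -inner ℝ (cutoff (N : ℕ∞) (scaledL2 ψ 1 δ) : L2Disc) (scaledL2 γ 0 δ)) := by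
  obtain ⟨c₁, δ₁, hc₁, hδ₁, h₁⟩ := exists_le_neg_inner_scaledL2 hs ht
  obtain ⟨a, κ, δ₂, ha, hκ, hκ1, hδ₂, hδ₂1, h₂⟩ := exists_le_abs_inner_scaledL2 hs ht
  obtain ⟨B, hB, hBn⟩ := exists_norm_besselMode_sq_le
  set c₀ : ℝ := a ^ 2 / B with hc₀
  have hc₀0 : 0 < c₀ := by positivity
  refine ⟨min c₁ (min c₀ (c₀ * (κ / 8) ^ 4 / 4)), min δ₁ (min δ₂ (κ / 4)), by positivity,
    by positivity, fun δ hδ hδle => ⟨?_, fun N hN => ?_⟩⟩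
  · rw [scaledL2, coe_cutoff_top (radial_mem_L2rad (continuousOn_shifted (ht.profile.continuousOn hs) 1 hδ))]
    exact (min_le_left _ _).trans (h₁ δ hδ (hδle.trans (min_le_left _ _)))
  have hδ2 : δ ≤ δ₂ := hδle.trans ((min_le_right _ _).trans (min_le_left _ _))
  have hδκ : δ ≤ κ / 4 := hδle.trans ((min_le_right _ _).trans (min_le_right _ _))
  rw [neg_inner_cutoff_scaledL2 hs ht hδ]
  have hterm0 : ∀ n ∈ Finset.Icc 1 N, 0 ≤ δ ^ 2 * besselZero n ^ 2 *
      (inner ℝ (scaledL2 ψ 1 δ) (besselMode n) ^ 2 / ‖besselMode n‖ ^ 2) := fun n _ => by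
    positivity
  -- The coefficient is at least `a δ` and the squared norm of the mode at most `B / z_n`, so the
  -- term is at least `c₀ δ⁴ z_n³`. The condition `4 n δ ≤ κ` ensures `z_n δ ≤ κ`.
  have hterm : ∀ n : ℕ, 1 ≤ n → 4 * n * δ ≤ κ → c₀ * δ ^ 4 * (n : ℝ) ^ 3 ≤
      δ ^ 2 * besselZero n ^ 2 *
        (inner ℝ (scaledL2 ψ 1 δ) (besselMode n) ^ 2 / ‖besselMode n‖ ^ 2) := by
    intro n hn hnκ
    have hz := besselZero_pos hn
    have hzκ : besselZero n * δ ≤ κ := le_trans (by gcongr; exact besselZero_le n) hnκ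
    have hin := h₂ δ (besselZero n) hδ hδ2 hz hzκ
    have hsq : (a * δ) ^ 2 ≤ inner ℝ (scaledL2 ψ 1 δ) (besselMode n) ^ 2 := by
      rw [← sq_abs (inner ℝ (scaledL2 ψ 1 δ) (besselMode n))]
      exact pow_le_pow_left₀ (by positivity) hin 2
    have hnorm0 : 0 < ‖besselMode n‖ ^ 2 := by
      have := norm_pos_iff.2 (besselMode_ne_zero n); positivity
    have hq : (a * δ) ^ 2 / (B / besselZero n) ≤
        inner ℝ (scaledL2 ψ 1 δ) (besselMode n) ^ 2 / ‖besselMode n‖ ^ 2 :=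
      div_le_div₀ (sq_nonneg _) hsq hnorm0 (hBn n hn)
    calc c₀ * δ ^ 4 * (n : ℝ) ^ 3 ≤ c₀ * δ ^ 4 * besselZero n ^ 3 := by
          gcongr; exact le_besselZero n
      _ = δ ^ 2 * besselZero n ^ 2 * ((a * δ) ^ 2 / (B / besselZero n)) := by
          rw [hc₀]; field_simp
      _ ≤ _ := by gcongr
  refine ⟨?_, fun hNδ => ?_⟩
  -- For arbitrary `N` only the first mode is kept.
  · refine le_trans ?_ (Finset.single_le_sum hterm0 (Finset.mem_Icc.2 ⟨le_rfl, hN⟩))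
    refine le_trans ?_ (hterm 1 le_rfl (by push_cast; linarith))
    rw [Nat.cast_one, one_pow, mul_one]
    gcongr
    exact (min_le_right _ _).trans (min_le_left _ _)
  -- The modes `n ≤ M` all satisfy `4 n δ ≤ κ`. They lie below `N`, as `M δ ≤ κ / 4 ≤ 1/4` while `N
  -- δ ≥ 1/2`; and `M δ ≥ κ / 8`, so the sum of cubes compensates `δ⁴`.
  · set M : ℕ := ⌊κ / (4 * δ)⌋₊ with hM
    have hMle : (M : ℝ) ≤ κ / (4 * δ) := Nat.floor_le (by positivity)
    have hMlt : κ / (4 * δ) < M + 1 := Nat.lt_floor_add_one _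
    have h1κ : 1 ≤ κ / (4 * δ) := by rw [le_div_iff₀ (by positivity)]; linarith
    have hM1 : 1 ≤ M := Nat.le_floor (by exact_mod_cast h1κ)
    have hM1' : (1 : ℝ) ≤ M := by exact_mod_cast hM1
    have hMδ : 4 * M * δ ≤ κ := by
      rw [le_div_iff₀ (by positivity)] at hMle; linarith
    have hMN : M ≤ N := by
      have : (M : ℝ) ≤ N := by
        by_contra! hlt
        have : (N : ℝ) * δ < M * δ := by gcongr
        nlinarith
      exact_mod_cast this
    have hMlow : κ / 8 ≤ M * δ := by
      rw [div_lt_iff₀ (by positivity)] at hMlt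
      nlinarith
    calc min c₁ (min c₀ (c₀ * (κ / 8) ^ 4 / 4)) ≤ c₀ * (κ / 8) ^ 4 / 4 :=
          (min_le_right _ _).trans (min_le_right _ _)
      _ ≤ c₀ * (M * δ) ^ 4 / 4 := by gcongr
      _ = c₀ * δ ^ 4 * ((M : ℝ) ^ 4 / 4) := by ring
      _ ≤ c₀ * δ ^ 4 * ∑ n ∈ Finset.Icc 1 M, (n : ℝ) ^ 3 := by
          gcongr; exact pow_four_le_sum_cube M
      _ = ∑ n ∈ Finset.Icc 1 M, c₀ * δ ^ 4 * (n : ℝ) ^ 3 := Finset.mul_sum _ _ _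
      _ ≤ ∑ n ∈ Finset.Icc 1 M, δ ^ 2 * besselZero n ^ 2 *
          (inner ℝ (scaledL2 ψ 1 δ) (besselMode n) ^ 2 / ‖besselMode n‖ ^ 2) := by
          refine Finset.sum_le_sum fun n hn => hterm n (Finset.mem_Icc.1 hn).1 ?_
          have : (n : ℝ) ≤ M := by exact_mod_cast (Finset.mem_Icc.1 hn).2
          refine le_trans ?_ hMδ
          gcongr
      _ ≤ _ := Finset.sum_le_sum_of_subset_of_nonneg (Finset.Icc_subset_Icc le_rfl hMN)
          fun n hn _ => hterm0 n hn

end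

/-! ### Phases and tame curves -/

/-! ### The moving frame along the soliton manifold -/

theorem hasDerivAt_phase (θ : ℝ) : HasDerivAt phase (Complex.I * phase θ) θ := by
  have h1 : HasDerivAt (fun t : ℝ => (t : ℂ) * Complex.I) Complex.I θ := by
    simpa using (hasDerivAt_id θ).ofReal_comp.mul_const Complex.I
  exact h1.cexp.congr_deriv (mul_comm _ _)

theorem contDiff_phase : ContDiff ℝ ∞ phase := by
  unfold phase
  exact (Complex.ofRealCLM.contDiff.mul contDiff_const).cexp

theorem norm_phase_sub_le (a b : ℝ) : ‖phase a - phase b‖ ≤ |a - b| := by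
  have h := convex_univ.norm_image_sub_le_of_norm_hasDerivWithin_le (f := phase)
    (f' := fun t => Complex.I * phase t) (C := 1)
    (fun x _ => (hasDerivAt_phase x).hasDerivWithinAt)
    (fun x _ => by simp [norm_phase]) (Set.mem_univ b) (Set.mem_univ a)
  simpa using h

/-- Smooth curves in `L²(𝔻)` over `(1/2, 3/2)`, bounded and Lipschitz with constant `M`. -/
structure IsTameCurve (M : ℝ) (x : ℝ → L2Disc) : Prop where
  contDiffOn : ContDiffOn ℝ ∞ x (Set.Ioo (1 / 2) (3 / 2))
  norm_le : ∀ s ∈ Set.Ioo (1 / 2 : ℝ) (3 / 2), ‖x s‖ ≤ M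
  lipschitz : ∀ s ∈ Set.Ioo (1 / 2 : ℝ) (3 / 2), ∀ t ∈ Set.Ioo (1 / 2 : ℝ) (3 / 2),
    ‖x s - x t‖ ≤ M * |s - t|

theorem IsTameCurve.mono {M M' : ℝ} {x : ℝ → L2Disc} (h : IsTameCurve M x) (hM : M ≤ M') :
    IsTameCurve M' x :=
  ⟨h.contDiffOn, fun s hs => (h.norm_le s hs).trans hM, fun s hs t ht =>
    (h.lipschitz s hs t ht).trans (mul_le_mul_of_nonneg_right hM (abs_nonneg _))⟩

/-- On `(1/2, 3/2)` both `s⁻¹ ≤ 2` and the Lipschitz constant of `s⁻¹` is at most `4`, which gives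
the factor `6`. -/
theorem IsTameCurve.neg_inv_smul {M : ℝ} {x : ℝ → L2Disc} (h : IsTameCurve M x) :
    IsTameCurve (6 * M) fun s => (-s⁻¹) • x s := by
  have hM : 0 ≤ M := (norm_nonneg _).trans (h.norm_le 1 (by norm_num))
  have hinv : ∀ s ∈ Set.Ioo (1 / 2 : ℝ) (3 / 2), 0 < s⁻¹ ∧ s⁻¹ ≤ 2 := fun s hs => by
    have : 0 < s := by linarith [hs.1]
    refine ⟨by positivity, ?_⟩
    rw [inv_le_comm₀ this two_pos]
    linarith [hs.1]
  refine ⟨(contDiffOn_id.inv fun s hs => by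
    have : 0 < s := by linarith [hs.1]
    exact this.ne').neg.smul h.contDiffOn, fun s hs => ?_, fun s hs t ht => ?_⟩
  · obtain ⟨h1, h2⟩ := hinv s hs
    rw [norm_smul, norm_neg, Real.norm_eq_abs, abs_of_pos h1]
    nlinarith [norm_nonneg (x s), h.norm_le s hs]
  · obtain ⟨h1, h2⟩ := hinv s hs
    obtain ⟨h3, h4⟩ := hinv t ht
    have hs0 : s ≠ 0 := by linarith [hs.1]
    have ht0 : t ≠ 0 := by linarith [ht.1]
    have e : (-s⁻¹) • x s - (-t⁻¹) • x t = (-s⁻¹) • (x s - x t) + (s⁻¹ * t⁻¹ * (s - t)) • x t := by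
      have : s⁻¹ * t⁻¹ * (s - t) = t⁻¹ - s⁻¹ := by field_simp
      rw [this]
      module
    rw [e]
    refine (norm_add_le _ _).trans ?_
    rw [norm_smul, norm_smul, norm_neg, Real.norm_eq_abs, Real.norm_eq_abs, abs_of_pos h1, abs_mul,
      abs_of_pos (mul_pos h1 h3)]
    have i1 : s⁻¹ * ‖x s - x t‖ ≤ 2 * (M * |s - t|) :=
      mul_le_mul h2 (h.lipschitz s hs t ht) (norm_nonneg _) zero_le_two
    have i2 : s⁻¹ * t⁻¹ ≤ 2 * 2 := mul_le_mul h2 h4 h3.le zero_le_two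
    have i3 : s⁻¹ * t⁻¹ * |s - t| * ‖x t‖ ≤ 2 * 2 * |s - t| * M := by
      gcongr
      exact h.norm_le t ht
    linarith

theorem mem_paramBall {a : ℝ × ℝ} (ha : a ∈ paramBall) : a.2 ∈ Set.Ioo (1 / 2 : ℝ) (3 / 2) := by
  rw [paramBall, mem_ball_iff_norm] at ha
  have h2 : ‖a.2 - 1‖ < 1 / 2 := lt_of_le_of_lt (le_max_right _ _) ha
  rw [Real.norm_eq_abs, abs_lt] at h2
  constructor <;> linarith [h2.1, h2.2]

/-- With relative scale `s` the chain rule gives `δ (δ s)⁻¹ = s⁻¹`, so the Lipschitz bound does not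
see `δ`. The restriction `δ ≤ 1/2` keeps `δ s` below `1`. -/
theorem Profile.exists_isTameCurve {q p h : ℝ → ℝ} (hs : IsRadialSolution q p)
    (hh : Profile q p h) :
    ∃ M : ℝ, ∀ b δ, |b| ≤ 1 → 0 < δ → δ ≤ 1 / 2 →
      IsTameCurve M fun s => scaledL2 h b (δ * s) := by
  obtain ⟨h', hh', hd⟩ := hh.exists_hasDerivAt hs
  obtain ⟨M, hM0, hM⟩ := hh.exists_norm_scaledL2_le hs
  obtain ⟨M', hM0', hM'⟩ := (hh.add hh').exists_norm_scaledL2_le hs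
  refine ⟨M + 2 * M', fun b δ hb hδ hδ1 => ⟨?_, fun s hs' => ?_, fun s hs' t ht' => ?_⟩⟩
  · refine (hh.contDiffOn_scaledL2 hs b).comp (contDiff_const.mul contDiff_id).contDiffOn
      fun s hs' => ?_
    exact mul_pos hδ (by linarith [hs'.1] : (0 : ℝ) < s)
  · have : 0 < s := by linarith [hs'.1]
    refine (hM b (δ * s) hb (by positivity) ?_).trans (by linarith)
    nlinarith [hs'.2]
  · have hder : ∀ r ∈ Set.Ioo (1 / 2 : ℝ) (3 / 2), HasDerivWithinAt (fun s => scaledL2 h b (δ * s))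
        (δ • -(δ * r)⁻¹ • scaledL2 (fun r => h r + h' r) b (δ * r)) (Set.Ioo (1 / 2) (3 / 2)) r := by
      intro r hr
      have hr0 : 0 < r := by linarith [hr.1]
      have h1 : HasDerivAt (fun s => δ * s) δ r := by simpa using (hasDerivAt_id r).const_mul δ
      exact (HasDerivAt.scomp r (hh.hasDerivAt_scaledL2 hs hh' hd b (by positivity))
        h1).hasDerivWithinAt
    have hmv := (convex_Ioo (1 / 2 : ℝ) (3 / 2)).norm_image_sub_le_of_norm_hasDerivWithin_le
      (C := M + 2 * M') hder (fun r hr => ?_) ht' hs'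
    · rwa [Real.norm_eq_abs] at hmv
    · have hr0 : 0 < r := by linarith [hr.1]
      have hb' := hM' b (δ * r) hb (by positivity) (by nlinarith [hr.2])
      have hinv : r⁻¹ ≤ 2 := by rw [inv_le_comm₀ hr0 two_pos]; linarith [hr.1]
      rw [smul_smul, norm_smul, Real.norm_eq_abs]
      have e : |δ * -(δ * r)⁻¹| = r⁻¹ := by
        rw [mul_neg, abs_neg, mul_inv, ← mul_assoc, mul_inv_cancel₀ hδ.ne', one_mul,
          abs_of_pos (by positivity)]
      rw [e]
      have := mul_le_mul hinv hb' (norm_nonneg _) zero_le_two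
      linarith

/-- `(θ, s) ↦ P_{≤N}(c e^{i(θ₀+θ)} x(s))`. -/
def frameVector (N : ℕ∞) (θ₀ : ℝ) (c : ℂ) (x : ℝ → L2Disc) (a : ℝ × ℝ) : cutoffSpace N :=
  cutoff N ((c * phase (θ₀ + a.1)) • x a.2)

theorem norm_cutoff_le (N : ℕ∞) (u : L2Disc) : ‖cutoff N u‖ ≤ ‖u‖ :=
  Submodule.norm_orthogonalProjectionOnto_apply_le _ _

theorem contDiffOn_frameVector (N : ℕ∞) (θ₀ : ℝ) (c : ℂ) {x : ℝ → L2Disc}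
    (hx : ContDiffOn ℝ ∞ x (Set.Ioo (1 / 2) (3 / 2))) :
    ContDiffOn ℝ ∞ (frameVector N θ₀ c x) paramBall := by
  have h1 : ContDiffOn ℝ ∞ (fun a : ℝ × ℝ => c * phase (θ₀ + a.1)) paramBall :=
    (contDiff_const.mul (contDiff_phase.comp (contDiff_const.add contDiff_fst))).contDiffOn
  have h2 : ContDiffOn ℝ ∞ (fun a : ℝ × ℝ => x a.2) paramBall :=
    hx.comp contDiff_snd.contDiffOn fun a ha => mem_paramBall ha
  exact (cutoff N).contDiff.comp_contDiffOn (h1.smul h2)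

theorem IsTameCurve.frameVector {M : ℝ} {x : ℝ → L2Disc} (h : IsTameCurve M x) (N : ℕ∞) (θ₀ : ℝ)
    {c : ℂ} (hc : ‖c‖ = 1) : IsTame (2 * M) (frameVector N θ₀ c x) := by
  have hM : 0 ≤ M := (norm_nonneg _).trans (h.norm_le 1 (by norm_num))
  refine ⟨contDiffOn_frameVector N θ₀ c h.contDiffOn, fun a ha => ?_, fun a ha b hb => ?_⟩
  · refine (norm_cutoff_le _ _).trans ?_
    rw [norm_smul, norm_mul, hc, norm_phase, one_mul, one_mul]
    linarith [h.norm_le _ (mem_paramBall ha)]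
  · rw [SolitonBundle.frameVector, SolitonBundle.frameVector, ← map_sub]
    refine (norm_cutoff_le _ _).trans ?_
    have e : (c * phase (θ₀ + a.1)) • x a.2 - (c * phase (θ₀ + b.1)) • x b.2 =
        (c * (phase (θ₀ + a.1) - phase (θ₀ + b.1))) • x a.2 +
          (c * phase (θ₀ + b.1)) • (x a.2 - x b.2) := by
      rw [mul_sub, sub_smul, smul_sub]; abel
    rw [e]
    refine (norm_add_le _ _).trans ?_
    rw [norm_smul, norm_smul, norm_mul, norm_mul, hc, norm_phase, one_mul, one_mul, one_mul]
    have h1 : ‖phase (θ₀ + a.1) - phase (θ₀ + b.1)‖ ≤ ‖a - b‖ := by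
      refine (norm_phase_sub_le _ _).trans ?_
      rw [add_sub_add_left_eq_sub]
      exact norm_fst_le (a - b)
    have h2 : |a.2 - b.2| ≤ ‖a - b‖ := norm_snd_le (a - b)
    have h3 := mul_le_mul h1 (h.norm_le _ (mem_paramBall ha)) (norm_nonneg _) (norm_nonneg _)
    have h4 := (h.lipschitz _ (mem_paramBall ha) _ (mem_paramBall hb)).trans
      (mul_le_mul_of_nonneg_left h2 hM)
    linarith

theorem hasFDerivAt_frameVector (N : ℕ∞) (θ₀ : ℝ) {x : ℝ → L2Disc} {x' : L2Disc} {a : ℝ × ℝ}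
    (hx : HasDerivAt x x' a.2) :
    HasFDerivAt (frameVector N θ₀ 1 x)
      ((ContinuousLinearMap.fst ℝ ℝ ℝ).smulRight (frameVector N θ₀ Complex.I x a) +
        (ContinuousLinearMap.snd ℝ ℝ ℝ).smulRight (cutoff N ((1 * phase (θ₀ + a.1)) • x'))) a := by
  have h1 : HasFDerivAt (fun a : ℝ × ℝ => 1 * phase (θ₀ + a.1)) _ a :=
    (((hasDerivAt_phase (θ₀ + a.1)).hasFDerivAt.comp a
      ((ContinuousLinearMap.fst ℝ ℝ ℝ).hasFDerivAt.const_add θ₀))).const_mul 1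
  have h2 : HasFDerivAt (fun a : ℝ × ℝ => x a.2) _ a :=
    hx.hasFDerivAt.comp a (ContinuousLinearMap.snd ℝ ℝ ℝ).hasFDerivAt
  refine ((cutoff N).hasFDerivAt.comp a (h1.smul h2)).congr_fderiv ?_
  ext1 <;> ext1 <;> simp [frameVector]

/-- Against elements of `E_N` a vector may be replaced by its projection, so the normals can be
taken inside `E_N`. -/
theorem inner_cutoff_right (N : ℕ∞) (v : cutoffSpace N) (y : L2Disc) :
    inner ℝ v (cutoff N y) = inner ℝ (v : L2Disc) y :=
  Submodule.inner_orthogonalProjectionOnto_eq_of_mem_left v y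

theorem conj_phase_mul (θ : ℝ) : (starRingEnd ℂ) (phase θ) * phase θ = 1 := by
  rw [mul_comm, Complex.mul_conj, Complex.normSq_eq_norm_sq, norm_phase]; simp

/-! ### The frame of the soliton manifold and its chart -/

/-- The common phase is unimodular and commutes with the cutoff, so it cancels: the frame pairings
do not depend on `θ`. -/
theorem inner_frameVector (N : ℕ∞) (θ₀ : ℝ) (c d : ℂ) (x y : ℝ → L2Disc) (a : ℝ × ℝ) :
    inner ℝ (frameVector N θ₀ c x a) (frameVector N θ₀ d y a) =
      inner ℝ (cutoff N (x a.2) : L2Disc) (((starRingEnd ℂ) c * d) • y a.2) := by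
  unfold frameVector
  rw [inner_cutoff_right, coe_cutoff_smul, inner_smul_complex, smul_smul, map_mul]
  congr 2
  linear_combination ((starRingEnd ℂ) c * d) * conj_phase_mul (θ₀ + a.1)

/-- The two-dimensional Laplacian of `q + r q'`. -/
def scalingLaplacian (q p : ℝ → ℝ) (r : ℝ) : ℝ :=
  3 * (q r - q r ^ 3) + (p r - 3 * q r ^ 2 * p r)

section

variable (q p : ℝ → ℝ) (N : ℕ∞) (θ₀ δ₀ : ℝ)

/-- `P_{≤N}(i e^{iθ} 𝐐_δ)` at `θ = θ₀ + a.1`, `δ = δ₀ a.2`. -/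
def phaseTangent : ℝ × ℝ → cutoffSpace N :=
  frameVector N θ₀ Complex.I fun s => scaledL2 q 1 (δ₀ * s)

/-- `P_{≤N}(-δ² Δ(i e^{iθ} 𝐐_δ))`. -/
def phaseNormal : ℝ × ℝ → cutoffSpace N :=
  frameVector N θ₀ (-Complex.I) fun s => scaledL2 (fun r => q r - q r ^ 3) 0 (δ₀ * s)

/-- `P_{≤N}(δ₀ e^{iθ} ∂_δ 𝐐_δ)`. -/
def scaleTangent : ℝ × ℝ → cutoffSpace N :=
  frameVector N θ₀ 1 fun s => (-s⁻¹) • scaledL2 (fun r => q r + p r) 1 (δ₀ * s)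

/-- `P_{≤N}(-δ³ Δ(e^{iθ} ∂_δ 𝐐_δ))`. -/
def scaleNormal : ℝ × ℝ → cutoffSpace N :=
  frameVector N θ₀ 1 fun s => scaledL2 (scalingLaplacian q p) 0 (δ₀ * s)

/-- `P_{≤N}(e^{iθ} 𝐐_δ)`. -/
def solitonMap : ℝ × ℝ → cutoffSpace N :=
  frameVector N θ₀ 1 fun s => scaledL2 q 1 (δ₀ * s)

end

section

variable {q p : ℝ → ℝ} {N : ℕ∞} {θ₀ δ₀ : ℝ} {a : ℝ × ℝ}

theorem solitonMap_eq (hs : IsRadialSolution q p) (hδ : 0 < δ₀ * a.2) :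
    cutoff N (soliton q (θ₀ + a.1) (δ₀ * a.2)) = solitonMap q N θ₀ δ₀ a := by
  rw [soliton_eq hs _ hδ, solitonMap, frameVector, one_mul]

/-- The component is unchanged when the tangent and its Laplacian are rescaled independently. The
singular powers of `δ` therefore disappear and frame vectors of size `O(1)` can be used. -/
theorem h1Coeff_smul_cutoff {t : Plane → ℂ} {x y : L2Disc} {α β : ℝ} (hα : α ≠ 0) (hβ : β ≠ 0)
    (hx : toL2 t = α • x) (hy : negLaplacian t = β • y) {T n : ℝ × ℝ → cutoffSpace N}
    (hT : T a = cutoff N x) (hn : n a = cutoff N y) (v : cutoffSpace N) :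
    h1Coeff N t v • cutoff N (toL2 t) = frameComponent T n a v := by
  rw [frameComponent, h1Coeff, hT, hn, inner_cutoff_right, inner_cutoff_right, hx, hy, map_smul,
    smul_smul, Submodule.coe_smul, real_inner_smul_left, real_inner_smul_right,
    real_inner_smul_right]
  congr 1
  field_simp

theorem toL2_tangentPhase_eq (hs : IsRadialSolution q p) (hδ : 0 < δ₀ * a.2) :
    toL2 (tangentPhase q (θ₀ + a.1) (δ₀ * a.2)) =
      (1 : ℝ) • (Complex.I * phase (θ₀ + a.1)) • scaledL2 q 1 (δ₀ * a.2) := by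
  rw [toL2_tangentPhase hs _ hδ, one_smul]

theorem negLaplacian_tangentPhase_eq (hs : IsRadialSolution q p) (hδ : 0 < δ₀ * a.2) :
    negLaplacian (tangentPhase q (θ₀ + a.1) (δ₀ * a.2)) = ((δ₀ * a.2) ^ 2)⁻¹ •
      (-Complex.I * phase (θ₀ + a.1)) • scaledL2 (fun r => q r - q r ^ 3) 0 (δ₀ * a.2) := by
  rw [negLaplacian_tangentPhase hs _ hδ, neg_smul, neg_mul, neg_smul, smul_neg]

theorem toL2_tangentScale_eq (hs : IsRadialSolution q p) (hδ : 0 < δ₀ * a.2) :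
    toL2 (tangentScale q (θ₀ + a.1) (δ₀ * a.2)) = δ₀⁻¹ • (1 * phase (θ₀ + a.1)) •
      (-a.2⁻¹) • scaledL2 (fun r => q r + p r) 1 (δ₀ * a.2) := by
  rw [toL2_tangentScale hs _ hδ, one_mul, smul_comm (phase (θ₀ + a.1)) (-a.2⁻¹), smul_smul, mul_neg,
    mul_inv]

theorem negLaplacian_tangentScale_eq (hs : IsRadialSolution q p) (hδ : 0 < δ₀ * a.2) :
    negLaplacian (tangentScale q (θ₀ + a.1) (δ₀ * a.2)) = ((δ₀ * a.2) ^ 3)⁻¹ •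
      (1 * phase (θ₀ + a.1)) • scaledL2 (scalingLaplacian q p) 0 (δ₀ * a.2) := by
  rw [negLaplacian_tangentScale hs _ hδ, one_mul]
  rfl

theorem normalProj_eq (hs : IsRadialSolution q p) (h₀ : 0 < δ₀) (ha : 0 < a.2)
    (v : cutoffSpace N) :
    normalProj q N (θ₀ + a.1) (δ₀ * a.2) v =
      v - frameComponent (phaseTangent q N θ₀ δ₀) (phaseNormal q N θ₀ δ₀) a v
        - frameComponent (scaleTangent q p N θ₀ δ₀) (scaleNormal q p N θ₀ δ₀) a v := by
  have hδ : 0 < δ₀ * a.2 := mul_pos h₀ ha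
  rw [normalProj,
    h1Coeff_smul_cutoff one_ne_zero (inv_ne_zero (pow_ne_zero 2 hδ.ne'))
      (toL2_tangentPhase_eq hs hδ) (negLaplacian_tangentPhase_eq hs hδ)
      (T := phaseTangent q N θ₀ δ₀) (n := phaseNormal q N θ₀ δ₀) rfl rfl,
    h1Coeff_smul_cutoff (inv_ne_zero h₀.ne') (inv_ne_zero (pow_ne_zero 3 hδ.ne'))
      (toL2_tangentScale_eq hs hδ) (negLaplacian_tangentScale_eq hs hδ)
      (T := scaleTangent q p N θ₀ δ₀) (n := scaleNormal q p N θ₀ δ₀) rfl rfl]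

theorem mem_normalCutoff_iff (hs : IsRadialSolution q p) (h₀ : 0 < δ₀) (ha : 0 < a.2)
    (v : cutoffSpace N) :
    (v : L2Disc) ∈ normalCutoff q N (θ₀ + a.1) (δ₀ * a.2) ↔
      inner ℝ v (phaseNormal q N θ₀ δ₀ a) = 0 ∧ inner ℝ v (scaleNormal q p N θ₀ δ₀ a) = 0 := by
  have hδ : 0 < δ₀ * a.2 := mul_pos h₀ ha
  have h2 := inv_ne_zero (pow_ne_zero 2 hδ.ne')
  have h3 := inv_ne_zero (pow_ne_zero 3 hδ.ne')
  have e : (v : L2Disc) ∈ normalCutoff q N (θ₀ + a.1) (δ₀ * a.2) ↔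
      ((v : L2Disc) ∈ L2rad ∧
        inner ℝ (v : L2Disc) (negLaplacian (tangentScale q (θ₀ + a.1) (δ₀ * a.2))) = 0 ∧
        inner ℝ (v : L2Disc) (negLaplacian (tangentPhase q (θ₀ + a.1) (δ₀ * a.2))) = 0) ∧
        (v : L2Disc) ∈ cutoffSpace N := Iff.rfl
  rw [e, negLaplacian_tangentScale_eq hs hδ, negLaplacian_tangentPhase_eq hs hδ,
    real_inner_smul_right, real_inner_smul_right, mul_eq_zero_iff_left h3,
    mul_eq_zero_iff_left h2, phaseNormal, scaleNormal, frameVector, frameVector,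
    inner_cutoff_right, inner_cutoff_right]
  exact ⟨fun h => ⟨h.1.2.2, h.1.2.1⟩, fun h => ⟨⟨cutoffSpace_le_L2rad N v.2, h.2, h.1⟩, v.2⟩⟩

theorem inner_phaseTangent_phaseNormal : inner ℝ (phaseTangent q N θ₀ δ₀ a)
    (phaseNormal q N θ₀ δ₀ a) = -inner ℝ (cutoff N (scaledL2 q 1 (δ₀ * a.2)) : L2Disc)
      (scaledL2 (fun r => q r - q r ^ 3) 0 (δ₀ * a.2)) := by
  rw [phaseTangent, phaseNormal, inner_frameVector]
  have : (starRingEnd ℂ) Complex.I * -Complex.I = -1 := by simp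
  rw [this, neg_one_smul, inner_neg_right]

theorem inner_scaleTangent_scaleNormal : inner ℝ (scaleTangent q p N θ₀ δ₀ a)
    (scaleNormal q p N θ₀ δ₀ a) = a.2⁻¹ *
      -inner ℝ (cutoff N (scaledL2 (fun r => q r + p r) 1 (δ₀ * a.2)) : L2Disc)
      (scaledL2 (scalingLaplacian q p) 0 (δ₀ * a.2)) := by
  rw [scaleTangent, scaleNormal, inner_frameVector, map_smul, Submodule.coe_smul,
    real_inner_smul_left, map_one, one_mul, one_smul]
  ring

theorem inner_phaseTangent_scaleNormal (hs : IsRadialSolution q p) (hδ : 0 < δ₀ * a.2) :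
    inner ℝ (phaseTangent q N θ₀ δ₀ a) (scaleNormal q p N θ₀ δ₀ a) = 0 := by
  have h1 := continuousOn_shifted hs.continuousOn 1 hδ
  have h2 := continuousOn_shifted ((isLaplaceTriple_scaling hs).profileΔ.continuousOn hs) 0 hδ
  rw [phaseTangent, scaleNormal, inner_frameVector]
  have : (starRingEnd ℂ) Complex.I * 1 = -Complex.I := by simp
  rw [this, neg_smul, inner_neg_right, neg_eq_zero]
  exact inner_cutoff_radial_I_smul h1 h2 N

theorem inner_scaleTangent_phaseNormal (hs : IsRadialSolution q p) (hδ : 0 < δ₀ * a.2) :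
    inner ℝ (scaleTangent q p N θ₀ δ₀ a) (phaseNormal q N θ₀ δ₀ a) = 0 := by
  have h1 := continuousOn_shifted ((isLaplaceTriple_scaling hs).profile.continuousOn hs) 1 hδ
  have h2 := continuousOn_shifted ((isLaplaceTriple_base hs).profileΔ.continuousOn hs) 0 hδ
  rw [scaleTangent, phaseNormal, inner_frameVector]
  have : (starRingEnd ℂ) 1 * -Complex.I = -Complex.I := by simp
  rw [this, neg_smul Complex.I, inner_neg_right, neg_eq_zero, map_smul, Submodule.coe_smul,
    real_inner_smul_left]
  have := inner_cutoff_radial_I_smul h1 h2 N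
  rw [scaledL2, scaledL2, this, mul_zero]

/-- Since each tangent is orthogonal to the normal of the other, removing one component does not
disturb the other condition. -/
theorem normalProj_mem (hs : IsRadialSolution q p) (h₀ : 0 < δ₀) (ha : 0 < a.2)
    (h1 : inner ℝ (phaseTangent q N θ₀ δ₀ a) (phaseNormal q N θ₀ δ₀ a) ≠ 0)
    (h2 : inner ℝ (scaleTangent q p N θ₀ δ₀ a) (scaleNormal q p N θ₀ δ₀ a) ≠ 0)
    (v : cutoffSpace N) :
    (normalProj q N (θ₀ + a.1) (δ₀ * a.2) v : L2Disc) ∈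
      normalCutoff q N (θ₀ + a.1) (δ₀ * a.2) := by
  have hδ : 0 < δ₀ * a.2 := mul_pos h₀ ha
  rw [mem_normalCutoff_iff hs h₀ ha, normalProj_eq hs h₀ ha]
  simp only [frameComponent, inner_sub_left, real_inner_smul_left,
    inner_phaseTangent_scaleNormal hs hδ, inner_scaleTangent_phaseNormal hs hδ]
  constructor <;> field_simp <;> ring

/-- The inclusion of `V ∩ E_N` into `E_N`. -/
def normalInclusion (q : ℝ → ℝ) (N : ℕ∞) (θ₀ δ₀ : ℝ) :
    normalCutoff q N θ₀ δ₀ →ₗᵢ[ℝ] cutoffSpace N where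
  toLinearMap := Submodule.inclusion inf_le_right
  norm_map' _ := rfl

theorem mem_range_normalInclusion (hs : IsRadialSolution q p) (h₀ : 0 < δ₀) (z : cutoffSpace N) :
    z ∈ Set.range (normalInclusion q N θ₀ δ₀) ↔
      inner ℝ z (phaseNormal q N θ₀ δ₀ (0, 1)) = 0 ∧
        inner ℝ z (scaleNormal q p N θ₀ δ₀ (0, 1)) = 0 := by
  rw [← mem_normalCutoff_iff hs h₀ one_pos]
  simp only [add_zero, mul_one]
  exact ⟨fun ⟨v, hv⟩ => hv ▸ v.2, fun hz => ⟨⟨z, hz⟩, rfl⟩⟩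

theorem completeSpace_normalCutoff (hs : IsRadialSolution q p) (h₀ : 0 < δ₀) :
    CompleteSpace (normalCutoff q N θ₀ δ₀) := by
  have hr : Set.range (normalInclusion q N θ₀ δ₀) =
      {z | inner ℝ z (phaseNormal q N θ₀ δ₀ (0, 1)) = 0} ∩
        {z | inner ℝ z (scaleNormal q p N θ₀ δ₀ (0, 1)) = 0} :=
    Set.ext fun z => mem_range_normalInclusion hs h₀ z
  have hc : IsClosed (Set.range (normalInclusion q N θ₀ δ₀)) := by
    rw [hr]
    exact (isClosed_eq (by fun_prop) continuous_const).inter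
      (isClosed_eq (by fun_prop) continuous_const)
  exact (completeSpace_iff_isComplete_range
    (normalInclusion q N θ₀ δ₀).isometry.isUniformInducing).2 hc.isComplete

/-- The chart provided by the bundle map when the tangent vectors are nondegenerate. -/
theorem exists_bundle_chart (hs : IsRadialSolution q p) {M μ : ℝ} (hM : 1 ≤ M)
    (h₀ : 0 < δ₀) (hμ : 0 < μ) (hμ1 : μ ≤ 1)
    (hx₁ : IsTameCurve M fun s => scaledL2 q 1 (δ₀ * s))
    (hx₂ : IsTameCurve M fun s => scaledL2 (fun r => q r + p r) 1 (δ₀ * s))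
    (hy₁ : IsTameCurve M fun s => scaledL2 (fun r => q r - q r ^ 3) 0 (δ₀ * s))
    (hy₂ : IsTameCurve M fun s => scaledL2 (scalingLaplacian q p) 0 (δ₀ * s))
    (hm₁ : ∀ a ∈ paramBall,
      μ ≤ inner ℝ (phaseTangent q N θ₀ δ₀ a) (phaseNormal q N θ₀ δ₀ a))
    (hm₂ : ∀ a ∈ paramBall,
      μ ≤ inner ℝ (scaleTangent q p N θ₀ δ₀ a) (scaleNormal q p N θ₀ δ₀ a)) :
    ∃ Φ : OpenPartialHomeomorph (ℝ × ℝ × normalCutoff q N θ₀ δ₀) (cutoffSpace N),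
      ((0, 1, 0) : ℝ × ℝ × normalCutoff q N θ₀ δ₀) ∈ Φ.source ∧
      (∀ p ∈ Φ.source, (p.1, p.2.1) ∈ paramBall) ∧
      Set.EqOn Φ (bundleMap q N θ₀ δ₀) Φ.source ∧
      ContDiffOn ℝ ∞ Φ Φ.source ∧
      ContDiffOn ℝ ∞ Φ.symm Φ.target ∧
      ∀ u : cutoffSpace N, ‖u - cutoff N (soliton q θ₀ δ₀)‖ ≤ μ ^ 4 / (1200 * (12 * M) ^ 8) →
        u ∈ Φ.target := by
  have := completeSpace_normalCutoff (N := N) (θ₀ := θ₀) hs h₀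
  have hI : ‖Complex.I‖ = 1 := Complex.norm_I
  have mono : ∀ {f : ℝ × ℝ → cutoffSpace N}, IsTame (2 * M) f → IsTame (12 * M) f := fun h =>
    ⟨h.contDiffOn, fun a ha => (h.norm_le a ha).trans (by linarith), fun a ha b hb =>
      (h.lipschitz a ha b hb).trans (mul_le_mul_of_nonneg_right (by linarith) (norm_nonneg _))⟩
  have ht₂ : IsTame (12 * M) (scaleTangent q p N θ₀ δ₀) := by
    have := hx₂.neg_inv_smul.frameVector N θ₀ norm_one
    rw [show 2 * (6 * M) = 12 * M by ring] at this
    exact this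
  have hbase : 0 < δ₀ * ((0, 1) : ℝ × ℝ).2 := by simpa using h₀
  obtain ⟨Φ, h1, h2, h3, h4, h5, h6⟩ := exists_frame_chart (normalInclusion q N θ₀ δ₀)
    (M := 12 * M) (by linarith) hμ hμ1 (F := solitonMap q N θ₀ δ₀)
    (t₁ := phaseTangent q N θ₀ δ₀) (t₂ := scaleTangent q p N θ₀ δ₀)
    (n₁ := phaseNormal q N θ₀ δ₀) (n₂ := scaleNormal q p N θ₀ δ₀)
    (contDiffOn_frameVector N θ₀ 1 hx₁.contDiffOn)
    (fun a ha => by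
      have ha0 : 0 < a.2 := by linarith [(mem_paramBall ha).1]
      have hlin : HasDerivAt (fun s => δ₀ * s) δ₀ a.2 := by
        simpa using (hasDerivAt_id a.2).const_mul δ₀
      have hd := HasDerivAt.scomp a.2 (Profile.base.hasDerivAt_scaledL2 hs .base' hs.hasDerivAt 1
        (mul_pos h₀ ha0)) hlin
      -- The derivative in the relative scale `s` is `δ₀ ∂_δ`, which is exactly the normalization of
      -- `scaleTangent`.
      have e : δ₀ • -(δ₀ * a.2)⁻¹ • scaledL2 (fun r => q r + p r) 1 (δ₀ * a.2) =
          (-a.2⁻¹) • scaledL2 (fun r => q r + p r) 1 (δ₀ * a.2) := by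
        rw [smul_smul]
        congr 1
        field_simp
      rw [e] at hd
      exact hasFDerivAt_frameVector N θ₀ hd)
    (mono (hx₁.frameVector N θ₀ hI)) ht₂
    (mono (hy₁.frameVector N θ₀ (by rw [norm_neg, hI])))
    (mono (hy₂.frameVector N θ₀ norm_one)) hm₁ hm₂ (inner_phaseTangent_scaleNormal hs hbase)
    (inner_scaleTangent_phaseNormal hs hbase) (mem_range_normalInclusion hs h₀)
  refine ⟨Φ, h1, h2, fun x hx => ?_, h4, h5, fun u hu => h6 u ?_⟩
  · have ha0 : 0 < x.2.1 := by linarith [(mem_paramBall (h2 x hx)).1]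
    rw [h3 hx, frameMap, bundleMap, solitonMap_eq (a := (x.1, x.2.1)) hs (mul_pos h₀ ha0),
      normalProj_eq (a := (x.1, x.2.1)) hs h₀ ha0]
    rfl
  · rw [← solitonMap_eq hs hbase]
    simpa using hu

end

/-! ### The normal bundle decomposition -/

theorem norm_fullSoliton_sub_soliton_le {q p : ℝ → ℝ} (hs : IsRadialSolution q p) (θ : ℝ) {δ : ℝ}
    (hδ : 0 < δ) :
    ‖fullSoliton q θ δ - soliton q θ δ‖ ≤ Real.sqrt discConst * |rescaled q δ 1| := by
  rw [fullSoliton_eq hs θ hδ, soliton_eq hs θ hδ, ← smul_sub, norm_smul, norm_phase, one_mul,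
    scaledL2, scaledL2, ← radial_sub (continuousOn_shifted hs.continuousOn 0 hδ)
    (continuousOn_shifted hs.continuousOn 1 hδ)]
  have e : (fun r => shifted q 0 δ r - shifted q 1 δ r) = fun _ => rescaled q δ 1 := by
    ext r; simp [shifted]
  rw [e]
  exact norm_radial_le continuousOn_const fun _ _ _ => le_rfl

/-- A point in the image of the bundle map is a soliton plus a vector of its normal space. -/
theorem exists_normal_form_of_bundleMap_eq {q p : ℝ → ℝ} {N : ℕ∞} {θ₀ δ₀ : ℝ}
    (hs : IsRadialSolution q p) (h₀ : 0 < δ₀)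
    (hm₁ : ∀ a ∈ paramBall, 0 < inner ℝ (phaseTangent q N θ₀ δ₀ a) (phaseNormal q N θ₀ δ₀ a))
    (hm₂ : ∀ a ∈ paramBall, 0 < inner ℝ (scaleTangent q p N θ₀ δ₀ a) (scaleNormal q p N θ₀ δ₀ a))
    {x : ℝ × ℝ × normalCutoff q N θ₀ δ₀} (hx : (x.1, x.2.1) ∈ paramBall) {w : cutoffSpace N}
    (hw : bundleMap q N θ₀ δ₀ x = w) :
    ∃ θ δ : ℝ, 0 < δ ∧ ∃ v ∈ normalCutoff q N θ δ,
      (w : L2Disc) = (cutoff N (soliton q θ δ) : L2Disc) + v := by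
  have hx0 : 0 < x.2.1 := by linarith [(mem_paramBall hx).1]
  have hm := normalProj_mem hs h₀ hx0 (hm₁ _ hx).ne' (hm₂ _ hx).ne' ⟨(x.2.2 : L2Disc), x.2.2.2.2⟩
  refine ⟨θ₀ + x.1, δ₀ * x.2.1, mul_pos h₀ hx0, _, hm, ?_⟩
  rw [← hw, bundleMap, Submodule.coe_add]

/-- The lower endpoint of the range of scales. -/
def lowerScale (δsup : ℝ) : ℕ∞ → ℝ
  | none => 0
  | some N => min (N : ℝ)⁻¹ (δsup / 2)

/-- Uniform nondegeneracy of a tangent direction for the scales above `lowerScale`. -/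
theorem exists_coercive_lowerScale {q p ψ ψ₁ γ : ℝ → ℝ} (hs : IsRadialSolution q p)
    (ht : IsLaplaceTriple q p ψ ψ₁ γ) :
    ∃ c δ₁ : ℝ, 0 < c ∧ 0 < δ₁ ∧ ∀ δsup, 0 < δsup → δsup ≤ 1 → δsup ≤ δ₁ → ∀ N : ℕ∞, IsDyadic N →
      ∀ δ₀ ∈ Set.Ioo (lowerScale δsup N) δsup, ∀ s ∈ Set.Ioo (1 / 2 : ℝ) (3 / 2),
        c * δsup ^ 4 ≤ -inner ℝ (cutoff N (scaledL2 ψ 1 (δ₀ * s)) : L2Disc)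
          (scaledL2 γ 0 (δ₀ * s)) := by
  obtain ⟨c, δ₁, hc, hδ₁, h⟩ := exists_coercive hs ht
  refine ⟨c / 4 ^ 4, δ₁ / 2, by positivity, by positivity, fun δsup hpos h1 hle N hN δ₀ hδ₀ s hs' => ?_⟩
  have hs0 : 0 < s := by linarith [hs'.1]
  have hlow : c / 4 ^ 4 * δsup ^ 4 ≤ c := by
    have : δsup ^ 4 ≤ 1 := pow_le_one₀ hpos.le h1
    nlinarith
  have hδle : 0 < δ₀ → δ₀ * s ≤ δ₁ := fun h0 => by
    have := hδ₀.2
    nlinarith [hs'.2]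
  rcases hN with rfl | ⟨k, rfl⟩
  · have h0 : 0 < δ₀ := hδ₀.1
    exact hlow.trans (h _ (by positivity) (hδle h0)).1
  · have hN1 : 1 ≤ 2 ^ k := Nat.one_le_two_pow
    have hN0 : (0 : ℝ) < ((2 ^ k : ℕ) : ℝ) := by exact_mod_cast hN1
    have hlt : min (((2 ^ k : ℕ) : ℝ))⁻¹ (δsup / 2) < δ₀ := hδ₀.1
    have h0 : 0 < δ₀ := lt_trans (by positivity) hlt
    obtain ⟨hA, hB⟩ := (h _ (by positivity) (hδle h0)).2 (2 ^ k) hN1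
    -- Either `δ₀ > N⁻¹`, and then `N δ₀ s ≥ 1/2` puts the scale in the uniform regime; or `δ₀ >
    -- δsup / 2`, and then `δ₀ s ≥ δsup / 4` makes the bound `c (δ₀ s)⁴` sufficient, which accounts
    -- for the factor `4⁴`.
    rcases min_lt_iff.1 hlt with h2 | h2
    · refine hlow.trans (hB ?_)
      rw [inv_lt_iff_one_lt_mul₀ hN0] at h2
      nlinarith [hs'.1]
    · refine le_trans ?_ hA
      have h3 : δsup / 4 ≤ δ₀ * s := by nlinarith [hs'.1]
      calc c / 4 ^ 4 * δsup ^ 4 = c * (δsup / 4) ^ 4 := by ring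
        _ ≤ c * (δ₀ * s) ^ 4 := by gcongr

end SolitonBundle

end

open SolitonBundle in
/-- Phases are represented by real numbers: the source of `Φ` is an open subset of
`ℝ × ℝ × (V ∩ E_N)` on which the (`2π`-periodic in `θ`) map is injective, so it embeds as an open
subset of `𝕋 × ℝ × (V ∩ E_N)`. -/
theorem theorem5p1 (q : ℝ → ℝ) (hq : IsGroundState q) :
    ∃ C : ℝ, 0 < C ∧ ∀ η : ℝ, 0 < η → ∃ ε₀ : ℝ, 0 < ε₀ ∧ ∀ ε : ℝ, 0 < ε → ε ≤ ε₀ →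
      ∃ δsup K : ℝ, 0 < δsup ∧ δsup < η ∧ 0 < K ∧ ∀ N : ℕ∞, IsDyadic N →
        ∃ δinf : ℝ, invScale N ≤ K * δinf ∧ δinf ≤ C * invScale N ∧ δinf < δsup ∧
          (∀ θ₀ : ℝ, ∀ δ₀ ∈ Set.Ioo δinf δsup,
            ∃ Φ : OpenPartialHomeomorph (ℝ × ℝ × normalCutoff q N θ₀ δ₀) (cutoffSpace N),
              ((0, 1, 0) : ℝ × ℝ × normalCutoff q N θ₀ δ₀) ∈ Φ.source ∧
              (∀ p ∈ Φ.source, 0 < p.2.1) ∧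
              Set.EqOn Φ (bundleMap q N θ₀ δ₀) Φ.source ∧
              ContDiffOn ℝ ∞ Φ Φ.source ∧
              ContDiffOn ℝ ∞ Φ.symm Φ.target ∧
              ∀ u : cutoffSpace N, ‖u - cutoff N (soliton q θ₀ δ₀)‖ ≤ 2 * ε → u ∈ Φ.target) ∧
          (∀ u ∈ neighborhood q ε δinf δsup,
            ∃ θ δ : ℝ, 0 < δ ∧ ∃ v ∈ normalCutoff q N θ δ,
              (cutoff N u : L2Disc) = (cutoff N (soliton q θ δ) : L2Disc) + v) := by
  have hs := hq.isRadialSolution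
  set p : ℝ → ℝ := fun r => r * deriv q r
  obtain ⟨M₁, hM₁⟩ := (isLaplaceTriple_base hs).profile.exists_isTameCurve hs
  obtain ⟨M₂, hM₂⟩ := (isLaplaceTriple_scaling hs).profile.exists_isTameCurve hs
  obtain ⟨M₃, hM₃⟩ := (isLaplaceTriple_base hs).profileΔ.exists_isTameCurve hs
  obtain ⟨M₄, hM₄⟩ := (isLaplaceTriple_scaling hs).profileΔ.exists_isTameCurve hs
  obtain ⟨c₁, d₁, hc₁, hd₁, hcoer₁⟩ := exists_coercive_lowerScale hs (isLaplaceTriple_base hs)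
  obtain ⟨c₂, d₂, hc₂, hd₂, hcoer₂⟩ := exists_coercive_lowerScale hs (isLaplaceTriple_scaling hs)
  -- The chart radius will be `D δsup¹⁶`; order `17` makes the boundary value `Q_δ(1)` smaller than
  -- it by one factor of `δsup`.
  obtain ⟨A, hA0, hA⟩ := (isLaplaceTriple_base hs).profile.exists_rescaled_one_le hs 17
  set M : ℝ := max 1 (max (max M₁ M₂) (max M₃ M₄)) with hM
  have hM1 : 1 ≤ M := le_max_left _ _
  have hMM : max (max M₁ M₂) (max M₃ M₄) ≤ M := le_max_right _ _
  have hMa : M₁ ≤ M := (le_max_left _ _).trans ((le_max_left _ _).trans hMM)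
  have hMb : M₂ ≤ M := (le_max_right _ _).trans ((le_max_left _ _).trans hMM)
  have hMc : M₃ ≤ M := (le_max_left _ _).trans ((le_max_right _ _).trans hMM)
  have hMd : M₄ ≤ M := (le_max_right _ _).trans ((le_max_right _ _).trans hMM)
  -- The halving absorbs the factor `a.2⁻¹ > 2/3` in the scaling pairing, bounded below by `1/2`.
  set c : ℝ := min 1 (min c₁ c₂) / 2 with hc
  have hc0 : 0 < c := by positivity
  have hc1 : c ≤ 1 / 2 := by rw [hc]; linarith [min_le_left 1 (min c₁ c₂)]
  have hcc₁ : c ≤ c₁ / 2 := by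
    rw [hc]; linarith [(min_le_right 1 (min c₁ c₂)).trans (min_le_left c₁ c₂)]
  have hcc₂ : c ≤ c₂ / 2 := by
    rw [hc]; linarith [(min_le_right 1 (min c₁ c₂)).trans (min_le_right c₁ c₂)]
  set D : ℝ := c ^ 4 / (1200 * (12 * M) ^ 8) with hD
  have hD0 : 0 < D := by positivity
  set W : ℝ := Real.sqrt discConst with hW
  refine ⟨1, one_pos, fun η hη => ?_⟩
  -- The last entry makes `W A δsup¹⁷ ≤ r / 2`. The choice depends on `η` but not on `ε`.
  set δsup : ℝ := min (η / 2) (min (1 / 2) (min (min d₁ d₂) (D / (2 * (W * A + 1))))) with hδsup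
  have hδ0 : 0 < δsup := by positivity
  have hδη : δsup ≤ η / 2 := min_le_left _ _
  have hδr : δsup ≤ min (1 / 2) (min (min d₁ d₂) (D / (2 * (W * A + 1)))) := min_le_right _ _
  have hδhalf : δsup ≤ 1 / 2 := hδr.trans (min_le_left _ _)
  have hδr2 := hδr.trans (min_le_right _ _)
  have hδd₁ : δsup ≤ d₁ := (hδr2.trans (min_le_left _ _)).trans (min_le_left _ _)
  have hδd₂ : δsup ≤ d₂ := (hδr2.trans (min_le_left _ _)).trans (min_le_right _ _)
  have hδD : δsup ≤ D / (2 * (W * A + 1)) := hδr2.trans (min_le_right _ _)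
  set r : ℝ := D * δsup ^ 16 with hr
  have hr0 : 0 < r := by positivity
  set μ : ℝ := c * δsup ^ 4 with hμ
  have hμ0 : 0 < μ := by positivity
  have hμ1 : μ ≤ 1 := by
    have : δsup ^ 4 ≤ 1 := pow_le_one₀ hδ0.le (by linarith)
    nlinarith
  have hrμ : r = μ ^ 4 / (1200 * (12 * M) ^ 8) := by rw [hr, hD, hμ]; ring
  -- With `ε ≤ r / 4` both `2 ε` and `ε + r / 2` are at most `r`. In `K = 1 + 2 / δsup` the two
  -- summands serve the cases `δinf = N⁻¹` and `δinf = δsup / 2`.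
  refine ⟨r / 4, by positivity, fun ε hε hεr => ⟨δsup, 1 + 2 / δsup, hδ0, by linarith,
    by positivity, fun N hN => ⟨lowerScale δsup N, ?_, ?_, ?_, ?_⟩⟩⟩
  · cases N with
    | top => exact (mul_zero _).ge
    | coe n =>
      change (n : ℝ)⁻¹ ≤ (1 + 2 / δsup) * min (n : ℝ)⁻¹ (δsup / 2)
      have hn0 : 0 ≤ (n : ℝ)⁻¹ := by positivity
      have hn1 : (n : ℝ)⁻¹ ≤ 1 := Nat.cast_inv_le_one n
      have h2 : 0 < 2 / δsup := by positivity
      rcases min_choice (n : ℝ)⁻¹ (δsup / 2) with h | h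
      · rw [h]; nlinarith
      · rw [h]
        have : (1 + 2 / δsup) * (δsup / 2) = δsup / 2 + 1 := by field_simp
        linarith
  · cases N with
    | top => exact (mul_zero _).ge
    | coe n =>
      rw [one_mul]
      exact min_le_left _ _
  · cases N with
    | top => exact hδ0
    | coe n => exact (min_le_right _ _).trans_lt (by linarith)
  · have hlow0 : 0 ≤ lowerScale δsup N := by
      cases N with
      | top => exact le_rfl
      | coe n => exact le_min (by positivity) (by positivity)
    have hm₁ : ∀ θ₀, ∀ δ₀ ∈ Set.Ioo (lowerScale δsup N) δsup, ∀ a ∈ paramBall,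
        μ ≤ inner ℝ (phaseTangent q N θ₀ δ₀ a) (phaseNormal q N θ₀ δ₀ a) := by
      intro θ₀ δ₀ hδ₀ a ha
      rw [inner_phaseTangent_phaseNormal]
      refine le_trans ?_ (hcoer₁ δsup hδ0 (by linarith) hδd₁ N hN δ₀ hδ₀ _ (mem_paramBall ha))
      exact mul_le_mul_of_nonneg_right (by linarith) (by positivity)
    have hm₂ : ∀ θ₀, ∀ δ₀ ∈ Set.Ioo (lowerScale δsup N) δsup, ∀ a ∈ paramBall,
        μ ≤ inner ℝ (scaleTangent q p N θ₀ δ₀ a) (scaleNormal q p N θ₀ δ₀ a) := by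
      intro θ₀ δ₀ hδ₀ a ha
      rw [inner_scaleTangent_scaleNormal]
      have h1 := hcoer₂ δsup hδ0 (by linarith) hδd₂ N hN δ₀ hδ₀ _ (mem_paramBall ha)
      have ha2 := mem_paramBall ha
      have ha0 : 0 < a.2 := by linarith [ha2.1]
      have hinv : 1 / 2 ≤ a.2⁻¹ := by
        rw [le_inv_comm₀ (by norm_num) ha0]; linarith [ha2.2]
      calc μ ≤ 1 / 2 * (c₂ * δsup ^ 4) := by
            have : c * δsup ^ 4 ≤ c₂ / 2 * δsup ^ 4 := by gcongr
            linarith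
        _ ≤ _ := mul_le_mul hinv h1 (by positivity) (by positivity)
    have hchart := fun θ₀ δ₀ (hδ₀ : δ₀ ∈ Set.Ioo (lowerScale δsup N) δsup) =>
      have h₀ : 0 < δ₀ := hlow0.trans_lt hδ₀.1
      have hle : δ₀ ≤ 1 / 2 := hδ₀.2.le.trans hδhalf
      exists_bundle_chart (N := N) (θ₀ := θ₀) hs hM1 h₀ hμ0 hμ1
        ((hM₁ 1 δ₀ (by norm_num) h₀ hle).mono hMa) ((hM₂ 1 δ₀ (by norm_num) h₀ hle).mono hMb)
        ((hM₃ 0 δ₀ (by norm_num) h₀ hle).mono hMc) ((hM₄ 0 δ₀ (by norm_num) h₀ hle).mono hMd)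
        (hm₁ θ₀ δ₀ hδ₀) (hm₂ θ₀ δ₀ hδ₀)
    refine ⟨fun θ₀ δ₀ hδ₀ => ?_, ?_⟩
    · obtain ⟨Φ, h1, h2, h3, h4, h5, h6⟩ := hchart θ₀ δ₀ hδ₀
      exact ⟨Φ, h1, fun x hx => by linarith [(mem_paramBall (h2 x hx)).1], h3, h4, h5,
        fun u hu => h6 u (by rw [← hrμ]; linarith)⟩
    · rintro u ⟨-, -, θ₀, δ₀, hδ₀, hu⟩
      have h₀ : 0 < δ₀ := hlow0.trans_lt hδ₀.1
      obtain ⟨Φ, -, h2, h3, -, -, h6⟩ := hchart θ₀ δ₀ hδ₀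
      -- The cutoff is a contraction, so the distance is at most `ε` to the full soliton plus `r /
      -- 2` for removing its boundary value.
      have hdist : ‖cutoff N u - cutoff N (soliton q θ₀ δ₀)‖ ≤ r := by
        rw [← map_sub]
        refine (norm_cutoff_le _ _).trans ?_
        have h7 := norm_sub_le_norm_sub_add_norm_sub u (fullSoliton q θ₀ δ₀) (soliton q θ₀ δ₀)
        have h8 := norm_fullSoliton_sub_soliton_le hs θ₀ h₀
        have h9 : W * |rescaled q δ₀ 1| ≤ r / 2 := by
          have hpow : δ₀ ^ 17 ≤ δsup ^ 17 := pow_le_pow_left₀ h₀.le hδ₀.2.le 17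
          have hW0 : 0 ≤ W := Real.sqrt_nonneg _
          have h10 : W * |rescaled q δ₀ 1| ≤ W * A * δsup ^ 17 := by
            rw [mul_assoc]
            refine mul_le_mul_of_nonneg_left ((hA δ₀ h₀).trans ?_) hW0
            gcongr
          rw [le_div_iff₀ (by positivity)] at hδD
          have h11 : W * A * δsup ≤ D / 2 := by linarith
          calc W * |rescaled q δ₀ 1| ≤ W * A * δsup * δsup ^ 16 := by
                refine h10.trans (le_of_eq ?_); ring
            _ ≤ D / 2 * δsup ^ 16 := by gcongr
            _ = r / 2 := by rw [hr]; ring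
        linarith
      have hmem : cutoff N u ∈ Φ.target := h6 _ (by rw [← hrμ]; exact hdist)
      have hx : Φ.symm (cutoff N u) ∈ Φ.source := Φ.map_target hmem
      exact exists_normal_form_of_bundleMap_eq hs h₀
        (fun a ha => hμ0.trans_le (hm₁ θ₀ δ₀ hδ₀ a ha))
        (fun a ha => hμ0.trans_le (hm₂ θ₀ δ₀ hδ₀ a ha)) (h2 _ hx)
        ((h3 hx).symm.trans (Φ.right_inv hmem))
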